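/- **Conventions.** A Lorentzian pre-length space is a metric space $(X,d)$ with a reflexive transitive relation $\le$, a transitive relation $\ll$ contained in $\le$, and a lower semicontinuous $\tau:X\times X\to[0,\infty]$ with $\tau(x,z)\ge\tau(x,y)+\tau(y,z)$ for $x\le y\le z$, $\tau(x,y)=0$ if $x\not\le y$, and $\tau(x,y)>0\iff x\ll y$. Put $\tau_s(x,y)=\max\{\tau(x,y),\tau(y,x)\}$. Causal (timelike) curves are continuous curves that are monotone for $\le$ (strictly monotone for $\ll$). A geodesic is a causal curve whose $\tau$-length between any two of its points equals their time separation. $X$ is *regular* if every geodesic between timelike related points contains no null segment (so it is timelike up to parametrization), and *strongly causal* if the metric topology is generated by the diamonds $\{z: x\ll z\ll y\}$. $\mathbb L^2(K)$ is the simply connected two-dimensional Lorentzian model space of constant curvature $K$ (the Minkowski plane for $K=0$, the universal cover of scaled de Sitter space for $K>0$ and of scaled anti-de Sitter space for $K<0$), and $D_K=\pi/\sqrt{-K}$ for $K<0$, $D_K=\infty$ for $K\ge0$. A timelike triangle $\triangle(a,b,c)$ consists of three pairwise timelike related points, in any order, with timelike geodesics $[a,b],[a,c],[b,c]$. A comparison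 triangle is a timelike triangle $\triangle(\bar a,\bar b,\bar c)$ in $\mathbb L^2(K)$ with the same (directed) side lengths, all of them less than $D_K$. The comparison point of $p\in[x,y]$ is the point $\bar p\in[\bar x,\bar y]$ with $\tau_s(\bar x,\bar p)=\tau_s(x,p)$. The comparison angle $\widetilde\measuredangle^K_a(b,c)$ is the hyperbolic angle at $\bar a$ in $\triangle(\bar a,\bar b,\bar c)$. For timelike geodesics $\alpha,\beta$ starting at $p$, the angle is $\measuredangle_p(\alpha,\beta)=\limsup_{s,t\to0}\widetilde\measuredangle^K_p(\alpha(s),\beta(t))\in[0,\infty]$, taken over those $s,t$ for which a comparison triangle exists, and $\measuredangle_a(b,c)$ is the angle between the sides $[a,b]$ and $[a,c]$. An open set $U\subseteq X$ is a $(\le K)$-comparison neighbourhood if (1) $\{(x,y)\in U\times U:\tau(x,y)<D_K\}$ is open and $\tau$ is continuous on it; (2) any $x\ll y$ in $U$ with $\tau(x,y)<D_K$ are joined by a geodesic contained in $U$; (3) for every timelike triangle whose sides lie in $U$, every comparison triangle in $\mathbb L^2(K)$, and all points $p,q$ on the sides with comparison points $\bar p,\bar q$, one has $\tau(p,q)\ge\tau(\bar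 p,\bar q)$. It is causally closed if $\le$ is closed in $U\times U$. **Proposition 4.1 (Rigidity of upper curvature bounds).** Let $X$ be a strongly causal, regular Lorentzian pre-length space, let $K\in\mathbb R$, and let $\triangle(a,b,c)$ be a timelike triangle, with any order of the vertices, whose sides lie in a causally closed $(\le K)$-comparison neighbourhood $U\subseteq X$. Let $\triangle(\bar a,\bar b,\bar c)$ be a comparison triangle in $\mathbb L^2(K)$. The following are equivalent: 1. $\measuredangle_a(b,c)=\widetilde\measuredangle^K_a(b,c)$. 2. All three angles of $\triangle(a,b,c)$ equal the corresponding angles of $\triangle(\bar a,\bar b,\bar c)$. 3. For every $x\in[a,c]$ with $x\ne a,c$, the comparison point $\bar x$ satisfies $\tau_s(b,x)=\tau_s(\bar b,\bar x)$. 4. There is $x\in[a,c]$ with $x\neq a,c$ whose comparison point $\bar x$ satisfies $\tau_s(b,x)=\tau_s(\bar b,\bar x)>0$. 5. There is a map $f$ from the filled-in triangle $\mathrm{conv}\{\bar a,\bar b,\bar c\}\subseteq\mathbb L^2(K)$ (the geodesic convex hull) into $U$ that is an isometry onto its image, i.e. it is injective, $\tau(f(x),f(y))=\tau(x,y)$,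 and $f(x)\le f(y)\iff x\le y$. It maps each side of $\triangle(\bar a,\bar b,\bar c)$ onto the corresponding side of $\triangle(a,b,c)$, and its image is geodesically convex, i.e. any two points $x\le y$ of the image are joined by a geodesic that stays in the image. -/

import Mathlib

open Set Filter Topology
open scoped ENNReal unitInterval

noncomputable section

namespace Lorentz

/-- The causal relation `≤`, the timelike relation `≪` and the time separation `τ`, as bare data.
The axioms are in `LorentzianPreLengthSpace`. -/
class CausalData (X : Type*) where
  causal : X → X → Prop
  chron : X → X → Prop
  tau : X → X → ℝ≥0∞

open CausalData

/-- Lorentzian pre-length spaces `(X, d, ≤, ≪, τ)`. -/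
class LorentzianPreLengthSpace (X : Type*) [MetricSpace X] extends CausalData X where
  causal_refl : ∀ x : X, causal x x
  causal_trans : ∀ x y z : X, causal x y → causal y z → causal x z
  chron_trans : ∀ x y z : X, chron x y → chron y z → chron x z
  causal_of_chron : ∀ x y : X, chron x y → causal x y
  tau_lowerSemicontinuous : LowerSemicontinuous fun p : X × X => tau p.1 p.2
  tau_add_le : ∀ x y z : X, causal x y → causal y z → tau x y + tau y z ≤ tau x z
  tau_eq_zero : ∀ x y : X, ¬ causal x y → tau x y = 0
  tau_pos_iff : ∀ x y : X, 0 < tau x y ↔ chron x y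

/-- The order independent time separation `τ_s`. -/
def tauSym {X : Type*} [CausalData X] (x y : X) : ℝ≥0∞ := max (tau x y) (tau y x)

/-! ### Curves and geodesics -/

section Curves

variable {X : Type*} [MetricSpace X] [LorentzianPreLengthSpace X]

/-- The `τ`-length of the restriction of `γ` to `[s, t]`: the infimum of
`∑ τ (γ uᵢ) (γ uᵢ₊₁)` over all partitions `s = u₀ < ⋯ < uₙ = t`. -/
def tauLength {x y : X} (γ : Path x y) (s t : I) : ℝ≥0∞ :=
  ⨅ (n : ℕ) (u : Fin (n + 1) → I) (_ : StrictMono u) (_ : u 0 = s) (_ : u (Fin.last n) = t),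
    ∑ i : Fin n, tau (γ (u i.castSucc)) (γ (u i.succ))

/-- Future-directed geodesics: continuous causal curves from `x` to `y` that realise the time
separation between any two of their points. -/
def IsFutureGeodesic {x y : X} (γ : Path x y) : Prop :=
  (∀ s t : I, s ≤ t → causal (γ s) (γ t)) ∧
    ∀ s t : I, s ≤ t → tau (γ s) (γ t) = tauLength γ s t

/-- Future-directed timelike geodesics. -/
def IsFutureTimelikeGeodesic {x y : X} (γ : Path x y) : Prop :=
  IsFutureGeodesic γ ∧ ∀ s t : I, s < t → chron (γ s) (γ t)

/-- Timelike geodesics from `x` to `y`, future- or past-directed. -/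
def IsTimelikeGeodesic {x y : X} (γ : Path x y) : Prop :=
  IsFutureTimelikeGeodesic γ ∨ IsFutureTimelikeGeodesic γ.symm

/-- A set is geodesically convex if any two causally related points of it are joined by a geodesic
that stays inside. -/
def GeodesicallyConvex (S : Set X) : Prop :=
  ∀ x ∈ S, ∀ y ∈ S, causal x y → ∃ γ : Path x y, IsFutureGeodesic γ ∧ range γ ⊆ S

end Curves

section Space

variable (X : Type*) [MetricSpace X] [LorentzianPreLengthSpace X]

/-- `X` is regular: a geodesic between timelike related points does not contain a null segment. -/
def Regular : Prop :=
  ∀ (x y : X) (γ : Path x y), chron x y → IsFutureGeodesic γ →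
    ∀ s t : I, s < t → γ s ≠ γ t → chron (γ s) (γ t)

/-- `X` is strongly causal: the metric topology is the Alexandrov topology, which is generated by
the chronological diamonds `I⁺(x) ∩ I⁻(y)`. -/
def StronglyCausal : Prop :=
  (inferInstance : TopologicalSpace X) =
    TopologicalSpace.generateFrom {D | ∃ x y : X, D = {z | chron x z ∧ chron z y}}

variable {X}

/-- `U` is causally closed: the relation `≤` is closed in `U × U`. -/
def CausallyClosed (U : Set X) : Prop :=
  IsClosed {p : U × U | causal (p.1 : X) (p.2 : X)}

end Space

/-! ### The model spaces

For `K = 0` this is the Minkowski plane with coordinates `(t, x)`. For `K ≠ 0` it is the universal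
cover of the two-dimensional de Sitter space (`0 < K`) resp. anti-de Sitter space (`K < 0`) of
radius `1 / √|K|`, in global conformal coordinates `(t, x)`. The metric is
`(1 / K) * (cos t)⁻² * (-dt² + dx²)` on `|t| < π / 2` for `0 < K`, and
`(1 / |K|) * (cos x)⁻² * (-dt² + dx²)` on `|x| < π / 2` for `K < 0`. -/

/-- The Lorentzian model space `𝕃²(K)` of constant curvature `K`. -/
def Model (K : ℝ) : Type :=
  {p : ℝ × ℝ // (0 < K → |p.1| < Real.pi / 2) ∧ (K < 0 → |p.2| < Real.pi / 2)}

namespace Model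

variable {K : ℝ}

/-- The time coordinate. -/
def t (p : Model K) : ℝ := p.1.1

/-- The space coordinate. -/
def x (p : Model K) : ℝ := p.1.2

/-- The ambient scalar product on `ℝ³`: signature `(-, +, +)` for `0 ≤ K` and `(-, -, +)` for
`K < 0`. -/
def form (K : ℝ) (v w : Fin 3 → ℝ) : ℝ :=
  -(v 0 * w 0) + (if K < 0 then -(v 1 * w 1) else v 1 * w 1) + v 2 * w 2

/-- The map to `ℝ³`: onto a plane for `K = 0`, and otherwise the covering map onto the unit
pseudosphere `form K v v = 1` (for `0 < K`) resp. `form K v v = -1` (for `K < 0`). -/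
def embed (p : Model K) : Fin 3 → ℝ :=
  if 0 < K then ![Real.tan p.t, Real.cos p.x / Real.cos p.t, Real.sin p.x / Real.cos p.t]
  else if K < 0 then ![Real.cos p.t / Real.cos p.x, Real.sin p.t / Real.cos p.x, Real.tan p.x]
  else ![p.t, p.x, 0]

/-- The causal and timelike relations and the time separation of `𝕃²(K)`. In the case `K < 0`, the
points `q` with `π < (q.t - p.t) + |p.x + q.x|` are those that are reached from `p` by causal
curves of arbitrarily large length. -/
instance : CausalData (Model K) where
  causal p q := |q.x - p.x| ≤ q.t - p.t
  chron p q := |q.x - p.x| < q.t - p.t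
  tau p q :=
    if |q.x - p.x| ≤ q.t - p.t then
      if 0 < K then ENNReal.ofReal (Real.arcosh (form K p.embed q.embed) / √K)
      else if K < 0 then
        if q.t - p.t + |p.x + q.x| ≤ Real.pi then
          ENNReal.ofReal (Real.arccos (-form K p.embed q.embed) / √(-K))
        else ⊤
      else ENNReal.ofReal √((q.t - p.t) ^ 2 - (q.x - p.x) ^ 2)
    else 0

/-- The (image of the) causal geodesic between two points of `𝕃²(K)`, in either order: all points
causally between them for which equality holds in the reverse triangle inequality. -/
def segment (p q : Model K) : Set (Model K) :=
  {z | causal p z ∧ causal z q ∧ tau p z + tau z q = tau p q} ∪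
    {z | causal q z ∧ causal z p ∧ tau q z + tau z p = tau q p}

/-- The geodesic convex hull: the smallest set containing `S` that contains the geodesic between
any two causally related points of it. For the vertices of a timelike triangle in the Minkowski
plane this is the usual convex hull. -/
def conv (S : Set (Model K)) : Set (Model K) :=
  ⋂₀ {C | S ⊆ C ∧ ∀ p ∈ C, ∀ q ∈ C, causal p q → segment p q ⊆ C}

/-- A vector at `embed p`, tangent to the model space, that is a positive multiple of the initial
velocity of the geodesic from `p` to `q` (for timelike related points at distance less than the
diameter). -/
def direction (p q : Model K) : Fin 3 → ℝ :=
  if K = 0 then q.embed - p.embed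
  else q.embed - (Real.sign K * form K p.embed q.embed) • p.embed

/-- The (hyperbolic) angle at `p` between the geodesics from `p` to `q` and from `p` to `r`. -/
def angle (p q r : Model K) : ℝ :=
  Real.arcosh (|form K (direction p q) (direction p r)| /
    (√|form K (direction p q) (direction p q)| * √|form K (direction p r) (direction p r)|))

end Model

/-- The timelike diameter of `𝕃²(K)`. -/
def modelDiam (K : ℝ) : ℝ≥0∞ := if K < 0 then ENNReal.ofReal (Real.pi / √(-K)) else ⊤

/-! ### Triangles, comparison and angles -/

/-- `(p', q', r')` is a comparison triangle in `𝕃²(K)` for the pairwise timelike related points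
`(p, q, r)`: a timelike triangle with the same side lengths (and the same order of the vertices),
whose sides are shorter than the diameter. -/
structure IsComparisonTriangle {X : Type*} [CausalData X] {K : ℝ} (p q r : X)
    (p' q' r' : Model K) : Prop where
  timelike_pq : 0 < tauSym p' q'
  timelike_pr : 0 < tauSym p' r'
  timelike_qr : 0 < tauSym q' r'
  lt_pq : tauSym p' q' < modelDiam K
  lt_pr : tauSym p' r' < modelDiam K
  lt_qr : tauSym q' r' < modelDiam K
  tau_pq : tau p' q' = tau p q
  tau_qp : tau q' p' = tau q p
  tau_pr : tau p' r' = tau p r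
  tau_rp : tau r' p' = tau r p
  tau_qr : tau q' r' = tau q r
  tau_rq : tau r' q' = tau r q

/-- The comparison triangle for `(p, q, r)` in `𝕃²(K)` exists. -/
def HasComparisonTriangle {X : Type*} [CausalData X] (K : ℝ) (p q r : X) : Prop :=
  ∃ T : Model K × Model K × Model K, IsComparisonTriangle p q r T.1 T.2.1 T.2.2

open Classical in
/-- The comparison angle at `p`: the angle at `p'` in a comparison triangle `(p', q', r')` in
`𝕃²(K)`. It does not depend on the triangle, which is unique up to isometry. It is only used where
a comparison triangle exists. -/
def comparisonAngle {X : Type*} [CausalData X] (K : ℝ) (p q r : X) : ℝ :=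
  if h : HasComparisonTriangle K p q r then
    Model.angle h.choose.1 h.choose.2.1 h.choose.2.2
  else 0

section Triangles

variable {X : Type*} [MetricSpace X] [LorentzianPreLengthSpace X]

/-- The angle at `p` between two timelike geodesics starting at `p`: the limit superior of the
comparison angles at `p` of `(p, α s, β t)` as `s, t → 0`, over those `s, t` for which they are
defined. It may be infinite. -/
def angle (K : ℝ) {p q r : X} (α : Path p q) (β : Path p r) : ℝ≥0∞ :=
  limsup (fun st : I × I => ENNReal.ofReal (comparisonAngle K p (α st.1) (β st.2)))
    (𝓝[{st : I × I | HasComparisonTriangle K p (α st.1) (β st.2)}] (0, 0))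

variable (X) in
/-- Timelike triangles: three points, in any order, joined by timelike geodesics. -/
structure TimelikeTriangle where
  a : X
  b : X
  c : X
  ab : Path a b
  ac : Path a c
  bc : Path b c
  geodesic_ab : IsTimelikeGeodesic ab
  geodesic_ac : IsTimelikeGeodesic ac
  geodesic_bc : IsTimelikeGeodesic bc

/-- The triangle (with its sides) lies in `U`. -/
def TimelikeTriangle.IsIn (T : TimelikeTriangle X) (U : Set X) : Prop :=
  range T.ab ⊆ U ∧ range T.ac ⊆ U ∧ range T.bc ⊆ U

/-- `p'` is the comparison point on `[x', y']` of the point `p` on the side `γ` from `x` to `y`. -/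
def IsComparisonPoint {K : ℝ} {x y : X} (γ : Path x y) (x' y' : Model K) (p : X) (p' : Model K) :
    Prop :=
  p ∈ range γ ∧ p' ∈ Model.segment x' y' ∧ tauSym x' p' = tauSym x p

/-- `p` lies on a side of `T`, and `p'` is its comparison point on the corresponding side of the
comparison triangle `(a', b', c')`. -/
def TimelikeTriangle.IsComparisonPoint {K : ℝ} (T : TimelikeTriangle X) (a' b' c' : Model K)
    (p : X) (p' : Model K) : Prop :=
  Lorentz.IsComparisonPoint T.ab a' b' p p' ∨ Lorentz.IsComparisonPoint T.ac a' c' p p' ∨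
    Lorentz.IsComparisonPoint T.bc b' c' p p'

/-- `(≤ K)`-comparison neighbourhoods, in the sense of triangle comparison. -/
structure IsUpperComparisonNhd (K : ℝ) (U : Set X) : Prop where
  isOpen : IsOpen U
  isOpen_tau_lt : IsOpen {p : X × X | p.1 ∈ U ∧ p.2 ∈ U ∧ tau p.1 p.2 < modelDiam K}
  continuousOn_tau : ContinuousOn (fun p : X × X => tau p.1 p.2)
    {p : X × X | p.1 ∈ U ∧ p.2 ∈ U ∧ tau p.1 p.2 < modelDiam K}
  exists_geodesic : ∀ x ∈ U, ∀ y ∈ U, chron x y → tau x y < modelDiam K →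
    ∃ γ : Path x y, IsFutureGeodesic γ ∧ range γ ⊆ U
  comparison : ∀ T : TimelikeTriangle X, T.IsIn U → ∀ a' b' c' : Model K,
    IsComparisonTriangle T.a T.b T.c a' b' c' →
      ∀ (p q : X) (p' q' : Model K), T.IsComparisonPoint a' b' c' p p' →
        T.IsComparisonPoint a' b' c' q q' → tau p' q' ≤ tau p q

end Triangles

/-- `f` restricts to an isometry from `S` onto `f '' S`: a bijection that preserves the time
separation and (in both directions) the causal relation. -/
def IsIsometryOn {X Y : Type*} [CausalData X] [CausalData Y] (f : X → Y) (S : Set X) : Prop :=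
  InjOn f S ∧ ∀ x ∈ S, ∀ y ∈ S,
    tau (f x) (f y) = tau x y ∧ (causal (f x) (f y) ↔ causal x y)

end Lorentz

end

/-! The argument attaches one number to each hinge. With `sn K` the generalised sine and `md K` its
primitive, the law of cosines in the model space is affine in `md K` of the opposite side, so `coef
K a p q` can be computed from the three separations alone. It is the hyperbolic cosine of the
comparison angle at a if the two sides leave a in the same time direction, and minus that cosine
otherwise. In the model it does not change when p and q move along the sides of a triangle
(`energy_comparison_point`). The bound `τ(p, q) ≥ τ(p', q')` therefore says that in X the
coefficient can only drop when p and q move towards a (`SideTriangle.coef_le`). Rigidity means that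
it never drops: `HingeRigid` for all pairs on the two sides at a, `RayRigid` when one of the points
stays at b.

The angle is a limit superior of the arcosh of the absolute value of a monotone coefficient, so
equality of angles at a is the same as `HingeRigid` at a (`SideTriangle.angle_eq_iff`). Stewart's
identity shows that a cevian from b has the model length seen from a if and only if it has it seen
from c. Together with monotonicity from both ends, a single interior point of [a, c] with the model
distance to b forces all of them (`SideTriangle.rayRigid_of_coef_eq`). `RayRigid` implies
`HingeRigid` by first variation: a strict drop at p between a and b would make p too far from points
near a for the reverse triangle inequality between b, p and these points
(`SideTriangle.hingeRigid_of_rayRigid`). Changing the roles of the vertices spreads rigidity to all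
three angles.

For the filling, join the minimal vertex to all points of the opposite side. Any two of these
geodesics span a rigid triangle (`SideTriangle.sub_rigid`), so matching points geodesic by geodesic
with the model triangle preserves τ and hence ≪. Push-up and closedness of ≤ in U then give ≤
(`Fan.causal_iff`). Strong causality makes ≤ antisymmetric, so the matching is a map, and makes the
images of model geodesics continuous. The geodesic hull is covered by the model geodesics from the
minimal vertex, because in suitable linear coordinates geodesics span planes and the hull lies in a
convex cone. Conversely an isometric filling fixes vertices and preserves cevians.

The model spaces enter through null charts centred at a point, in which `md K` of the separation is
one rational function of the coordinates for every sign of K. -/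

noncomputable section

namespace Lorentz

open CausalData

/-! ### Generalised trigonometric functions -/

/-- The solution of `f'' = K f`, `f 0 = 0`, `f' 0 = 1`. -/
def sn (K r : ℝ) : ℝ :=
  if 0 < K then Real.sinh (√K * r) / √K else if K < 0 then Real.sin (√(-K) * r) / √(-K) else r

/-- The primitive of `sn K` that vanishes at zero. -/
def md (K r : ℝ) : ℝ :=
  if 0 < K then (Real.cosh (√K * r) - 1) / K
  else if K < 0 then (1 - Real.cos (√(-K) * r)) / (-K) else r ^ 2 / 2

/-- `r` is a possible length of a geodesic below the timelike diameter. -/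
def InRange (K r : ℝ) : Prop := 0 ≤ r ∧ (K < 0 → √(-K) * r < Real.pi)

/-- Writing K as 0, k² or -k² removes the square roots from `sn` and `md`, and their identities
become those of polynomials, hyperbolic and trigonometric functions. -/
theorem curvature_cases {P : ℝ → Prop} (h0 : P 0) (hp : ∀ k > 0, P (k ^ 2))
    (hn : ∀ k > 0, P (-k ^ 2)) (K : ℝ) : P K := by
  rcases lt_trichotomy K 0 with h | h | h
  · have := hn (√(-K)) (Real.sqrt_pos.2 (by linarith))
    rwa [Real.sq_sqrt (by linarith), neg_neg] at this
  · rwa [h]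
  · have := hp (√K) (Real.sqrt_pos.2 h)
    rwa [Real.sq_sqrt h.le] at this

theorem sn_zero_curv (r : ℝ) : sn 0 r = r := by simp [sn]

theorem md_zero_curv (r : ℝ) : md 0 r = r ^ 2 / 2 := by simp [md]

theorem sn_sq_curv {k : ℝ} (hk : 0 < k) (r : ℝ) : sn (k ^ 2) r = Real.sinh (k * r) / k := by
  simp [sn, pow_pos hk 2, Real.sqrt_sq hk.le]

theorem md_sq_curv {k : ℝ} (hk : 0 < k) (r : ℝ) :
    md (k ^ 2) r = (Real.cosh (k * r) - 1) / k ^ 2 := by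
  simp [md, pow_pos hk 2, Real.sqrt_sq hk.le]

theorem sn_neg_sq_curv {k : ℝ} (hk : 0 < k) (r : ℝ) :
    sn (-k ^ 2) r = Real.sin (k * r) / k := by
  have := pow_pos hk 2
  simp [sn, this, this.le, not_lt.2, Real.sqrt_sq hk.le]

theorem md_neg_sq_curv {k : ℝ} (hk : 0 < k) (r : ℝ) :
    md (-k ^ 2) r = (1 - Real.cos (k * r)) / k ^ 2 := by
  have := pow_pos hk 2
  simp [md, this, this.le, not_lt.2, Real.sqrt_sq hk.le]

theorem inRange_zero_curv {r : ℝ} : InRange 0 r ↔ 0 ≤ r := by simp [InRange]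

theorem inRange_sq_curv {k : ℝ} (hk : 0 < k) {r : ℝ} : InRange (k ^ 2) r ↔ 0 ≤ r := by
  have := pow_pos hk 2
  simp [InRange, not_lt.2, this.le]

theorem inRange_neg_sq_curv {k : ℝ} (hk : 0 < k) {r : ℝ} :
    InRange (-k ^ 2) r ↔ 0 ≤ r ∧ k * r < Real.pi := by
  have := pow_pos hk 2
  simp [InRange, this, Real.sqrt_sq hk.le]

@[simp] theorem sn_zero (K : ℝ) : sn K 0 = 0 := by simp [sn]

@[simp] theorem md_zero (K : ℝ) : md K 0 = 0 := by simp [md]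

@[simp] theorem sn_neg (K r : ℝ) : sn K (-r) = -sn K r := by
  unfold sn; split_ifs <;> simp [neg_div]

@[simp] theorem md_neg (K r : ℝ) : md K (-r) = md K r := by
  unfold md; split_ifs <;> simp

/-- The generalised cosine is `1 + K * md K r`. This is cosh² - sinh² = 1 after division by K, a
form that survives at K = 0. -/
theorem sn_sq (K r : ℝ) : sn K r ^ 2 = 2 * md K r + K * md K r ^ 2 := by
  induction K using curvature_cases with
  | h0 => simp only [sn_zero_curv, md_zero_curv]; ring
  | hp k hk =>
    rw [sn_sq_curv hk, md_sq_curv hk]; field_simp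
    linear_combination -Real.cosh_sq (k * r)
  | hn k hk =>
    rw [sn_neg_sq_curv hk, md_neg_sq_curv hk]; field_simp
    linear_combination Real.sin_sq_add_cos_sq (k * r)

/-- The addition theorem for the generalised cosine `1 + K * md K`, divided by K. -/
theorem md_add (K x y : ℝ) :
    md K (x + y) = md K x + md K y + K * md K x * md K y + sn K x * sn K y := by
  induction K using curvature_cases with
  | h0 => simp only [sn_zero_curv, md_zero_curv]; ring
  | hp k hk =>
    simp only [sn_sq_curv hk, md_sq_curv hk, mul_add, Real.cosh_add]; field_simp; ring
  | hn k hk =>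
    simp only [sn_neg_sq_curv hk, md_neg_sq_curv hk, mul_add, Real.cos_add]; field_simp; ring

theorem sn_add (K x y : ℝ) :
    sn K (x + y) = sn K x * (1 + K * md K y) + sn K y * (1 + K * md K x) := by
  induction K using curvature_cases with
  | h0 => simp only [sn_zero_curv, md_zero_curv]; ring
  | hp k hk =>
    simp only [sn_sq_curv hk, md_sq_curv hk, mul_add, Real.sinh_add]; field_simp; ring
  | hn k hk =>
    simp only [sn_neg_sq_curv hk, md_neg_sq_curv hk, mul_add, Real.sin_add]; field_simp; ring

theorem md_sub (K x y : ℝ) :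
    md K (x - y) = md K x + md K y + K * md K x * md K y - sn K x * sn K y := by
  rw [sub_eq_add_neg, md_add, md_neg, sn_neg]; ring

theorem sn_sub (K x y : ℝ) :
    sn K (x - y) = sn K x * (1 + K * md K y) - sn K y * (1 + K * md K x) := by
  rw [sub_eq_add_neg, sn_add, md_neg, sn_neg]; ring

theorem InRange.mono {K x y : ℝ} (hy : InRange K y) (hx : 0 ≤ x) (hxy : x ≤ y) : InRange K x :=
  ⟨hx, fun h => (mul_le_mul_of_nonneg_left hxy (Real.sqrt_nonneg _)).trans_lt (hy.2 h)⟩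

theorem inRange_zero (K : ℝ) : InRange K 0 := ⟨le_rfl, fun _ => by simpa using Real.pi_pos⟩

theorem sn_pos {K r : ℝ} (hr : InRange K r) (h : 0 < r) : 0 < sn K r := by
  induction K using curvature_cases with
  | h0 => rwa [sn_zero_curv]
  | hp k hk => rw [sn_sq_curv hk]; exact div_pos (Real.sinh_pos_iff.2 (mul_pos hk h)) hk
  | hn k hk =>
    rw [sn_neg_sq_curv hk]
    exact div_pos (Real.sin_pos_of_pos_of_lt_pi (mul_pos hk h) ((inRange_neg_sq_curv hk).1 hr).2) hk

theorem sn_nonneg {K r : ℝ} (hr : InRange K r) : 0 ≤ sn K r := by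
  rcases hr.1.eq_or_lt with h | h
  · simp [← h]
  · exact (sn_pos hr h).le

theorem md_nonneg (K r : ℝ) : 0 ≤ md K r := by
  induction K using curvature_cases with
  | h0 => rw [md_zero_curv]; positivity
  | hp k hk =>
    rw [md_sq_curv hk]
    exact div_nonneg (sub_nonneg.2 (Real.one_le_cosh _)) (by positivity)
  | hn k hk =>
    rw [md_neg_sq_curv hk]
    exact div_nonneg (sub_nonneg.2 (Real.cos_le_one _)) (by positivity)

/-- Below the diameter every comparison of lengths can be made after applying `md K`, where the law
of cosines is algebraic. -/
theorem md_strictMonoOn (K : ℝ) : StrictMonoOn (md K) {r | InRange K r} := by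
  intro x hx y hy hxy
  induction K using curvature_cases with
  | h0 =>
    have := inRange_zero_curv.1 hx
    simp only [md_zero_curv]; nlinarith
  | hp k hk =>
    have hx := (inRange_sq_curv hk).1 hx
    simp only [md_sq_curv hk]
    gcongr
    rw [Real.cosh_lt_cosh, abs_of_nonneg (by positivity), abs_of_nonneg
      (mul_nonneg hk.le (hx.trans hxy.le))]
    gcongr
  | hn k hk =>
    have hx := (inRange_neg_sq_curv hk).1 hx
    have hy := (inRange_neg_sq_curv hk).1 hy
    simp only [md_neg_sq_curv hk]
    gcongr
    exact Real.cos_lt_cos_of_nonneg_of_le_pi (mul_nonneg hk.le hx.1) hy.2.le (by gcongr)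

theorem md_lt_md {K x y : ℝ} (hx : InRange K x) (hy : InRange K y) : md K x < md K y ↔ x < y :=
  (md_strictMonoOn K).lt_iff_lt hx hy

theorem md_le_md {K x y : ℝ} (hx : InRange K x) (hy : InRange K y) : md K x ≤ md K y ↔ x ≤ y :=
  (md_strictMonoOn K).le_iff_le hx hy

theorem md_inj {K x y : ℝ} (hx : InRange K x) (hy : InRange K y) : md K x = md K y ↔ x = y :=
  (md_strictMonoOn K).eq_iff_eq hx hy

theorem md_pos {K r : ℝ} (hr : InRange K r) (h : 0 < r) : 0 < md K r := by
  simpa using (md_lt_md (inRange_zero K) hr).2 h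

/-- For r > 0 both factors of `sn² = md * (2 + K * md)` must be positive. It makes the half-angle
substitution possible. -/
theorem two_add_mul_md_pos {K r : ℝ} (hr : InRange K r) : 0 < 2 + K * md K r := by
  rcases hr.1.eq_or_lt with h | h
  · simp [← h]
  · have h1 := md_pos hr h
    have h2 := pow_pos (sn_pos hr h) 2
    rw [sn_sq] at h2
    by_contra! h3
    nlinarith

theorem hasDerivAt_md (K r : ℝ) : HasDerivAt (md K) (sn K r) r := by
  induction K using curvature_cases with
  | h0 =>
    rw [show md 0 = fun r => r ^ 2 / 2 from funext md_zero_curv, sn_zero_curv]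
    simpa using (hasDerivAt_pow 2 r).div_const 2
  | hp k hk =>
    rw [show md (k ^ 2) = _ from funext (md_sq_curv hk), sn_sq_curv hk]
    have := ((((hasDerivAt_id r).const_mul k).cosh.sub_const 1).div_const (k ^ 2))
    refine this.congr_deriv ?_
    simp only [id]
    field_simp
  | hn k hk =>
    rw [show md (-k ^ 2) = _ from funext (md_neg_sq_curv hk), sn_neg_sq_curv hk]
    have := ((((hasDerivAt_id r).const_mul k).cos.const_sub 1).div_const (k ^ 2))
    refine this.congr_deriv ?_
    simp only [id]
    field_simp

theorem hasDerivAt_sn (K r : ℝ) : HasDerivAt (sn K) (1 + K * md K r) r := by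
  induction K using curvature_cases with
  | h0 =>
    rw [show sn 0 = id from funext sn_zero_curv]
    simpa using hasDerivAt_id r
  | hp k hk =>
    rw [show sn (k ^ 2) = _ from funext (sn_sq_curv hk), md_sq_curv hk]
    have := ((((hasDerivAt_id r).const_mul k).sinh).div_const k)
    refine this.congr_deriv ?_
    simp only [id]
    field_simp; ring
  | hn k hk =>
    rw [show sn (-k ^ 2) = _ from funext (sn_neg_sq_curv hk), md_neg_sq_curv hk]
    have := ((((hasDerivAt_id r).const_mul k).sin).div_const k)
    refine this.congr_deriv ?_
    simp only [id]
    field_simp; ring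

theorem continuous_sn (K : ℝ) : Continuous (sn K) :=
  continuous_iff_continuousAt.2 fun r => (hasDerivAt_sn K r).continuousAt

/-! ### The energy of pairs of points in the model spaces -/

namespace Model

variable {K : ℝ}

/-- The function of two points which is `md K (tau p q)` for causally related points. -/
def energy (p q : Model K) : ℝ :=
  if 0 < K then (form K p.embed q.embed - 1) / K
  else if K < 0 then (1 + form K p.embed q.embed) / (-K)
  else ((q.t - p.t) ^ 2 - (q.x - p.x) ^ 2) / 2

/-- `q` is in the causal future of `p`, and the geodesics between them are not longer than
the timelike diameter. -/
def Reach (p q : Model K) : Prop :=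
  causal p q ∧ (K < 0 → q.t - p.t + |p.x + q.x| < Real.pi)

theorem cos_t_pos (hK : 0 < K) (p : Model K) : 0 < Real.cos p.t :=
  Real.cos_pos_of_mem_Ioo (abs_lt.1 (p.2.1 hK))

theorem cos_x_pos (hK : K < 0) (p : Model K) : 0 < Real.cos p.x :=
  Real.cos_pos_of_mem_Ioo (abs_lt.1 (p.2.2 hK))

theorem form_embed_of_pos (hK : 0 < K) (p q : Model K) :
    form K p.embed q.embed =
      (Real.cos (q.x - p.x) - Real.sin p.t * Real.sin q.t) / (Real.cos p.t * Real.cos q.t) := by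
  have hp := cos_t_pos hK p
  have hq := cos_t_pos hK q
  simp [form, embed, hK, not_lt.2 hK.le, Real.tan_eq_sin_div_cos, Real.cos_sub]
  field_simp
  ring

theorem form_embed_of_neg (hK : K < 0) (p q : Model K) :
    form K p.embed q.embed =
      -((Real.cos (q.t - p.t) - Real.sin p.x * Real.sin q.x) / (Real.cos p.x * Real.cos q.x)) := by
  have hp := cos_x_pos hK p
  have hq := cos_x_pos hK q
  simp [form, embed, hK, not_lt.2 hK.le, Real.tan_eq_sin_div_cos, Real.cos_sub]
  field_simp
  ring

theorem energy_of_pos (hK : 0 < K) (p q : Model K) :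
    energy p q = (Real.cos (q.x - p.x) - Real.cos (q.t - p.t)) /
      (K * (Real.cos p.t * Real.cos q.t)) := by
  have hp := cos_t_pos hK p
  have hq := cos_t_pos hK q
  rw [energy, if_pos hK, form_embed_of_pos hK, Real.cos_sub q.t]
  field_simp
  ring

theorem energy_of_neg (hK : K < 0) (p q : Model K) :
    energy p q = (Real.cos (q.x - p.x) - Real.cos (q.t - p.t)) /
      (-K * (Real.cos p.x * Real.cos q.x)) := by
  have hp := cos_x_pos hK p
  have hq := cos_x_pos hK q
  rw [energy, if_neg hK.not_gt, if_pos hK, form_embed_of_neg hK, Real.cos_sub q.x]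
  field_simp
  ring

theorem energy_self (p : Model K) : energy p p = 0 := by
  rcases lt_trichotomy K 0 with h | h | h
  · simp [energy_of_neg h]
  · simp [energy, h]
  · simp [energy_of_pos h]

theorem energy_comm (p q : Model K) : energy p q = energy q p := by
  rcases lt_trichotomy K 0 with h | h | h
  · rw [energy_of_neg h, energy_of_neg h, ← Real.cos_neg (q.x - p.x), ← Real.cos_neg (q.t - p.t),
      neg_sub, neg_sub, mul_comm (Real.cos p.x)]
  · simp [energy, h]; ring
  · rw [energy_of_pos h, energy_of_pos h, ← Real.cos_neg (q.x - p.x), ← Real.cos_neg (q.t - p.t),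
      neg_sub, neg_sub, mul_comm (Real.cos p.t)]

theorem causal_refl (p : Model K) : causal p p := by
  change |p.x - p.x| ≤ p.t - p.t; simp

theorem causal_trans {p q r : Model K} (h : causal p q) (h' : causal q r) : causal p r := by
  change |r.x - p.x| ≤ r.t - p.t
  change |q.x - p.x| ≤ q.t - p.t at h
  change |r.x - q.x| ≤ r.t - q.t at h'
  calc |r.x - p.x| = |(q.x - p.x) + (r.x - q.x)| := by ring_nf
    _ ≤ _ := abs_add_le _ _
    _ ≤ r.t - p.t := by linarith

theorem causal_antisymm {p q : Model K} (h : causal p q) (h' : causal q p) : p = q := by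
  change |q.x - p.x| ≤ q.t - p.t at h
  change |p.x - q.x| ≤ p.t - q.t at h'
  have h1 := abs_nonneg (q.x - p.x)
  have h2 := abs_nonneg (p.x - q.x)
  have h3 : q.t - p.t = 0 := by linarith
  have h4 : q.x - p.x = 0 := abs_nonpos_iff.1 (h3 ▸ h)
  exact Subtype.ext (Prod.ext (sub_eq_zero.1 h3).symm (sub_eq_zero.1 h4).symm)

theorem causal_of_chron {p q : Model K} (h : chron p q) : causal p q :=
  le_of_lt (show |q.x - p.x| < q.t - p.t from h)

theorem t_sub_lt_pi {p q : Model K} (hK : 0 < K) : q.t - p.t < Real.pi := by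
  have := abs_lt.1 (p.2.1 hK); have := abs_lt.1 (q.2.1 hK)
  simp only [t]; linarith

theorem cos_x_sub_ge {p q : Model K} (h : causal p q) (h' : q.t - p.t ≤ Real.pi) :
    Real.cos (q.t - p.t) ≤ Real.cos (q.x - p.x) := by
  change |q.x - p.x| ≤ q.t - p.t at h
  rw [← Real.cos_abs (q.x - p.x)]
  exact Real.cos_le_cos_of_nonneg_of_le_pi (abs_nonneg _) h' h

/-- The time separation of points below the diameter in terms of the energy. -/
theorem Reach.tau_eq {p q : Model K} (h : Reach p q) :
    ∃ r, InRange K r ∧ tau p q = ENNReal.ofReal r ∧ md K r = energy p q := by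
  have hc : |q.x - p.x| ≤ q.t - p.t := h.1
  rcases lt_trichotomy K 0 with hK | hK | hK
  · have hl := h.2 hK
    have h0 := abs_nonneg (p.x + q.x)
    have hp := cos_x_pos hK p
    have hq := cos_x_pos hK q
    have hs : 0 < √(-K) := Real.sqrt_pos.2 (by linarith)
    set y := -form K p.embed q.embed with hy
    have hy1 : y = (Real.cos (q.t - p.t) - Real.sin p.x * Real.sin q.x) /
      (Real.cos p.x * Real.cos q.x) := by rw [hy, form_embed_of_neg hK, neg_neg]
    have hle : y ≤ 1 := by
      rw [hy1, div_le_one (by positivity)]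
      have := cos_x_sub_ge h.1 (by linarith)
      rw [Real.cos_sub q.x] at this
      linarith
    have hgt : -1 < y := by
      rw [hy1, lt_div_iff₀ (by positivity)]
      -- By the addition theorem `-1 < y` says exactly that cos(q.t - p.t) exceeds -cos(p.x + q.x).
      -- This is where the bound in `Reach` enters.
      have : Real.cos (Real.pi - |p.x + q.x|) < Real.cos (q.t - p.t) :=
        Real.cos_lt_cos_of_nonneg_of_le_pi ((abs_nonneg _).trans hc) (by linarith) (by linarith)
      rw [Real.cos_pi_sub, Real.cos_abs, Real.cos_add] at this
      linarith
    refine ⟨Real.arccos y / √(-K), ⟨div_nonneg (Real.arccos_nonneg _) hs.le, fun _ => ?_⟩, ?_, ?_⟩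
    · rw [mul_div_cancel₀ _ hs.ne']
      refine (Real.arccos_le_pi y).lt_of_ne fun h => ?_
      have := Real.arccos_eq_pi.1 h
      linarith
    · simp only [tau, if_pos hc, if_neg hK.not_gt, if_pos hK, if_pos hl.le, hy]
    · rw [md, if_neg hK.not_gt, if_pos hK, mul_div_cancel₀ _ hs.ne', Real.cos_arccos hgt.le hle,
        energy, if_neg hK.not_gt, if_pos hK, hy, sub_neg_eq_add]
  · subst hK
    have h1 : 0 ≤ (q.t - p.t) ^ 2 - (q.x - p.x) ^ 2 := by
      have := sq_le_sq' (by linarith [abs_nonneg (q.x - p.x)]) hc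
      rw [sq_abs] at this
      linarith
    refine ⟨√((q.t - p.t) ^ 2 - (q.x - p.x) ^ 2), inRange_zero_curv.2 (Real.sqrt_nonneg _), ?_, ?_⟩
    · simp [tau, hc]
    · rw [md_zero_curv, Real.sq_sqrt h1]; simp [energy]
  · have hp := cos_t_pos hK p
    have hq := cos_t_pos hK q
    have hs : 0 < √K := Real.sqrt_pos.2 hK
    set y := form K p.embed q.embed with hy
    have hle : 1 ≤ y := by
      rw [hy, form_embed_of_pos hK, le_div_iff₀ (by positivity)]
      have := cos_x_sub_ge h.1 (t_sub_lt_pi hK).le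
      rw [Real.cos_sub q.t] at this
      linarith
    refine ⟨Real.arcosh y / √K, ⟨div_nonneg (Real.arcosh_nonneg hle) hs.le,
      fun h => absurd h hK.not_gt⟩, ?_, ?_⟩
    · simp only [tau, if_pos hc, if_pos hK, hy]
    · rw [md, if_pos hK, mul_div_cancel₀ _ hs.ne', Real.cosh_arcosh hle, energy, if_pos hK]

theorem tau_eq_zero {p q : Model K} (h : ¬ causal p q) : tau p q = 0 :=
  if_neg h

theorem causal_of_tau_pos {p q : Model K} (h : 0 < tau p q) : causal p q := by
  by_contra h'
  exact h.ne' (tau_eq_zero h')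

/-- Outside `Reach` the separation is at least the diameter. On the boundary the embedded points are
antipodal, so the arccos is π, and beyond it `tau` is infinite. -/
theorem reach_of_tau_lt {p q : Model K} (h : causal p q) (h' : tau p q < modelDiam K) :
    Reach p q := by
  refine ⟨h, fun hK => ?_⟩
  have hc : |q.x - p.x| ≤ q.t - p.t := h
  by_contra! hl
  refine absurd h' (not_lt.2 ?_)
  simp only [tau, if_pos hc, if_neg hK.not_gt, if_pos hK, modelDiam]
  split_ifs with h1
  · have h2 : q.t - p.t = Real.pi - |p.x + q.x| := by linarith
    have hp := cos_x_pos hK p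
    have hq := cos_x_pos hK q
    have : -form K p.embed q.embed = -1 := by
      rw [form_embed_of_neg hK, h2, neg_neg, Real.cos_pi_sub, Real.cos_abs, Real.cos_add]
      field_simp
      ring
    rw [this, Real.arccos_neg_one]
  · exact le_top

/-- The hinge term of three points: minus the product of the directions from `a` to `p` and `q`. -/
def hinge (a p q : Model K) : ℝ :=
  energy a p + energy a q + K * energy a p * energy a q - energy p q

theorem hinge_comm (a p q : Model K) : hinge a p q = hinge a q p := by
  rw [hinge, hinge, energy_comm p q]; ring

theorem form_sub_smul (p q r : Fin 3 → ℝ) (c d : ℝ) :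
    form K (q - c • p) (r - d • p) =
      form K q r - c * form K p r - d * form K p q + c * d * form K p p := by
  simp only [form, Pi.sub_apply, Pi.smul_apply, smul_eq_mul]
  split_ifs <;> ring

/-- The factor |K| appears because the embedding has unit radius. It cancels in the normalised
angle. -/
theorem form_direction (p q r : Model K) :
    form K (direction p q) (direction p r) = -((if K = 0 then 1 else |K|) * hinge p q r) := by
  rcases lt_trichotomy K 0 with hK | hK | hK
  · have hp : form K p.embed p.embed = -1 := by
      have := energy_self p
      rw [energy, if_neg hK.not_gt, if_pos hK, div_eq_zero_iff] at this
      rcases this with h | h <;> linarith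
    have hK0 : K ≠ 0 := by rintro rfl; exact lt_irrefl _ hK
    simp only [direction, if_neg hK.ne, form_sub_smul, hp, Real.sign_of_neg hK, abs_of_neg hK,
      hinge, energy, if_neg hK.not_gt, if_pos hK]
    field_simp
    ring
  · subst hK
    simp [direction, form, embed, hinge, energy]
    ring
  · have hp : form K p.embed p.embed = 1 := by
      have := energy_self p
      rw [energy, if_pos hK, div_eq_zero_iff] at this
      rcases this with h | h <;> linarith
    have hK0 : K ≠ 0 := by rintro rfl; exact lt_irrefl _ hK
    simp only [direction, if_neg hK.ne', form_sub_smul, hp, Real.sign_of_pos hK, abs_of_pos hK,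
      hinge, energy, if_pos hK]
    field_simp
    ring

theorem hinge_self (a p : Model K) : hinge a p p = 2 * energy a p + K * energy a p ^ 2 := by
  rw [hinge, energy_self]; ring

/-- The hyperbolic law of cosines. -/
theorem angle_eq {p q r : Model K} {x y : ℝ} (hx : InRange K x) (hy : InRange K y)
    (hq : energy p q = md K x) (hr : energy p r = md K y) :
    Model.angle p q r = Real.arcosh |hinge p q r / (sn K x * sn K y)| := by
  have hc : 0 < (if K = 0 then 1 else |K|) := by split_ifs <;> positivity
  have key : ∀ (s : Model K) {z : ℝ}, InRange K z → energy p s = md K z →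
      √|form K (direction p s) (direction p s)| = √(if K = 0 then 1 else |K|) * sn K z := by
    intro s z hz hs
    rw [form_direction, hinge_self, hs, ← sn_sq, abs_neg, abs_of_nonneg (by positivity),
      Real.sqrt_mul hc.le, Real.sqrt_sq (sn_nonneg hz)]
  rw [Model.angle, key q hx hq, key r hy hr, form_direction, abs_neg, abs_mul, abs_of_pos hc]
  congr 1
  rw [abs_div, abs_of_nonneg (mul_nonneg (sn_nonneg hx) (sn_nonneg hy)), mul_mul_mul_comm,
    Real.mul_self_sqrt hc.le, mul_div_mul_left _ _ hc.ne']

end Model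

/-! ### Null coordinates centred at a point -/

namespace Model

variable {K : ℝ}

/-- The first null coordinate. -/
def u (p : Model K) : ℝ := (p.t + p.x) / 2

/-- The second null coordinate. -/
def v (p : Model K) : ℝ := (p.t - p.x) / 2

/-- The sign that distinguishes the de Sitter and the anti-de Sitter case. -/
def sg (K : ℝ) : ℝ := if K < 0 then -1 else 1

/-- The first null coordinate, normalised at `o`. -/
def chartU (o q : Model K) : ℝ :=
  if K = 0 then q.u - o.u else Real.sin (q.u - o.u) / (√|K| * Real.cos (q.u + sg K * o.v))

/-- The second null coordinate, normalised at `o`. -/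
def chartV (o q : Model K) : ℝ :=
  if K = 0 then q.v - o.v else Real.sin (q.v - o.v) / (√|K| * Real.cos (o.u + sg K * q.v))

theorem sg_mul_self (K : ℝ) : sg K * sg K = 1 := by unfold sg; split_ifs <;> norm_num

theorem sg_cases (K : ℝ) : sg K = 1 ∨ sg K = -1 := by unfold sg; split_ifs <;> simp

theorem eq_sg_mul (K : ℝ) : K = sg K * √|K| ^ 2 := by
  rw [Real.sq_sqrt (abs_nonneg K), sg]
  split_ifs with h
  · rw [abs_of_neg h]; ring
  · rw [abs_of_nonneg (not_lt.1 h)]; ring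

theorem causal_iff_uv {p q : Model K} : causal p q ↔ p.u ≤ q.u ∧ p.v ≤ q.v := by
  change |q.x - p.x| ≤ q.t - p.t ↔ _
  rw [abs_le, u, u, v, v]
  constructor <;> rintro ⟨h, h'⟩ <;> constructor <;> linarith

theorem chron_iff_uv {p q : Model K} : chron p q ↔ p.u < q.u ∧ p.v < q.v := by
  change |q.x - p.x| < q.t - p.t ↔ _
  rw [abs_lt, u, u, v, v]
  constructor <;> rintro ⟨h, h'⟩ <;> constructor <;> linarith

theorem energy_zero_curv {p q : Model K} (hK : K = 0) :
    energy p q = 2 * (q.u - p.u) * (q.v - p.v) := by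
  simp only [energy, hK, lt_irrefl, if_false, u, v]; ring

theorem energy_eq_uv {p q : Model K} (hK : K ≠ 0) :
    energy p q = 2 * Real.sin (q.u - p.u) * Real.sin (q.v - p.v) /
      (√|K| ^ 2 * (Real.cos (p.u + sg K * p.v) * Real.cos (q.u + sg K * q.v))) := by
  have key : Real.cos (q.x - p.x) - Real.cos (q.t - p.t) =
      2 * Real.sin (q.u - p.u) * Real.sin (q.v - p.v) := by
    have h1 : q.x - p.x = (q.u - p.u) - (q.v - p.v) := by simp only [u, v]; ring
    have h2 : q.t - p.t = (q.u - p.u) + (q.v - p.v) := by simp only [u, v]; ring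
    rw [h1, h2, Real.cos_sub (q.u - p.u), Real.cos_add (q.u - p.u)]; ring
  rw [Real.sq_sqrt (abs_nonneg K), ← key]
  rcases hK.lt_or_gt with h | h
  · rw [energy_of_neg h, abs_of_neg h]
    have h1 : ∀ p : Model K, p.u + sg K * p.v = p.x := fun p => by simp [sg, h, u, v]; ring
    rw [h1, h1]
  · rw [energy_of_pos h, abs_of_pos h]
    have h1 : ∀ p : Model K, p.u + sg K * p.v = p.t := fun p => by
      simp [sg, not_lt.2 h.le, u, v]; ring
    rw [h1, h1]

/-- These are the arguments of the cosines in the denominators of the charts. For K < 0, `q.u - o.v`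
is half of (q.t - o.t) + (o.x + q.x), which `Reach` bounds by π. For K > 0 the corresponding sums
lie between o.t and q.t. -/
theorem Reach.angle_bounds {o q : Model K} (h : Reach o q) (hK : K ≠ 0) :
    (q.u + sg K * o.v ∈ Ioo (-(Real.pi / 2)) (Real.pi / 2) ∧
    o.u + sg K * q.v ∈ Ioo (-(Real.pi / 2)) (Real.pi / 2) ∧
    q.u + sg K * q.v ∈ Ioo (-(Real.pi / 2)) (Real.pi / 2)) ∧ q.t - o.t < Real.pi := by
  obtain ⟨h1, h2⟩ := causal_iff_uv.1 h.1
  simp only [u, v] at h1 h2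
  rcases hK.lt_or_gt with hn | hp
  · have h3 := h.2 hn
    have h4 := le_abs_self (o.x + q.x)
    have h5 := neg_abs_le (o.x + q.x)
    have ho := abs_lt.1 (o.2.2 hn); have hq := abs_lt.1 (q.2.2 hn)
    change _ < o.x ∧ o.x < _ at ho
    change _ < q.x ∧ q.x < _ at hq
    simp only [sg, hn, if_true, u, v, mem_Ioo]
    refine ⟨⟨⟨?_, ?_⟩, ⟨?_, ?_⟩, ?_, ?_⟩, ?_⟩ <;> linarith
  · have ho := abs_lt.1 (o.2.1 hp); have hq := abs_lt.1 (q.2.1 hp)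
    change _ < o.t ∧ o.t < _ at ho
    change _ < q.t ∧ q.t < _ at hq
    simp only [sg, not_lt.2 hp.le, if_false, u, v, mem_Ioo]
    refine ⟨⟨⟨?_, ?_⟩, ⟨?_, ?_⟩, ?_, ?_⟩, ?_⟩ <;> linarith

theorem reach_self (o : Model K) : Reach o o := by
  refine ⟨causal_refl o, fun hK => ?_⟩
  have := abs_lt.1 (o.2.2 hK)
  change _ < o.x ∧ o.x < _ at this
  rw [sub_self, zero_add, abs_lt]
  constructor <;> linarith

/-- Points causally between two points below the diameter are below the diameter. -/
theorem Reach.of_between {o p q r : Model K} (h : Reach o r) (hp : causal o p) (hpq : causal p q)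
    (hq : causal q r) : Reach p q := by
  refine ⟨hpq, fun hK => ?_⟩
  have h1 := h.2 hK
  have h2 := le_abs_self (o.x + r.x)
  have h3 := neg_abs_le (o.x + r.x)
  rw [causal_iff_uv] at hp hq
  simp only [u, v] at hp hq
  have : |p.x + q.x| < Real.pi - (q.t - p.t) := by
    rw [abs_lt]; constructor <;> linarith [hp.1, hp.2, hq.1, hq.2]
  linarith

theorem sin_sub_mul_cos_add (a b o m : ℝ) :
    Real.sin (a - o) * Real.cos (b + m) - Real.sin (b - o) * Real.cos (a + m) =
      Real.sin (a - b) * Real.cos (o + m) := by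
  simp only [Real.sin_sub, Real.cos_add]; ring

theorem sin_sub_mul_cos_sg (a b o m : ℝ) :
    Real.sin (a - o) * Real.cos (m + sg K * b) - Real.sin (b - o) * Real.cos (m + sg K * a) =
      Real.sin (a - b) * Real.cos (m + sg K * o) := by
  rcases sg_cases K with h | h <;>
    simp only [h, one_mul, neg_one_mul, ← sub_eq_add_neg, Real.sin_sub, Real.cos_sub,
      Real.cos_add] <;> ring

theorem cos_mul_cos_sub (a b c d : ℝ) :
    Real.cos (a + sg K * d) * Real.cos (c + sg K * b) -
        sg K * (Real.sin (a - c) * Real.sin (b - d)) =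
      Real.cos (c + sg K * d) * Real.cos (a + sg K * b) := by
  rcases sg_cases K with h | h <;>
    simp only [h, one_mul, neg_one_mul, ← sub_eq_add_neg, Real.sin_sub, Real.cos_sub,
      Real.cos_add] <;> ring

/-! ### The null charts: order, energy and injectivity -/

section

variable {o q r : Model K}

theorem sqrt_abs_pos (hK : K ≠ 0) : 0 < √|K| := Real.sqrt_pos.2 (abs_pos.2 hK)

theorem Reach.cos_pos (h : Reach o q) (hK : K ≠ 0) :
    0 < Real.cos (q.u + sg K * o.v) ∧ 0 < Real.cos (o.u + sg K * q.v) ∧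
      0 < Real.cos (q.u + sg K * q.v) ∧ 0 < Real.cos (o.u + sg K * o.v) :=
  ⟨Real.cos_pos_of_mem_Ioo (h.angle_bounds hK).1.1, Real.cos_pos_of_mem_Ioo (h.angle_bounds hK).1.2.1,
    Real.cos_pos_of_mem_Ioo (h.angle_bounds hK).1.2.2,
    Real.cos_pos_of_mem_Ioo ((reach_self o).angle_bounds hK).1.1⟩

/-- The chart difference is the sine of the coordinate difference times a positive factor. This
yields both the order property of the chart and the formula for the energy. -/
theorem chartU_sub (hq : Reach o q) (hr : Reach o r) (hK : K ≠ 0) :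
    chartU o r - chartU o q = Real.sin (r.u - q.u) * (Real.cos (o.u + sg K * o.v) /
      (√|K| * (Real.cos (r.u + sg K * o.v) * Real.cos (q.u + sg K * o.v)))) := by
  have h1 := hq.cos_pos hK
  have h2 := hr.cos_pos hK
  have h3 := sqrt_abs_pos hK
  rw [chartU, chartU, if_neg hK, if_neg hK]
  have := sin_sub_mul_cos_add r.u q.u o.u (sg K * o.v)
  have h4 := h1.1.ne'; have h5 := h2.1.ne'
  field_simp
  linear_combination this

theorem chartV_sub (hq : Reach o q) (hr : Reach o r) (hK : K ≠ 0) :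
    chartV o r - chartV o q = Real.sin (r.v - q.v) * (Real.cos (o.u + sg K * o.v) /
      (√|K| * (Real.cos (o.u + sg K * r.v) * Real.cos (o.u + sg K * q.v)))) := by
  have h1 := hq.cos_pos hK
  have h2 := hr.cos_pos hK
  have h3 := sqrt_abs_pos hK
  rw [chartV, chartV, if_neg hK, if_neg hK]
  have := sin_sub_mul_cos_sg (K := K) r.v q.v o.v o.u
  have h4 := h1.2.1.ne'; have h5 := h2.2.1.ne'
  generalize Real.cos (o.u + sg K * q.v) = C at *
  generalize Real.cos (o.u + sg K * r.v) = C' at *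
  generalize Real.cos (o.u + sg K * o.v) = C'' at *
  field_simp
  linear_combination this

theorem one_sub_chart (hq : Reach o q) (hK : K ≠ 0) :
    1 - K * chartU o q * chartV o q =
      Real.cos (o.u + sg K * o.v) * Real.cos (q.u + sg K * q.v) /
        (Real.cos (q.u + sg K * o.v) * Real.cos (o.u + sg K * q.v)) := by
  have h1 := hq.cos_pos hK
  have h3 := sqrt_abs_pos hK
  have h4 := h1.1.ne'; have h5 := h1.2.1.ne'
  have h6 := cos_mul_cos_sub (K := K) q.u q.v o.u o.v
  have h7 : K * chartU o q * chartV o q = sg K * (Real.sin (q.u - o.u) * Real.sin (q.v - o.v)) /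
      (Real.cos (q.u + sg K * o.v) * Real.cos (o.u + sg K * q.v)) := by
    rw [chartU, chartV, if_neg hK, if_neg hK]
    nth_rewrite 1 [eq_sg_mul K]
    field_simp
  rw [h7, ← h6]
  field_simp

theorem one_sub_chart_pos (hq : Reach o q) : 0 < 1 - K * chartU o q * chartV o q := by
  by_cases hK : K = 0
  · simp [hK]
  · rw [one_sub_chart hq hK]
    obtain ⟨h1, h2, h3, h4⟩ := hq.cos_pos hK
    positivity

/-- In these charts the squared separation is infinitesimally 4 dU dV / (1 - K U V)² for every K.
Later identities of the model geometry thereby become rational identities, uniform in the sign of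
the curvature. -/
theorem energy_chart (hq : Reach o q) (hr : Reach o r) :
    energy q r = 2 * (chartU o r - chartU o q) * (chartV o r - chartV o q) /
      ((1 - K * chartU o q * chartV o q) * (1 - K * chartU o r * chartV o r)) := by
  by_cases hK : K = 0
  · rw [energy_zero_curv hK]
    simp [chartU, chartV, hK]
  · obtain ⟨h1, h2, h3, h4⟩ := hq.cos_pos hK
    obtain ⟨h5, h6, h7, h8⟩ := hr.cos_pos hK
    have h9 := sqrt_abs_pos hK
    rw [one_sub_chart hq hK, one_sub_chart hr hK, chartU_sub hq hr hK, chartV_sub hq hr hK,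
      energy_eq_uv hK]
    generalize Real.cos (q.u + sg K * o.v) = C1 at *
    generalize Real.cos (o.u + sg K * q.v) = C2 at *
    generalize Real.cos (q.u + sg K * q.v) = C3 at *
    generalize Real.cos (o.u + sg K * o.v) = C4 at *
    generalize Real.cos (r.u + sg K * o.v) = C5 at *
    generalize Real.cos (o.u + sg K * r.v) = C6 at *
    generalize Real.cos (r.u + sg K * r.v) = C7 at *
    field_simp

theorem sin_nonneg_iff_of_abs_lt {a : ℝ} (h : |a| < Real.pi) : 0 ≤ Real.sin a ↔ 0 ≤ a := by
  rw [abs_lt] at h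
  constructor
  · intro h1
    by_contra! h2
    exact absurd h1 (not_le.2 (Real.sin_neg_of_neg_of_neg_pi_lt h2 h.1))
  · exact fun h1 => Real.sin_nonneg_of_nonneg_of_le_pi h1 h.2.le

theorem Reach.abs_sub_lt (hq : Reach o q) (hr : Reach o r) (hK : K ≠ 0) :
    |r.u - q.u| < Real.pi ∧ |r.v - q.v| < Real.pi := by
  have h1 := (hq.angle_bounds hK).2
  have h2 := (hr.angle_bounds hK).2
  have h3 := causal_iff_uv.1 hq.1
  have h4 := causal_iff_uv.1 hr.1
  simp only [u, v, abs_lt] at *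
  refine ⟨⟨?_, ?_⟩, ?_, ?_⟩ <;> linarith

theorem chartU_le_iff (hq : Reach o q) (hr : Reach o r) :
    chartU o q ≤ chartU o r ↔ q.u ≤ r.u := by
  by_cases hK : K = 0
  · simp [chartU, hK]
  · obtain ⟨h1, h2, h3, h4⟩ := hq.cos_pos hK
    obtain ⟨h5, h6, h7, h8⟩ := hr.cos_pos hK
    have h9 := sqrt_abs_pos hK
    rw [← sub_nonneg, chartU_sub hq hr hK, mul_nonneg_iff_of_pos_right (by positivity),
      sin_nonneg_iff_of_abs_lt (hq.abs_sub_lt hr hK).1, sub_nonneg]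

theorem chartV_le_iff (hq : Reach o q) (hr : Reach o r) :
    chartV o q ≤ chartV o r ↔ q.v ≤ r.v := by
  by_cases hK : K = 0
  · simp [chartV, hK]
  · obtain ⟨h1, h2, h3, h4⟩ := hq.cos_pos hK
    obtain ⟨h5, h6, h7, h8⟩ := hr.cos_pos hK
    have h9 := sqrt_abs_pos hK
    rw [← sub_nonneg, chartV_sub hq hr hK, mul_nonneg_iff_of_pos_right (by positivity),
      sin_nonneg_iff_of_abs_lt (hq.abs_sub_lt hr hK).2, sub_nonneg]

theorem causal_iff_chart (hq : Reach o q) (hr : Reach o r) :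
    causal q r ↔ chartU o q ≤ chartU o r ∧ chartV o q ≤ chartV o r := by
  rw [chartU_le_iff hq hr, chartV_le_iff hq hr, causal_iff_uv]

theorem chron_iff_chart (hq : Reach o q) (hr : Reach o r) :
    chron q r ↔ chartU o q < chartU o r ∧ chartV o q < chartV o r := by
  rw [← not_le, ← not_le, chartU_le_iff hr hq, chartV_le_iff hr hq, chron_iff_uv, not_le, not_le]

@[simp] theorem chartU_self (o : Model K) : chartU o o = 0 := by simp [chartU]

@[simp] theorem chartV_self (o : Model K) : chartV o o = 0 := by simp [chartV]

theorem chartU_nonneg (hq : Reach o q) : 0 ≤ chartU o q := by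
  rw [← chartU_self o, chartU_le_iff (reach_self o) hq]
  exact (causal_iff_uv.1 hq.1).1

theorem chartV_nonneg (hq : Reach o q) : 0 ≤ chartV o q := by
  rw [← chartV_self o, chartV_le_iff (reach_self o) hq]
  exact (causal_iff_uv.1 hq.1).2

theorem eq_of_chart_eq (hq : Reach o q) (hr : Reach o r) (h : chartU o q = chartU o r)
    (h' : chartV o q = chartV o r) : q = r :=
  causal_antisymm ((causal_iff_chart hq hr).2 ⟨h.le, h'.le⟩)
    ((causal_iff_chart hr hq).2 ⟨h.ge, h'.ge⟩)

end

/-- The inverse of `chartU o` in the coordinate `u`. -/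
def invU (o : Model K) (T : ℝ) : ℝ :=
  if K = 0 then o.u + T else -(sg K * o.v) + Real.arctan
    ((√|K| * T + Real.sin (o.u + sg K * o.v)) / Real.cos (o.u + sg K * o.v))

/-- The inverse of `chartV o` in the coordinate `v`. -/
def invV (o : Model K) (S : ℝ) : ℝ :=
  if K = 0 then o.v + S else sg K * (-o.u + Real.arctan
    ((√|K| * (sg K * S) + Real.sin (o.u + sg K * o.v)) / Real.cos (o.u + sg K * o.v)))

theorem continuous_invU (o : Model K) : Continuous (invU o) := by
  unfold invU; split_ifs
  · fun_prop
  · exact continuous_const.add (Real.continuous_arctan.comp (by fun_prop))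

theorem continuous_invV (o : Model K) : Continuous (invV o) := by
  unfold invV; split_ifs
  · fun_prop
  · exact continuous_const.mul (continuous_const.add (Real.continuous_arctan.comp (by fun_prop)))

/-- Both inverse charts come from solving sin(A - θ) / cos A = tan A cos θ - sin θ for A, with θ the
value of A at the centre. -/
theorem arctan_sin_sub {θ A : ℝ} (hθ : 0 < Real.cos θ)
    (hA : A ∈ Ioo (-(Real.pi / 2)) (Real.pi / 2)) :
    Real.arctan ((Real.sin (A - θ) / Real.cos A + Real.sin θ) / Real.cos θ) = A := by
  have h := Real.cos_pos_of_mem_Ioo hA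
  have : (Real.sin (A - θ) / Real.cos A + Real.sin θ) / Real.cos θ = Real.tan A := by
    rw [Real.tan_eq_sin_div_cos, Real.sin_sub]; field_simp; ring
  rw [this, Real.arctan_tan hA.1 hA.2]

theorem sin_arctan_sub {θ T : ℝ} (hθ : 0 < Real.cos θ) :
    Real.sin (Real.arctan ((T + Real.sin θ) / Real.cos θ) - θ) =
      T * Real.cos (Real.arctan ((T + Real.sin θ) / Real.cos θ)) := by
  have h1 := Real.tan_arctan ((T + Real.sin θ) / Real.cos θ)
  have h2 := Real.cos_arctan_pos ((T + Real.sin θ) / Real.cos θ)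
  set A := Real.arctan ((T + Real.sin θ) / Real.cos θ)
  rw [Real.tan_eq_sin_div_cos, div_eq_div_iff h2.ne' hθ.ne'] at h1
  rw [Real.sin_sub]
  linear_combination h1

theorem invU_chartU {o r : Model K} (h : Reach o r) : invU o (chartU o r) = r.u := by
  by_cases hK : K = 0
  · simp [invU, chartU, hK]
  · have h9 := sqrt_abs_pos hK
    have h1 := arctan_sin_sub (h.cos_pos hK).2.2.2 (h.angle_bounds hK).1.1
    rw [invU, chartU, if_neg hK, if_neg hK,
      show √|K| * (Real.sin (r.u - o.u) / (√|K| * Real.cos (r.u + sg K * o.v))) =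
        Real.sin (r.u + sg K * o.v - (o.u + sg K * o.v)) / Real.cos (r.u + sg K * o.v) by
        rw [add_sub_add_right_eq_sub]; field_simp, h1]
    ring

theorem invV_chartV {o r : Model K} (h : Reach o r) : invV o (chartV o r) = r.v := by
  by_cases hK : K = 0
  · simp [invV, chartV, hK]
  · have h9 := sqrt_abs_pos hK
    have h1 := arctan_sin_sub (h.cos_pos hK).2.2.2 (h.angle_bounds hK).1.2.1
    have h2 : sg K * Real.sin (r.v - o.v) = Real.sin (o.u + sg K * r.v - (o.u + sg K * o.v)) := by
      rw [add_sub_add_left_eq_sub, ← mul_sub]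
      rcases sg_cases K with h | h <;> simp [h, ← Real.sin_neg]
    rw [invV, chartV, if_neg hK, if_neg hK,
      show √|K| * (sg K * (Real.sin (r.v - o.v) / (√|K| * Real.cos (o.u + sg K * r.v)))) =
        Real.sin (o.u + sg K * r.v - (o.u + sg K * o.v)) / Real.cos (o.u + sg K * r.v) by
        rw [← h2]; field_simp, h1]
    linear_combination r.v * sg_mul_self K

theorem monotone_invU (o : Model K) : Monotone (invU o) := by
  intro a b hab
  by_cases hK : K = 0
  · simpa [invU, hK] using hab
  · have h9 := sqrt_abs_pos hK
    have := ((reach_self o).cos_pos hK).1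
    simp only [invU, if_neg hK]
    gcongr

theorem monotone_invV (o : Model K) : Monotone (invV o) := by
  intro a b hab
  by_cases hK : K = 0
  · simpa [invV, hK] using hab
  · have h9 := sqrt_abs_pos hK
    have := ((reach_self o).cos_pos hK).1
    simp only [invV, if_neg hK]
    rcases sg_cases K with h | h
    · simp only [h, one_mul] at this ⊢
      gcongr
    · simp only [h] at this ⊢
      have : Real.arctan ((√|K| * (-1 * b) + Real.sin (o.u + -1 * o.v)) / Real.cos (o.u + -1 * o.v)) ≤
        Real.arctan ((√|K| * (-1 * a) + Real.sin (o.u + -1 * o.v)) / Real.cos (o.u + -1 * o.v)) := by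
        refine Real.arctan_mono ?_
        gcongr ?_ / _
        nlinarith
      linarith

/-- Every pair of coordinates below those of a point is attained. -/
theorem exists_chart_eq {o r : Model K} (hr : Reach o r) {T S : ℝ} (hT : 0 ≤ T)
    (hT' : T ≤ chartU o r) (hS : 0 ≤ S) (hS' : S ≤ chartV o r) :
    ∃ q : Model K, Reach o q ∧ causal q r ∧ chartU o q = T ∧ chartV o q = S ∧
      q.u = invU o T ∧ q.v = invV o S := by
  have hu0 : o.u ≤ invU o T := by
    have := monotone_invU o hT
    rwa [← chartU_self o, invU_chartU (reach_self o)] at this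
  have hv0 : o.v ≤ invV o S := by
    have := monotone_invV o hS
    rwa [← chartV_self o, invV_chartV (reach_self o)] at this
  have hu1 : invU o T ≤ r.u := by
    have := monotone_invU o hT'
    rwa [invU_chartU hr] at this
  have hv1 : invV o S ≤ r.v := by
    have := monotone_invV o hS'
    rwa [invV_chartV hr] at this
  -- The new point has to lie in the coordinate strip. Its time u + v is between those of o and r,
  -- and its space coordinate u - v is between `o.u - r.v` and `r.u - o.v`, which `angle_bounds`
  -- controls for K < 0.
  have hmem : (0 < K → |invU o T + invV o S| < Real.pi / 2) ∧
      (K < 0 → |invU o T - invV o S| < Real.pi / 2) := by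
    refine ⟨fun hK => ?_, fun hK => ?_⟩
    · have ho := abs_lt.1 (o.2.1 hK); have hr' := abs_lt.1 (r.2.1 hK)
      change _ < o.t ∧ o.t < _ at ho
      change _ < r.t ∧ r.t < _ at hr'
      simp only [u, v] at hu0 hv0 hu1 hv1
      rw [abs_lt]
      constructor <;> linarith
    · have := (hr.angle_bounds hK.ne).1
      simp only [sg, hK, if_true, mem_Ioo] at this
      rw [abs_lt]
      constructor <;> linarith
  let q : Model K := ⟨(invU o T + invV o S, invU o T - invV o S), hmem⟩
  have hqu : q.u = invU o T := by
    change ((invU o T + invV o S) + (invU o T - invV o S)) / 2 = _; ring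
  have hqv : q.v = invV o S := by
    change ((invU o T + invV o S) - (invU o T - invV o S)) / 2 = _; ring
  have hoq : causal o q := causal_iff_uv.2 ⟨hqu ▸ hu0, hqv ▸ hv0⟩
  have hqr : causal q r := causal_iff_uv.2 ⟨hqu ▸ hu1, hqv ▸ hv1⟩
  have hq : Reach o q := hr.of_between (causal_refl o) hoq hqr
  refine ⟨q, hq, hqr, ?_, ?_, hqu, hqv⟩
  · by_cases hK : K = 0
    · rw [chartU, if_pos hK, hqu, invU, if_pos hK]; ring
    · obtain ⟨h1, h2, h3, h4⟩ := hq.cos_pos hK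
      have h9 := sqrt_abs_pos hK
      rw [chartU, if_neg hK, div_eq_iff (by positivity)]
      have := sin_arctan_sub (T := √|K| * T) h4
      have h5 : q.u + sg K * o.v = Real.arctan ((√|K| * T + Real.sin (o.u + sg K * o.v)) /
          Real.cos (o.u + sg K * o.v)) := by rw [hqu, invU, if_neg hK]; ring
      rw [← h5, add_sub_add_right_eq_sub] at this
      rw [this]; ring
  · by_cases hK : K = 0
    · rw [chartV, if_pos hK, hqv, invV, if_pos hK]; ring
    · obtain ⟨h1, h2, h3, h4⟩ := hq.cos_pos hK
      have h9 := sqrt_abs_pos hK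
      rw [chartV, if_neg hK, div_eq_iff (by positivity)]
      have := sin_arctan_sub (T := √|K| * (sg K * S)) h4
      have h5 : o.u + sg K * q.v = Real.arctan ((√|K| * (sg K * S) +
          Real.sin (o.u + sg K * o.v)) / Real.cos (o.u + sg K * o.v)) := by
        rw [hqv, invV, if_neg hK, ← mul_assoc, sg_mul_self]; ring
      rw [← h5, add_sub_add_left_eq_sub, ← mul_sub] at this
      have h6 : sg K * Real.sin (q.v - o.v) = Real.sin (sg K * (q.v - o.v)) := by
        rcases sg_cases K with h | h <;> simp [h, ← Real.sin_neg]
      rw [← h6] at this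
      have h7 := sg_mul_self K
      linear_combination sg K * this - (Real.sin (q.v - o.v) - √|K| * S *
        Real.cos (o.u + sg K * q.v)) * h7

end Model

/-! ### Geodesics of the model spaces -/

/-- The time separation, regardless of the order, as a real number. -/
def ts {X : Type*} [CausalData X] (x y : X) : ℝ := (tauSym x y).toReal

theorem tauSym_comm {X : Type*} [CausalData X] (x y : X) : tauSym x y = tauSym y x := max_comm _ _

theorem ts_comm {X : Type*} [CausalData X] (x y : X) : ts x y = ts y x := by
  rw [ts, ts, tauSym_comm]

/-- The half-angle substitution. -/
theorem exists_half {K r : ℝ} (hr : InRange K r) :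
    ∃ h, 0 ≤ h ∧ 0 < 1 - K * h ^ 2 ∧ md K r = 2 * h ^ 2 / (1 - K * h ^ 2) ∧
      sn K r = 2 * h / (1 - K * h ^ 2) := by
  have h1 := two_add_mul_md_pos hr
  have h2 := md_nonneg K r
  have h0 := sn_sq K r
  generalize md K r = m at *
  obtain ⟨d, hd⟩ : ∃ d, d = 2 + K * m := ⟨_, rfl⟩
  rw [← hd] at h1
  have h3 : √(m / d) ^ 2 = m / d := Real.sq_sqrt (by positivity)
  have h4 : 1 - K * (m / d) = 2 / d := by field_simp; linear_combination hd
  -- This is the half-angle tangent: tanh(k r / 2) / k for K = k², tan(k r / 2) / k for K = -k², and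
  -- r / 2 for K = 0.
  refine ⟨√(m / d), Real.sqrt_nonneg _, ?_, ?_, ?_⟩
  · rw [h3, h4]; positivity
  · rw [h3, h4]; field_simp
  · rw [h3, h4]
    have h5 : 0 ≤ 2 * √(m / d) / (2 / d) := by positivity
    rw [← Real.sqrt_sq (sn_nonneg hr), ← Real.sqrt_sq h5, h0]
    congr 1
    rw [div_pow, mul_pow, h3]
    field_simp
    linear_combination -m * hd

theorem sn_eq_of_md {K r h : ℝ} (hr : InRange K r) (h0 : 0 ≤ h) (h1 : 0 < 1 - K * h ^ 2)
    (hm : md K r = 2 * h ^ 2 / (1 - K * h ^ 2)) : sn K r = 2 * h / (1 - K * h ^ 2) := by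
  have h5 : 0 ≤ 2 * h / (1 - K * h ^ 2) := by positivity
  rw [← Real.sqrt_sq (sn_nonneg hr), ← Real.sqrt_sq h5, sn_sq, hm]
  congr 1
  field_simp
  ring

namespace Model

variable {K : ℝ}

section

variable {o m p q r z w a b : Model K}

theorem Reach.tau_self (o : Model K) : tau o o = 0 := by
  obtain ⟨r, h1, h2, h3⟩ := (reach_self o).tau_eq
  rw [energy_self, ← md_zero K, md_inj h1 (inRange_zero K)] at h3
  simp [h2, h3]

theorem tau_eq_zero_of_causal (h : causal p q) : tau q p = 0 := by
  by_cases h' : causal q p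
  · rw [causal_antisymm h h']; exact Reach.tau_self q
  · exact tau_eq_zero h'

theorem tauSym_of_causal (h : causal p q) : tauSym p q = tau p q := by
  simp [tauSym, tau_eq_zero_of_causal h]

/-- The symmetrised separation of two points in a causal diamond below the diameter. -/
theorem Reach.ts_eq (h : Reach p q) :
    InRange K (ts p q) ∧ tau p q = ENNReal.ofReal (ts p q) ∧ md K (ts p q) = energy p q := by
  obtain ⟨r, h1, h2, h3⟩ := h.tau_eq
  have : ts p q = r := by
    rw [ts, tauSym_of_causal h.1, h2, ENNReal.toReal_ofReal h1.1]
  rw [this]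
  exact ⟨h1, h2, h3⟩

/-- The causal diamond between two points below the diameter. -/
def Diamond (o m z : Model K) : Prop := Reach o m ∧ causal o z ∧ causal z m

theorem Diamond.reach (h : Diamond o m z) : Reach o z :=
  h.1.of_between (causal_refl o) h.2.1 h.2.2

theorem Diamond.reach_of_causal (hp : Diamond o m p) (hq : Diamond o m q) (h : causal p q) :
    Reach p q :=
  hp.1.of_between hp.2.1 h hq.2.2

/-- Causally unrelated points have chart differences of opposite signs, hence energy at most zero.
Truncating the energy at zero therefore covers related and unrelated points alike. -/
theorem Diamond.ts_eq (hp : Diamond o m p) (hq : Diamond o m q) :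
    InRange K (ts p q) ∧ tauSym p q = ENNReal.ofReal (ts p q) ∧
      md K (ts p q) = max (energy p q) 0 := by
  by_cases h : causal p q
  · obtain ⟨h1, h2, h3⟩ := (hp.reach_of_causal hq h).ts_eq
    exact ⟨h1, by rw [tauSym_of_causal h, h2], by rw [← h3, max_eq_left (md_nonneg _ _)]⟩
  by_cases h' : causal q p
  · obtain ⟨h1, h2, h3⟩ := (hq.reach_of_causal hp h').ts_eq
    rw [ts_comm, tauSym_comm, energy_comm]
    exact ⟨h1, by rw [tauSym_of_causal h', h2], by rw [← h3, max_eq_left (md_nonneg _ _)]⟩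
  · have h0 : tauSym p q = 0 := by simp [tauSym, tau_eq_zero h, tau_eq_zero h']
    have h1 : ts p q = 0 := by simp [ts, h0]
    rw [h1, h0]
    refine ⟨inRange_zero K, by simp, ?_⟩
    rw [md_zero, eq_comm, max_eq_right_iff, energy_chart hp.reach hq.reach]
    have h2 := one_sub_chart_pos hp.reach
    have h3 := one_sub_chart_pos hq.reach
    rw [causal_iff_chart hp.reach hq.reach] at h
    rw [causal_iff_chart hq.reach hp.reach] at h'
    refine div_nonpos_of_nonpos_of_nonneg ?_ (by positivity)
    rw [mul_assoc]
    refine mul_nonpos_of_nonneg_of_nonpos (by norm_num) ?_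
    rcases le_total (chartU o p) (chartU o q) with h4 | h4 <;>
      rcases le_total (chartV o p) (chartV o q) with h5 | h5
    · exact absurd ⟨h4, h5⟩ h
    · exact mul_nonpos_of_nonneg_of_nonpos (by linarith) (by linarith)
    · exact mul_nonpos_of_nonpos_of_nonneg (by linarith) (by linarith)
    · exact absurd ⟨h4, h5⟩ h'

/-- The first component in a null frame at `z` of the direction to `q`. -/
def frameA (o z q : Model K) : ℝ :=
  (chartU o q - chartU o z) * (1 - K * chartU o z * chartV o q) /
    ((1 - K * chartU o z * chartV o z) * (1 - K * chartU o q * chartV o q))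

/-- The second component in a null frame at `z` of the direction to `q`. -/
def frameB (o z q : Model K) : ℝ :=
  (chartV o q - chartV o z) * (1 - K * chartU o q * chartV o z) /
    ((1 - K * chartU o z * chartV o z) * (1 - K * chartU o q * chartV o q))

/-- The hinge term is a symmetric bilinear form in the directions from z, written in a null frame.
Its quadratic form is 4AB. -/
theorem hinge_eq_frame (hz : Reach o z) (hq : Reach o q) (hr : Reach o r) :
    hinge z q r = 2 * (frameA o z q * frameB o z r + frameB o z q * frameA o z r) := by
  have h1 := one_sub_chart_pos hz
  have h2 := one_sub_chart_pos hq
  have h3 := one_sub_chart_pos hr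
  rw [hinge, energy_chart hz hq, energy_chart hz hr, energy_chart hq hr, frameA, frameA, frameB,
    frameB]
  generalize chartU o z = U at *
  generalize chartV o z = V at *
  generalize chartU o q = U' at *
  generalize chartV o q = V' at *
  generalize chartU o r = U'' at *
  generalize chartV o r = V'' at *
  obtain ⟨d1, hd1⟩ : ∃ d, d = 1 - K * U * V := ⟨_, rfl⟩
  obtain ⟨d2, hd2⟩ : ∃ d, d = 1 - K * U' * V' := ⟨_, rfl⟩
  obtain ⟨d3, hd3⟩ : ∃ d, d = 1 - K * U'' * V'' := ⟨_, rfl⟩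
  rw [← hd1] at h1
  rw [← hd2] at h2
  rw [← hd3] at h3
  rw [← hd1, ← hd2, ← hd3]
  field_simp
  rw [hd1, hd2, hd3]
  ring

/-- Points on a geodesic from `a` to `b` are in the direction of `b`. -/
theorem frame_of_between {s L : ℝ} (ha : Reach o a) (hp : Reach o p) (hb : Reach o b)
    (hL : InRange K L) (hL0 : 0 < L)
    (hab : energy a b = md K L) (hap : energy a p = md K s) (hpb : energy p b = md K (L - s)) :
    sn K L * frameA o a p = sn K s * frameA o a b ∧
      sn K L * frameB o a p = sn K s * frameB o a b := by
  have h1 := hinge_eq_frame ha hp hp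
  have h2 := hinge_eq_frame ha hb hb
  have h3 := hinge_eq_frame ha hp hb
  have h4 := sn_pos hL hL0
  rw [hinge_self, hap, ← sn_sq] at h1
  rw [hinge_self, hab, ← sn_sq] at h2
  rw [hinge, hap, hab, hpb, md_sub] at h3
  set A := frameA o a p
  set B := frameB o a p
  set A' := frameA o a b
  set B' := frameB o a b
  -- The three products of the directions to p and b are `sn s ^ 2`, `sn L ^ 2` and `sn s * sn L`.
  -- This is equality in the reversed Cauchy–Schwarz inequality, so the determinant of the two
  -- directions vanishes.
  have h5 : A * B' = B * A' := by
    have : (A * B' - B * A') ^ 2 = 0 := by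
      linear_combination -(1 / 4) * (sn K s * sn K L + 2 * (A * B' + B * A')) * h3 +
        (1 / 4) * sn K L ^ 2 * h1 + A * B * h2
    exact sub_eq_zero.1 (pow_eq_zero_iff two_ne_zero |>.1 this)
  constructor
  · apply mul_left_cancel₀ h4.ne'
    linear_combination A * h2 - A' * h3 + 2 * A' * h5
  · apply mul_left_cancel₀ h4.ne'
    linear_combination B * h2 - B' * h3 - 2 * B' * h5

theorem hinge_of_between {s L : ℝ} (ha : Reach o a) (hp : Reach o p) (hb : Reach o b)
    (hw : Reach o w) (hL : InRange K L) (hL0 : 0 < L)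
    (hab : energy a b = md K L) (hap : energy a p = md K s) (hpb : energy p b = md K (L - s)) :
    sn K L * hinge a p w = sn K s * hinge a b w := by
  obtain ⟨h1, h2⟩ := frame_of_between ha hp hb hL hL0 hab hap hpb
  rw [hinge_eq_frame ha hp hw, hinge_eq_frame ha hb hw]
  linear_combination 2 * frameB o a w * h1 + 2 * frameA o a w * h2

theorem segment_comm (p q : Model K) : segment p q = segment q p := union_comm _ _

theorem Diamond.of_mem_segment (hp : Diamond o m p) (hq : Diamond o m q) (hz : z ∈ segment p q) :
    Diamond o m z := by
  rcases hz with hz | hz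
  · exact ⟨hp.1, causal_trans hp.2.1 hz.1, causal_trans hz.2.1 hq.2.2⟩
  · exact ⟨hp.1, causal_trans hq.2.1 hz.1, causal_trans hz.2.1 hp.2.2⟩

theorem Diamond.ts_add (hp : Diamond o m p) (hq : Diamond o m q) (hz : z ∈ segment p q) :
    ts p z + ts z q = ts p q ∧ energy p z = md K (ts p z) ∧ energy z q = md K (ts z q) := by
  have key : ∀ {p q : Model K}, Diamond o m p → Diamond o m q → causal p z → causal z q →
      tau p z + tau z q = tau p q →
      ts p z + ts z q = ts p q ∧ energy p z = md K (ts p z) ∧ energy z q = md K (ts z q) := by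
    intro p q hp hq h1 h2 h3
    have hz : Diamond o m z := ⟨hp.1, causal_trans hp.2.1 h1, causal_trans h2 hq.2.2⟩
    have h4 := (hp.reach_of_causal hz h1).ts_eq
    have h5 := (hz.reach_of_causal hq h2).ts_eq
    have h6 := (hp.reach_of_causal hq (causal_trans h1 h2)).ts_eq
    refine ⟨?_, h4.2.2.symm, h5.2.2.symm⟩
    rw [h4.2.1, h5.2.1, h6.2.1, ← ENNReal.ofReal_add h4.1.1 h5.1.1,
      ENNReal.ofReal_eq_ofReal_iff (add_nonneg h4.1.1 h5.1.1) h6.1.1] at h3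
    exact h3
  rcases hz with hz | hz
  · exact key hp hq hz.1 hz.2.1 hz.2.2
  · obtain ⟨h1, h2, h3⟩ := key hq hp hz.1 hz.2.1 hz.2.2
    rw [ts_comm p z, ts_comm z q, ts_comm p q, energy_comm p z, energy_comm z q]
    exact ⟨by linarith, h3, h2⟩

theorem Diamond.energy_eq (hp : Diamond o m p) (hq : Diamond o m q) (h : 0 < ts p q) :
    energy p q = md K (ts p q) := by
  obtain ⟨h1, -, h2⟩ := hp.ts_eq hq
  have h3 := md_pos h1 h
  rcases max_choice (energy p q) 0 with h4 | h4 <;> rw [h4] at h2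
  · exact h2.symm
  · linarith

/-- In a triangle of the model space, the hinge term is proportional along the sides. -/
theorem Diamond.hinge_of_mem_segment (ha : Diamond o m a) (hb : Diamond o m b)
    (hw : Diamond o m w) (hp : p ∈ segment a b) (hab : 0 < ts a b) :
    sn K (ts a b) * hinge a p w = sn K (ts a p) * hinge a b w := by
  obtain ⟨h1, h2, h3⟩ := ha.ts_add hb hp
  refine hinge_of_between ha.reach (ha.of_mem_segment hb hp).reach hb.reach hw.reach
    (ha.ts_eq hb).1 hab (ha.energy_eq hb hab) h2 ?_
  rw [h3, ← h1]; ring_nf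

/-- A causal geodesic between points below the diameter. -/
theorem Reach.exists_geodesic (h : Reach z w) :
    ∃ c : I → Model K, c 0 = z ∧ c 1 = w ∧ Continuous (fun s => (c s).u) ∧
      Continuous (fun s => (c s).v) ∧ (∀ s t, s ≤ t → causal (c s) (c t)) ∧
      (∀ s t, s ≤ t → tau (c s) (c t) = ENNReal.ofReal (ts z (c t) - ts z (c s))) ∧
      Monotone (fun s => ts z (c s)) ∧ Continuous (fun s => energy z (c s)) := by
  have hU := chartU_nonneg h
  have hV := chartV_nonneg h
  -- Geodesics through the centre of the charts are straight lines in them, so the curve is s ↦ (sU,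
  -- sV).
  have hex : ∀ s : I, ∃ q : Model K, Reach z q ∧ causal q w ∧ chartU z q = s * chartU z w ∧
      chartV z q = s * chartV z w ∧ q.u = invU z (s * chartU z w) ∧
      q.v = invV z (s * chartV z w) := fun s =>
    exists_chart_eq h (mul_nonneg s.2.1 hU) (mul_le_of_le_one_left hU s.2.2)
      (mul_nonneg s.2.1 hV) (mul_le_of_le_one_left hV s.2.2)
  choose c hc hcw hcU hcV hcu hcv using hex
  set U := chartU z w
  set V := chartV z w
  have hpos : ∀ s : I, 0 < 1 - K * (s * U) * (s * V) := fun s => by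
    have := one_sub_chart_pos (hc s)
    rwa [hcU, hcV] at this
  have hen : ∀ s t : I, energy (c s) (c t) = 2 * (t * U - s * U) * (t * V - s * V) /
      ((1 - K * (s * U) * (s * V)) * (1 - K * (t * U) * (t * V))) := fun s t => by
    rw [energy_chart (hc s) (hc t), hcU, hcU, hcV, hcV]
  have h0 : c 0 = z := eq_of_chart_eq (hc 0) (reach_self z) (by simp [hcU]) (by simp [hcV])
  have hen0 : ∀ s : I, energy z (c s) = 2 * (s * U) * (s * V) / (1 - K * (s * U) * (s * V)) :=
    fun s => by rw [← h0, hen]; simp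
  have hcc : ∀ s t : I, s ≤ t → causal (c s) (c t) := fun s t hst => by
    rw [causal_iff_chart (hc s) (hc t), hcU, hcU, hcV, hcV]
    have : (s : ℝ) ≤ t := hst
    exact ⟨by gcongr, by gcongr⟩
  -- The half-angle parameter of the distance from z is `s * √(U * V)`. With it `md_sub` turns
  -- additivity of the separation along the curve into a rational identity.
  have hmd : ∀ s : I, md K (ts z (c s)) = 2 * (s * √(U * V)) ^ 2 / (1 - K * (s * √(U * V)) ^ 2) ∧
      sn K (ts z (c s)) = 2 * (s * √(U * V)) / (1 - K * (s * √(U * V)) ^ 2) ∧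
      0 < 1 - K * (s * √(U * V)) ^ 2 := fun s => by
    have h1 : (s * √(U * V)) ^ 2 = (s * U) * (s * V) := by
      rw [mul_pow, Real.sq_sqrt (mul_nonneg hU hV)]; ring
    have h2 : 0 < 1 - K * (s * √(U * V)) ^ 2 := by
      rw [h1, ← mul_assoc]; exact hpos s
    have h3 : md K (ts z (c s)) = 2 * (s * √(U * V)) ^ 2 / (1 - K * (s * √(U * V)) ^ 2) := by
      rw [(hc s).ts_eq.2.2, hen0, h1]; ring
    exact ⟨h3, sn_eq_of_md (hc s).ts_eq.1 (mul_nonneg s.2.1 (Real.sqrt_nonneg _)) h2 h3, h2⟩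
  have hmono : ∀ s t : I, s ≤ t → ts z (c s) ≤ ts z (c t) := fun s t hst => by
    rw [← md_le_md (hc s).ts_eq.1 (hc t).ts_eq.1, (hc s).ts_eq.2.2, (hc t).ts_eq.2.2,
      ← sub_nonneg]
    have h1 : energy z (c t) - energy z (c s) = 2 * (U * V) * ((t : ℝ) ^ 2 - s ^ 2) /
        ((1 - K * (t * U) * (t * V)) * (1 - K * (s * U) * (s * V))) := by
      have h2 := hpos s
      have h3 := hpos t
      rw [hen0, hen0, div_sub_div _ _ h3.ne' h2.ne']
      congr 1
      ring
    rw [h1]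
    have h2 := hpos s
    have h3 := hpos t
    have h4 : (s : ℝ) ≤ t := hst
    have h5 : 0 ≤ (t : ℝ) ^ 2 - s ^ 2 := by nlinarith [s.2.1]
    positivity
  refine ⟨c, h0, ?_, ?_, ?_, hcc, fun s t hst => ?_, fun s t => hmono s t, ?_⟩
  · exact eq_of_chart_eq (hc 1) h (by simp [hcU, U]) (by simp [hcV, V])
  · simp only [hcu]
    exact (continuous_invU z).comp (by fun_prop)
  · simp only [hcv]
    exact (continuous_invV z).comp (by fun_prop)
  · have hr : Reach (c s) (c t) := h.of_between (hc s).1 (hcc s t hst) (hcw t)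
    have h1 : InRange K (ts z (c t) - ts z (c s)) :=
      (hc t).ts_eq.1.mono (sub_nonneg.2 (hmono s t hst)) (by linarith [(hc s).ts_eq.1.1])
    rw [hr.ts_eq.2.1]
    congr 1
    rw [← md_inj hr.ts_eq.1 h1, hr.ts_eq.2.2, hen, md_sub, (hmd s).1, (hmd t).1, (hmd s).2.1,
      (hmd t).2.1]
    have h2 := (hmd s).2.2
    have h3 := (hmd t).2.2
    have h4 : ∀ s : I, (s : ℝ) * U * (s * V) = (s * √(U * V)) ^ 2 := fun s => by
      rw [mul_pow, Real.sq_sqrt (mul_nonneg hU hV)]; ring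
    have h5 : (t * U - s * U) * (t * V - s * V) = ((t : ℝ) * √(U * V) - s * √(U * V)) ^ 2 := by
      linear_combination -((t : ℝ) - s) ^ 2 * Real.sq_sqrt (mul_nonneg hU hV)
    rw [mul_assoc, h5, mul_assoc K, mul_assoc K, h4, h4]
    generalize (s : ℝ) * √(U * V) = x at *
    generalize (t : ℝ) * √(U * V) = y at *
    obtain ⟨d1, hd1⟩ : ∃ d, d = 1 - K * x ^ 2 := ⟨_, rfl⟩
    obtain ⟨d2, hd2⟩ : ∃ d, d = 1 - K * y ^ 2 := ⟨_, rfl⟩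
    rw [← hd1] at h2
    rw [← hd2] at h3
    rw [← hd1, ← hd2]
    field_simp
    rw [hd1, hd2]
    ring
  · simp only [hen0]
    refine Continuous.div (by fun_prop) (by fun_prop) fun s => (hpos s).ne'

/-- The intermediate value theorem is applied to the energy along the geodesic, since it is visibly
continuous in the parameter and determines the distance from z. -/
theorem Reach.exists_mem_segment_aux (h : Reach z w) {s : ℝ} (hs : 0 ≤ s) (hs' : s ≤ ts z w) :
    ∃ p, p ∈ segment z w ∧ ts z p = s := by
  obtain ⟨c, h0, h1, -, -, hc, ht, -, he⟩ := h.exists_geodesic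
  have hsr := h.ts_eq.1.mono hs hs'
  obtain ⟨κ, hκ⟩ : ∃ κ : I, energy z (c κ) = md K s := by
    have := intermediate_value_univ (0 : I) 1 he
    simp only [h0, h1, energy_self] at this
    refine this ⟨md_nonneg _ _, ?_⟩
    rw [← h.ts_eq.2.2]
    exact (md_le_md hsr h.ts_eq.1).2 hs'
  have hz : causal z (c κ) := h0 ▸ hc 0 κ κ.2.1
  have hw : causal (c κ) w := h1 ▸ hc κ 1 κ.2.2
  have hr : Reach z (c κ) := h.of_between (causal_refl z) hz hw
  refine ⟨c κ, Or.inl ⟨hz, hw, ?_⟩, ?_⟩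
  · have h2 := ht κ 1 κ.2.2
    have h3 : ts z (c κ) ≤ ts z w := by
      rw [← md_le_md hr.ts_eq.1 h.ts_eq.1, hr.ts_eq.2.2, hκ]
      exact (md_le_md hsr h.ts_eq.1).2 hs'
    rw [h1] at h2
    rw [h2, hr.ts_eq.2.1, h.ts_eq.2.1, ← ENNReal.ofReal_add hr.ts_eq.1.1 (by linarith)]
    ring_nf
  · rw [← md_inj hr.ts_eq.1 hsr, hr.ts_eq.2.2, hκ]

end

end Model

/-! ### Filled triangles in the model spaces -/

namespace Model

variable {K : ℝ}

section

variable {o m p q r z w a b y : Model K}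

/-- Linear coordinates centred at `o`, in which geodesics span planes. -/
def vec (o q : Model K) : ℝ × ℝ × ℝ := (1 + K * energy o q, frameA o o q, frameB o o q)

theorem frameA_self (o q : Model K) :
    frameA o o q = chartU o q / (1 - K * chartU o q * chartV o q) := by
  simp [frameA]

theorem frameB_self (o q : Model K) :
    frameB o o q = chartV o q / (1 - K * chartU o q * chartV o q) := by
  simp [frameB]

theorem Reach.energy_chart_self (hq : Reach o q) :
    energy o q = 2 * chartU o q * chartV o q / (1 - K * chartU o q * chartV o q) := by
  rw [energy_chart (reach_self o) hq]; simp

theorem sn_sq_eq_frame (hq : Reach o q) :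
    sn K (ts o q) ^ 2 = 4 * (frameA o o q * frameB o o q) := by
  rw [sn_sq, hq.ts_eq.2.2, ← hinge_self, hinge_eq_frame (reach_self o) hq hq]; ring

theorem one_add_mul_div {U V : ℝ} (h : 0 < 1 - K * U * V) :
    1 + K * (2 * U * V / (1 - K * U * V)) = 2 * (1 / (1 - K * U * V)) - 1 := by
  obtain ⟨d, hd⟩ : ∃ d, d = 1 - K * U * V := ⟨_, rfl⟩
  rw [← hd] at h ⊢
  field_simp
  linear_combination 2 * hd

/-- A point is determined by its linear coordinates up to positive factors. -/
theorem eq_of_vec_eq_smul (hq : Reach o q) (hr : Reach o r) {ν : ℝ} (hν : 0 ≤ ν)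
    (h : vec o q = ν • vec o r) : q = r := by
  simp only [vec, Prod.smul_mk, smul_eq_mul, Prod.mk.injEq] at h
  obtain ⟨h1, h2, h3⟩ := h
  -- The linear coordinates lie on a quadric, which a ray of nonnegative multiples meets at most
  -- once. This forces ν = 1.
  have key : ∀ {q : Model K}, Reach o q →
      (1 + K * energy o q) ^ 2 - 4 * K * (frameA o o q * frameB o o q) = 1 := by
    intro q hq
    have := sn_sq_eq_frame hq
    rw [sn_sq, hq.ts_eq.2.2] at this
    linear_combination K * this
  have h4 : ν = 1 := by
    have h5 := key hq
    have h6 := key hr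
    rw [h1, h2, h3] at h5
    have : ν ^ 2 = 1 := by linear_combination h5 - ν ^ 2 * h6
    nlinarith
  subst h4
  rw [one_mul] at h1 h2 h3
  have key2 : ∀ {q : Model K}, Reach o q →
      1 + (1 + K * energy o q) = 2 / (1 - K * chartU o q * chartV o q) := by
    intro q hq
    have h5 := one_sub_chart_pos hq
    rw [hq.energy_chart_self, one_add_mul_div h5]; ring
  have h5 := one_sub_chart_pos hq
  have h6 := one_sub_chart_pos hr
  have h7 : 1 - K * chartU o q * chartV o q = 1 - K * chartU o r * chartV o r := by
    have h8 := key2 hq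
    rw [h1, key2 hr, div_eq_div_iff h6.ne' h5.ne'] at h8
    linarith
  rw [frameA_self, frameA_self, h7, div_left_inj' h6.ne'] at h2
  rw [frameB_self, frameB_self, h7, div_left_inj' h6.ne'] at h3
  exact eq_of_chart_eq hq hr h2 h3

/-- The linear coordinates of `q` in a frame moved to `z`. -/
theorem vec_eq_frame (hz : Reach o z) :
    ∃ S T : ℝ × ℝ × ℝ, ∀ q, Reach o q →
      vec o q = (1 + K * energy z q) • vec o z + frameA o z q • S + frameB o z q • T := by
  -- The two vectors are the partial derivatives of `vec` at z in the null charts, multiplied by `1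
  -- - K U V`.
  refine ⟨(1 - K * chartU o z * chartV o z)⁻¹ •
    (2 * K * chartV o z, 1, K * chartV o z ^ 2), (1 - K * chartU o z * chartV o z)⁻¹ •
    (2 * K * chartU o z, K * chartU o z ^ 2, 1), fun q hq => ?_⟩
  have h1 := one_sub_chart_pos hz
  have h2 := one_sub_chart_pos hq
  simp only [vec, hq.energy_chart_self, hz.energy_chart_self, energy_chart hz hq, frameA_self,
    frameB_self]
  rw [frameA, frameB]
  generalize chartU o z = U at *
  generalize chartV o z = V at *
  generalize chartU o q = U' at *
  generalize chartV o q = V' at *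
  obtain ⟨d1, hd1⟩ : ∃ d, d = 1 - K * U * V := ⟨_, rfl⟩
  obtain ⟨d2, hd2⟩ : ∃ d, d = 1 - K * U' * V' := ⟨_, rfl⟩
  rw [← hd1] at h1
  rw [← hd2] at h2
  rw [← hd1, ← hd2]
  simp only [Prod.smul_mk, Prod.mk_add_mk, smul_eq_mul, Prod.mk.injEq]
  refine ⟨?_, ?_, ?_⟩ <;> field_simp <;> rw [hd1, hd2] <;> ring

/-- Points on timelike geodesics in linear coordinates. -/
theorem Diamond.vec_of_mem_segment (hp : Diamond o m p) (hq : Diamond o m q)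
    (hpq : 0 < ts p q) (hz : z ∈ segment p q) :
    sn K (ts p q) • vec o z = sn K (ts p q - ts p z) • vec o p + sn K (ts p z) • vec o q := by
  obtain ⟨S, T, h⟩ := vec_eq_frame hp.reach
  obtain ⟨h1, h2, h3⟩ := hp.ts_add hq hz
  have hzd := hp.of_mem_segment hq hz
  have h4 := hp.energy_eq hq hpq
  obtain ⟨h5, h6⟩ := frame_of_between hp.reach hzd.reach hq.reach (hp.ts_eq hq).1 hpq h4 h2
    (by rw [h3, ← h1]; ring_nf)
  rw [h z hzd.reach, h q hq.reach, h2, h4]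
  simp only [smul_add, smul_smul, ← h5, ← h6, sn_sub]
  module

/-- On a null line U is constant, and 1 / (1 - K U V) and V / (1 - K U V) are fractional linear in V
with the same denominator. The weights are those of V' between V and V'', rescaled by the
denominators. -/
theorem null_segment_aux {U V V' V'' : ℝ} (h1 : 0 < 1 - K * U * V) (h2 : 0 < 1 - K * U * V')
    (h3 : 0 < 1 - K * U * V'') (hV : V ≤ V') (hV' : V' ≤ V'') (hne : V < V'') :
    ∃ c d : ℝ, 0 ≤ c ∧ 0 ≤ d ∧
      1 / (1 - K * U * V') = c * (1 / (1 - K * U * V)) + d * (1 / (1 - K * U * V'')) ∧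
      V' / (1 - K * U * V') = c * (V / (1 - K * U * V)) + d * (V'' / (1 - K * U * V'')) := by
  obtain ⟨d1, hd1⟩ : ∃ d, d = 1 - K * U * V := ⟨_, rfl⟩
  obtain ⟨d2, hd2⟩ : ∃ d, d = 1 - K * U * V' := ⟨_, rfl⟩
  obtain ⟨d3, hd3⟩ : ∃ d, d = 1 - K * U * V'' := ⟨_, rfl⟩
  rw [← hd1] at h1 ⊢
  rw [← hd2] at h2 ⊢
  rw [← hd3] at h3 ⊢
  have h4 := sub_pos.2 hne
  have h5 := sub_nonneg.2 hV
  have h6 := sub_nonneg.2 hV'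
  refine ⟨(V'' - V') * d1 / ((V'' - V) * d2), (V' - V) * d3 / ((V'' - V) * d2),
    by positivity, by positivity, ?_, ?_⟩
  · field_simp; ring
  · field_simp; ring

theorem Diamond.vec_of_mem_null_segment (hp : Diamond o m p) (hq : Diamond o m q)
    (hpq : energy p q = 0) (hpz : causal p z) (hzq : causal z q) :
    ∃ c d : ℝ, 0 ≤ c ∧ 0 ≤ d ∧ vec o z = c • vec o p + d • vec o q := by
  have hz : Diamond o m z := ⟨hp.1, causal_trans hp.2.1 hpz, causal_trans hzq hq.2.2⟩
  have h1 := one_sub_chart_pos hp.reach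
  have h2 := one_sub_chart_pos hz.reach
  have h3 := one_sub_chart_pos hq.reach
  by_cases hne : p = q
  · subst hne
    exact ⟨1, 0, by norm_num, by norm_num, by simp [causal_antisymm hpz hzq]⟩
  rw [energy_chart hp.reach hq.reach, div_eq_zero_iff, mul_assoc, mul_eq_zero, mul_eq_zero,
    or_iff_left (by positivity)] at hpq
  have h4 := (causal_iff_chart hp.reach hz.reach).1 hpz
  have h5 := (causal_iff_chart hz.reach hq.reach).1 hzq
  have hvec : ∀ {q : Model K}, Reach o q → vec o q =
      (2 * (1 / (1 - K * chartU o q * chartV o q)) - 1,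
        chartU o q / (1 - K * chartU o q * chartV o q),
        chartV o q / (1 - K * chartU o q * chartV o q)) := by
    intro q hq
    have h := one_sub_chart_pos hq
    rw [vec, hq.energy_chart_self, frameA_self, frameB_self]
    congr 1
    exact one_add_mul_div h
  rw [hvec hp.reach, hvec hq.reach, hvec hz.reach]
  -- The functional 1/D - K U (V/D), with D = 1 - K U V, equals one at every point of the null line,
  -- so the weights add up to one. The constant -1 in the first linear coordinate requires this.
  have hcd : ∀ {U V V' V'' c d : ℝ}, 0 < 1 - K * U * V → 0 < 1 - K * U * V' →
      0 < 1 - K * U * V'' →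
      1 / (1 - K * U * V') = c * (1 / (1 - K * U * V)) + d * (1 / (1 - K * U * V'')) →
      V' / (1 - K * U * V') = c * (V / (1 - K * U * V)) + d * (V'' / (1 - K * U * V'')) →
      c + d = 1 := by
    intro U V V' V'' c d h1 h2 h3 h6 h7
    have e : ∀ {V}, 0 < 1 - K * U * V →
        1 / (1 - K * U * V) - K * U * (V / (1 - K * U * V)) = 1 := fun h => by
      rw [mul_div_assoc', ← sub_div, div_self h.ne']
    have := e h2
    rw [h6, h7] at this
    linear_combination this - c * e h1 - d * e h3
  rcases hpq.resolve_left (by norm_num) with h | h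
  · have e1 : chartU o q = chartU o p := sub_eq_zero.1 h
    have e2 : chartU o z = chartU o p := le_antisymm (h5.1.trans e1.le) h4.1
    rw [e1] at h3 ⊢
    rw [e2] at h2 ⊢
    have hlt : chartV o p < chartV o q := (h4.2.trans h5.2).lt_of_ne fun h' =>
      hne (eq_of_chart_eq hp.reach hq.reach e1.symm h')
    obtain ⟨c, d, hc, hd, h6, h7⟩ := null_segment_aux h1 h2 h3 h4.2 h5.2 hlt
    refine ⟨c, d, hc, hd, ?_⟩
    simp only [Prod.smul_mk, Prod.mk_add_mk, smul_eq_mul, Prod.mk.injEq]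
    have h8 := hcd h1 h2 h3 h6 h7
    refine ⟨by linear_combination 2 * h6 + h8, ?_, h7⟩
    simp only [div_eq_mul_one_div (chartU o p)]
    linear_combination chartU o p * h6
  · have e1 : chartV o q = chartV o p := sub_eq_zero.1 h
    have e2 : chartV o z = chartV o p := le_antisymm (h5.2.trans e1.le) h4.2
    rw [e1, mul_right_comm K (chartU o q)] at h3 ⊢
    rw [e2, mul_right_comm K (chartU o z)] at h2 ⊢
    rw [mul_right_comm] at h1
    rw [mul_right_comm K (chartU o p)]
    have hlt : chartU o p < chartU o q := (h4.1.trans h5.1).lt_of_ne fun h' =>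
      hne (eq_of_chart_eq hp.reach hq.reach h' e1.symm)
    obtain ⟨c, d, hc, hd, h6, h7⟩ := null_segment_aux h1 h2 h3 h4.1 h5.1 hlt
    refine ⟨c, d, hc, hd, ?_⟩
    simp only [Prod.smul_mk, Prod.mk_add_mk, smul_eq_mul, Prod.mk.injEq]
    have h8 := hcd h1 h2 h3 h6 h7
    refine ⟨by linear_combination 2 * h6 + h8, h7, ?_⟩
    simp only [div_eq_mul_one_div (chartV o p)]
    linear_combination chartV o p * h6

theorem Diamond.vec_of_mem_causal_segment (hp : Diamond o m p) (hq : Diamond o m q)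
    (hpq : causal p q) (hz : z ∈ segment p q) :
    ∃ c d : ℝ, 0 ≤ c ∧ 0 ≤ d ∧ vec o z = c • vec o p + d • vec o q := by
  obtain ⟨h1, h2, h3⟩ := (hp.reach_of_causal hq hpq).ts_eq
  rcases h1.1.eq_or_lt with h0 | h0
  · rw [← h0, md_zero] at h3
    rcases hz with hz | hz
    · exact hp.vec_of_mem_null_segment hq h3.symm hz.1 hz.2.1
    · have : p = q := causal_antisymm hpq (causal_trans hz.1 hz.2.1)
      subst this
      exact hp.vec_of_mem_null_segment hq h3.symm hz.1 hz.2.1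
  · have h4 := hp.vec_of_mem_segment hq h0 hz
    have h5 := hp.ts_add hq hz
    have hz' := hp.of_mem_segment hq hz
    have h6 := (hp.ts_eq hz').1
    have h7 := (hz'.ts_eq hq).1
    have h8 := sn_pos h1 h0
    rw [show ts p q - ts p z = ts z q by linarith] at h4
    refine ⟨sn K (ts z q) / sn K (ts p q), sn K (ts p z) / sn K (ts p q),
      div_nonneg (sn_nonneg h7) h8.le, div_nonneg (sn_nonneg h6) h8.le, ?_⟩
    have h9 := congrArg ((sn K (ts p q))⁻¹ • ·) h4
    simp only [smul_smul, inv_mul_cancel₀ h8.ne', one_smul, smul_add] at h9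
    rw [h9, div_eq_inv_mul, div_eq_inv_mul]

/-- The filled triangle with vertices `p`, `q`, `r` where `p` is the minimal and `r` the maximal
vertex. -/
def filled (p q r : Model K) : Set (Model K) :=
  {z | Diamond p r z ∧ ∃ c₁ c₂ c₃ : ℝ, 0 ≤ c₁ ∧ 0 ≤ c₂ ∧ 0 ≤ c₃ ∧
    vec p z = c₁ • vec p p + c₂ • vec p q + c₃ • vec p r}

/-- In linear coordinates every point of a causal segment is a nonnegative combination of the
endpoints, and diamonds are causally convex, so the cone is closed under segments. The opposite
inclusion is not needed. -/
theorem conv_subset_filled (hpr : Reach p r) (hpq : causal p q) (hqr : causal q r) :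
    conv {p, q, r} ⊆ filled p q r := by
  refine sInter_subset_of_mem ⟨?_, ?_⟩
  · rintro z (rfl | rfl | rfl)
    · exact ⟨⟨hpr, causal_refl _, hpr.1⟩, 1, 0, 0, by norm_num, le_rfl, le_rfl, by simp⟩
    · exact ⟨⟨hpr, hpq, hqr⟩, 0, 1, 0, le_rfl, by norm_num, le_rfl, by simp⟩
    · exact ⟨⟨hpr, hpr.1, causal_refl _⟩, 0, 0, 1, le_rfl, le_rfl, by norm_num, by simp⟩
  · rintro w ⟨hw, c₁, c₂, c₃, h1, h2, h3, h⟩ w' ⟨hw', d₁, d₂, d₃, h1', h2', h3', h'⟩ hww z hz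
    obtain ⟨c, d, hc, hd, hcd⟩ := hw.vec_of_mem_causal_segment hw' hww hz
    refine ⟨hw.of_mem_segment hw' hz, c * c₁ + d * d₁, c * c₂ + d * d₂, c * c₃ + d * d₃,
      by positivity, by positivity, by positivity, ?_⟩
    rw [hcd, h, h']
    module

/-- Comparing linear coordinates gives `sn (ts p z) = ν * sn (ts p y)`, and c ≥ 0 excludes that z
lies beyond y. The point of the segment at the same distance from p then has the same coordinates.
-/
theorem mem_segment_of_vec_eq (hy : Reach p y) (hz : Reach p z) (hpy : 0 < ts p y) {c ν : ℝ}
    (hc : 0 ≤ c) (hν : 0 ≤ ν) (h : vec p z = c • vec p p + ν • vec p y) : z ∈ segment p y := by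
  have hself : vec p p = (1, 0, 0) := by simp [vec, energy_self, frameA_self, frameB_self]
  have h' := h
  rw [hself] at h'
  simp only [vec, Prod.smul_mk, smul_eq_mul, Prod.mk_add_mk, Prod.mk.injEq, mul_zero, zero_add,
    mul_one] at h'
  obtain ⟨h1, h2, h3⟩ := h'
  have hzr := hz.ts_eq
  have hyr := hy.ts_eq
  have h4 : sn K (ts p z) = ν * sn K (ts p y) := by
    rw [← Real.sqrt_sq (sn_nonneg hzr.1), ← Real.sqrt_sq (mul_nonneg hν (sn_nonneg hyr.1)),
      mul_pow, sn_sq_eq_frame hz, sn_sq_eq_frame hy, h2, h3]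
    ring_nf
  have h5 : ts p z ≤ ts p y := by
    by_contra! hlt
    have h6 : sn K (ts p z - ts p y) = -(c * sn K (ts p y)) := by
      rw [sn_sub, hzr.2.2, hyr.2.2, h4, h1]; ring
    have h7 : InRange K (ts p z - ts p y) :=
      hzr.1.mono (by linarith) (by linarith)
    have h8 := sn_pos h7 (by linarith)
    have h9 := mul_nonneg hc (sn_nonneg hyr.1)
    linarith
  obtain ⟨w, hw, hwz⟩ := hy.exists_mem_segment_aux hzr.1.1 h5
  have dp : Diamond p y p := ⟨hy, causal_refl p, hy.1⟩
  have dy : Diamond p y y := ⟨hy, hy.1, causal_refl y⟩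
  have h6 := dp.vec_of_mem_segment dy hpy hw
  have hwr := (dp.of_mem_segment dy hw).reach
  suffices z = w by rwa [this]
  refine eq_of_vec_eq_smul hz hwr zero_le_one ?_
  rw [one_smul]
  have h7 := sn_pos hyr.1 hpy
  have h8 : sn K (ts p y) • vec p z = sn K (ts p y) • vec p w := by
    rw [h6, h, hwz, sn_sub, hzr.2.2, hyr.2.2, h4, h1]
    module
  exact smul_right_injective _ h7.ne' h8

/-- The filled triangle is a union of geodesics starting at the minimal vertex. -/
theorem exists_mem_segment_of_mem_filled (hpr : Reach p r) (hpq : chron p q) (hqr : chron q r)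
    (hz : z ∈ filled p q r) : ∃ y ∈ segment q r, z ∈ segment p y := by
  obtain ⟨hzd, c₁, c₂, c₃, h1, h2, h3, h⟩ := hz
  have dq : Diamond p r q := ⟨hpr, causal_of_chron hpq, causal_of_chron hqr⟩
  have dr : Diamond p r r := ⟨hpr, hpr.1, causal_refl r⟩
  have dp : Diamond p r p := ⟨hpr, causal_refl p, hpr.1⟩
  have hqr' := dq.reach_of_causal dr dq.2.2
  have pos : ∀ {p' q' : Model K}, Diamond p r p' → Diamond p r q' → chron p' q' →
      0 < ts p' q' := by
    intro p' q' hp hq hc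
    obtain ⟨e1, -, e2⟩ := (hp.reach_of_causal hq (causal_of_chron hc)).ts_eq
    refine e1.1.lt_of_ne fun h0 => ?_
    rw [← h0, md_zero, energy_chart hp.reach hq.reach] at e2
    have e3 := one_sub_chart_pos hp.reach
    have e4 := one_sub_chart_pos hq.reach
    obtain ⟨e5, e6⟩ := (chron_iff_chart hp.reach hq.reach).1 hc
    rw [← sub_pos] at e5 e6
    exact e2.not_lt (by positivity)
  have hL := pos dq dr hqr
  have hLr := hqr'.ts_eq.1
  -- The point at distance s from q has weights in the ratio sn(L - s) : sn s, with L the length of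
  -- [q, r]. The zero s makes the part c₂ q + c₃ r of z a multiple of this point.
  obtain ⟨s, hs, hs0⟩ := intermediate_value_Icc hLr.1
    (f := fun s => c₂ * sn K s - c₃ * sn K (ts q r - s))
    (by have := continuous_sn K; fun_prop)
    (show (0 : ℝ) ∈ Icc _ _ by
      have := sn_pos hLr hL
      constructor <;> simp <;> positivity)
  obtain ⟨y, hy, hys⟩ := hqr'.exists_mem_segment_aux hs.1 hs.2
  refine ⟨y, hy, ?_⟩
  have hyd := dq.of_mem_segment dr hy
  have h4 := dq.vec_of_mem_segment dr hL hy
  have h5 := sn_pos hLr hL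
  have hqy : causal q y := by
    rcases hy with hy | hy
    · exact hy.1
    · rw [causal_antisymm hqr'.1 (causal_trans hy.1 hy.2.1)]
      exact causal_antisymm hqr'.1 (causal_trans hy.1 hy.2.1) ▸ hy.1
  have hpy : 0 < ts p y := by
    refine pos dp hyd ?_
    rw [chron_iff_uv] at hpq ⊢
    have := causal_iff_uv.1 hqy
    exact ⟨hpq.1.trans_le this.1, hpq.2.trans_le this.2⟩
  have h6 : InRange K (ts q r - s) := hLr.mono (by linarith [hs.2]) (by linarith [hs.1])
  have h7 : InRange K s := hLr.mono hs.1 hs.2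
  have h8 : 0 < sn K (ts q r - s) + sn K s := by
    rcases hs.1.eq_or_lt with h | h
    · rw [← h, sub_zero, sn_zero, add_zero]; exact h5
    · have := sn_pos h7 h; have := sn_nonneg h6; positivity
  refine mem_segment_of_vec_eq hyd.reach hzd.reach hpy h1
    (ν := (c₂ + c₃) / (sn K (ts q r - s) + sn K s) * sn K (ts q r)) (by positivity) ?_
  rw [h, mul_smul, h4, smul_add, smul_smul, smul_smul, hys, add_assoc]
  congr 3
  · field_simp; linear_combination hs0
  · field_simp; linear_combination -hs0

end

end Model

/-! ### Comparison triangles -/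

/-- The hinge term of a triangle with side lengths `x`, `y` adjacent and `z` opposite to the
vertex. -/
def hingeNum (K x y z : ℝ) : ℝ := md K x + md K y + K * md K x * md K y - md K z

theorem hingeNum_comm (K x y z : ℝ) : hingeNum K x y z = hingeNum K y x z := by
  unfold hingeNum; ring

theorem inRange_of_lt_modelDiam {K : ℝ} {a : ℝ≥0∞} (h : a < modelDiam K) :
    InRange K a.toReal ∧ a = ENNReal.ofReal a.toReal := by
  have h1 := (ENNReal.ofReal_toReal h.ne_top).symm
  refine ⟨⟨ENNReal.toReal_nonneg, fun hK => ?_⟩, h1⟩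
  have := Real.sqrt_pos.2 (neg_pos.2 hK)
  rw [h1, modelDiam, if_pos hK, ENNReal.ofReal_lt_ofReal_iff (by positivity),
    lt_div_iff₀ this, mul_comm] at h
  exact h

theorem causal_or_of_tauSym_pos {K : ℝ} {p q : Model K} (h : 0 < tauSym p q) :
    causal p q ∨ causal q p := by
  rcases lt_max_iff.1 h with h | h
  · exact Or.inl (Model.causal_of_tau_pos h)
  · exact Or.inr (Model.causal_of_tau_pos h)

theorem reach_or_of_tauSym {K : ℝ} {p q : Model K} (h : 0 < tauSym p q)
    (h' : tauSym p q < modelDiam K) : Model.Reach p q ∨ Model.Reach q p := by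
  rcases causal_or_of_tauSym_pos h with h | h
  · exact Or.inl (Model.reach_of_tau_lt h ((le_max_left _ _).trans_lt h'))
  · exact Or.inr (Model.reach_of_tau_lt h ((le_max_right _ _).trans_lt h'))

open Model in
theorem Model.Diamond.exists_mem_segment {K : ℝ} {o m a b : Model K} (ha : Diamond o m a)
    (hb : Diamond o m b) (hab : 0 < ts a b) {s : ℝ} (hs : 0 ≤ s) (hs' : s ≤ ts a b) :
    ∃ p ∈ segment a b, ts a p = s := by
  have h1 : 0 < tauSym a b := by
    rw [(ha.ts_eq hb).2.1]; exact ENNReal.ofReal_pos.2 hab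
  rcases causal_or_of_tauSym_pos h1 with h | h
  · exact (ha.reach_of_causal hb h).exists_mem_segment_aux hs hs'
  · obtain ⟨p, hp, hp'⟩ := (hb.reach_of_causal ha h).exists_mem_segment_aux (s := ts a b - s)
      (by linarith) (by rw [ts_comm b a]; linarith)
    refine ⟨p, segment_comm b a ▸ hp, ?_⟩
    have := (hb.ts_add ha hp).1
    rw [hp', ts_comm p a, ts_comm b a] at this
    linarith

/-! ### Relabelling and side lengths of comparison triangles -/

section

variable {X : Type*} [CausalData X] {K : ℝ} {p q r : X} {p' q' r' : Model K}

theorem IsComparisonTriangle.swap_left (h : IsComparisonTriangle p q r p' q' r') :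
    IsComparisonTriangle q p r q' p' r' where
  timelike_pq := tauSym_comm p' q' ▸ h.timelike_pq
  timelike_pr := h.timelike_qr
  timelike_qr := h.timelike_pr
  lt_pq := tauSym_comm p' q' ▸ h.lt_pq
  lt_pr := h.lt_qr
  lt_qr := h.lt_pr
  tau_pq := h.tau_qp
  tau_qp := h.tau_pq
  tau_pr := h.tau_qr
  tau_rp := h.tau_rq
  tau_qr := h.tau_pr
  tau_rq := h.tau_rp

theorem IsComparisonTriangle.swap_right (h : IsComparisonTriangle p q r p' q' r') :
    IsComparisonTriangle p r q p' r' q' where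
  timelike_pq := h.timelike_pr
  timelike_pr := h.timelike_pq
  timelike_qr := tauSym_comm q' r' ▸ h.timelike_qr
  lt_pq := h.lt_pr
  lt_pr := h.lt_pq
  lt_qr := tauSym_comm q' r' ▸ h.lt_qr
  tau_pq := h.tau_pr
  tau_qp := h.tau_rp
  tau_pr := h.tau_pq
  tau_rp := h.tau_qp
  tau_qr := h.tau_rq
  tau_rq := h.tau_qr

theorem IsComparisonTriangle.tauSym_pq (h : IsComparisonTriangle p q r p' q' r') :
    tauSym p' q' = tauSym p q := by rw [tauSym, tauSym, h.tau_pq, h.tau_qp]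

theorem IsComparisonTriangle.ts_pq (h : IsComparisonTriangle p q r p' q' r') :
    ts p' q' = ts p q := by rw [ts, ts, h.tauSym_pq]

theorem IsComparisonTriangle.ts_pr (h : IsComparisonTriangle p q r p' q' r') :
    ts p' r' = ts p r := h.swap_right.ts_pq

theorem IsComparisonTriangle.ts_qr (h : IsComparisonTriangle p q r p' q' r') :
    ts q' r' = ts q r := h.swap_left.swap_right.ts_pq

theorem IsComparisonTriangle.inRange (h : IsComparisonTriangle p q r p' q' r') :
    InRange K (ts p q) := by
  rw [← h.ts_pq]; exact (inRange_of_lt_modelDiam h.lt_pq).1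

theorem IsComparisonTriangle.ts_pos (h : IsComparisonTriangle p q r p' q' r') :
    0 < ts p q := by
  rw [← h.ts_pq]; exact ENNReal.toReal_pos h.timelike_pq.ne' h.lt_pq.ne_top

/-- The vertices of a comparison triangle lie in a causal diamond. -/
theorem IsComparisonTriangle.exists_diamond (h : IsComparisonTriangle p q r p' q' r') :
    ∃ o m : Model K, Model.Diamond o m p' ∧ Model.Diamond o m q' ∧ Model.Diamond o m r' := by
  have rf := fun p : Model K => Model.causal_refl p
  rcases reach_or_of_tauSym h.timelike_pq h.lt_pq with h1 | h1 <;>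
    rcases reach_or_of_tauSym h.timelike_pr h.lt_pr with h2 | h2 <;>
    rcases reach_or_of_tauSym h.timelike_qr h.lt_qr with h3 | h3
  · exact ⟨p', r', ⟨h2, rf _, h2.1⟩, ⟨h2, h1.1, h3.1⟩, h2, h2.1, rf _⟩
  · exact ⟨p', q', ⟨h1, rf _, h1.1⟩, ⟨h1, h1.1, rf _⟩, h1, h2.1, h3.1⟩
  · have := Model.causal_antisymm (Model.causal_trans h1.1 h3.1) h2.1
    subst this
    exact ⟨p', q', ⟨h1, rf _, h1.1⟩, ⟨h1, h1.1, rf _⟩, h1, rf _, h1.1⟩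
  · exact ⟨r', q', ⟨h3, h2.1, h1.1⟩, ⟨h3, h3.1, rf _⟩, h3, rf _, h3.1⟩
  · exact ⟨q', r', ⟨h3, h1.1, h2.1⟩, ⟨h3, rf _, h3.1⟩, h3, h3.1, rf _⟩
  · have := Model.causal_antisymm (Model.causal_trans h2.1 h3.1) h1.1
    subst this
    exact ⟨p', r', ⟨h2, rf _, h2.1⟩, ⟨h2, rf _, h2.1⟩, h2, h2.1, rf _⟩
  · exact ⟨q', p', ⟨h1, h1.1, rf _⟩, ⟨h1, rf _, h1.1⟩, h1, h3.1, h2.1⟩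
  · exact ⟨r', p', ⟨h2, h2.1, rf _⟩, ⟨h2, h3.1, h1.1⟩, h2, rf _, h2.1⟩

theorem IsComparisonTriangle.energy_pq (h : IsComparisonTriangle p q r p' q' r') :
    Model.energy p' q' = md K (ts p q) := by
  obtain ⟨o, m, h1, h2, -⟩ := h.exists_diamond
  rw [← h.ts_pq]
  exact h1.energy_eq h2 (h.ts_pq ▸ h.ts_pos)

theorem IsComparisonTriangle.hinge_eq (h : IsComparisonTriangle p q r p' q' r') :
    Model.hinge p' q' r' = hingeNum K (ts p q) (ts p r) (ts q r) := by
  rw [Model.hinge, hingeNum, h.energy_pq, h.swap_right.energy_pq, h.swap_left.swap_right.energy_pq]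

/-- The angle of a comparison triangle in terms of the side lengths. -/
theorem IsComparisonTriangle.angle_eq (h : IsComparisonTriangle p q r p' q' r') :
    Model.angle p' q' r' = Real.arcosh
      |hingeNum K (ts p q) (ts p r) (ts q r) / (sn K (ts p q) * sn K (ts p r))| := by
  rw [Model.angle_eq h.inRange h.swap_right.inRange h.energy_pq h.swap_right.energy_pq, h.hinge_eq]

theorem comparisonAngle_eq (h : HasComparisonTriangle K p q r) :
    comparisonAngle K p q r = Real.arcosh
      |hingeNum K (ts p q) (ts p r) (ts q r) / (sn K (ts p q) * sn K (ts p r))| := by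
  rw [comparisonAngle, dif_pos h]
  exact h.choose_spec.angle_eq

end

/-! ### Existence of comparison triangles -/

namespace Model

variable {K : ℝ}

/-- Both points are taken on the axis x = 0, which is a timelike geodesic. -/
theorem exists_reach_ts_eq {r : ℝ} (hr : InRange K r) :
    ∃ p q : Model K, Reach p q ∧ ts p q = r := by
  let p : Model K := ⟨(0, 0), fun _ => by simp [Real.pi_pos], fun _ => by simp [Real.pi_pos]⟩
  have key : ∀ (t : ℝ) (ht : 0 ≤ t) (h1 : 0 < K → t < Real.pi / 2) (h2 : K < 0 → t < Real.pi),
      ∃ q : Model K, q.t = t ∧ q.x = 0 ∧ Reach p q := by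
    intro t ht h1 h2
    refine ⟨⟨(t, 0), fun h => ?_, fun _ => by simp [Real.pi_pos]⟩, rfl, rfl, ?_, fun h => ?_⟩
    · rw [abs_of_nonneg ht]; exact h1 h
    · change |(0 : ℝ) - 0| ≤ t - 0; simpa using ht
    · change t - 0 + |(0 : ℝ) + 0| < Real.pi; simpa using h2 h
  suffices ∃ q : Model K, Reach p q ∧ energy p q = md K r by
    obtain ⟨q, h1, h2⟩ := this
    refine ⟨p, q, h1, ?_⟩
    rw [← md_inj h1.ts_eq.1 hr, h1.ts_eq.2.2, h2]
  have hpt : p.t = 0 := rfl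
  have hpx : p.x = 0 := rfl
  rcases lt_trichotomy K 0 with hK | hK | hK
  · have hs : 0 < √(-K) := Real.sqrt_pos.2 (neg_pos.2 hK)
    obtain ⟨q, h1, h2, h3⟩ := key (√(-K) * r) (mul_nonneg hs.le hr.1)
      (fun h => absurd h hK.not_gt) hr.2
    refine ⟨q, h3, ?_⟩
    rw [energy_of_neg hK, h1, h2, hpt, hpx, md, if_neg hK.not_gt, if_pos hK]
    simp
  · obtain ⟨q, h1, h2, h3⟩ := key r hr.1 (by simp [hK]) (by simp [hK])
    refine ⟨q, h3, ?_⟩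
    subst hK
    simp [energy, h1, h2, hpt, hpx, md]
  · have hs : 0 < √K := Real.sqrt_pos.2 hK
    -- The Gudermannian function converts proper time into conformal time of de Sitter space.
    obtain ⟨q, h1, h2, h3⟩ := key (Real.arctan (Real.sinh (√K * r)))
      (Real.arctan_nonneg.2 (Real.sinh_nonneg_iff.2 (mul_nonneg hs.le hr.1)))
      (fun _ => Real.arctan_lt_pi_div_two _) (fun h => absurd h hK.not_gt)
    refine ⟨q, h3, ?_⟩
    have h4 := Real.cosh_pos (√K * r)
    have h5 : Real.cos (Real.arctan (Real.sinh (√K * r))) = 1 / Real.cosh (√K * r) := by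
      rw [Real.cos_arctan, add_comm, ← Real.cosh_sq, Real.sqrt_sq h4.le]
    rw [energy_of_pos hK, h1, h2, hpt, hpx, md, if_pos hK]
    simp only [sub_zero, Real.cos_zero, one_mul, h5]
    field_simp

/-- The triangle with given side lengths. -/
theorem exists_triangle {x y z : ℝ} (hx : 0 < x) (hy : 0 < y) (hxy : x + y ≤ z)
    (hz : InRange K z) :
    ∃ p q r : Model K, Reach p r ∧ causal p q ∧ causal q r ∧ ts p q = x ∧ ts q r = y ∧
      ts p r = z := by
  obtain ⟨p, r, hpr, hts⟩ := exists_reach_ts_eq hz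
  have hxr := hz.mono hx.le (by linarith)
  have hyr := hz.mono hy.le (by linarith)
  obtain ⟨h, h0, h1, h2, h2'⟩ := exists_half hz
  obtain ⟨g, g0, g1, g2, g2'⟩ := exists_half hxr
  have hz0 : 0 < z := by linarith
  have hh : 0 < h := h0.lt_of_ne fun e => by
    have := sn_pos hz hz0
    rw [h2', ← e] at this; simp at this
  have hg : 0 < g := g0.lt_of_ne fun e => by
    have := sn_pos hxr hx
    rw [g2', ← e] at this; simp at this
  have hgh : g ≤ h := by
    have := (md_le_md hxr hz).2 (by linarith)
    rw [h2, g2, div_le_div_iff₀ g1 h1] at this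
    nlinarith
  have hU := chartU_nonneg hpr
  have hV := chartV_nonneg hpr
  have hone := one_sub_chart_pos hpr
  have hen := hpr.energy_chart_self
  rw [← hpr.ts_eq.2.2, hts, h2, mul_assoc K] at hen
  rw [mul_assoc K] at hone
  have hUV : chartU p r * chartV p r = h ^ 2 := by
    rw [div_eq_div_iff h1.ne' hone.ne'] at hen
    linear_combination -(1 / 2) * hen
  have hex := fun {T S : ℝ} => exists_chart_eq (T := T) (S := S) hpr
  have hench := fun {q : Model K} (hq : Reach p q) => energy_chart hq hpr
  have hU0 : 0 < chartU p r := hU.lt_of_ne fun e => by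
    rw [← e, zero_mul] at hUV; exact (pow_pos hh 2).ne hUV
  have hV0 : 0 < chartV p r := hV.lt_of_ne fun e => by
    rw [← e, mul_zero] at hUV; exact (pow_pos hh 2).ne hUV
  rw [mul_assoc K, hUV] at hench
  generalize chartU p r = U at *
  generalize chartV p r = V at *
  have hmd : md K y ≤ 2 * (h - g) ^ 2 / ((1 - K * h ^ 2) * (1 - K * g ^ 2)) := by
    have h3 : md K (z - x) = 2 * (h - g) ^ 2 / ((1 - K * h ^ 2) * (1 - K * g ^ 2)) := by
      rw [md_sub, h2, h2', g2, g2']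
      obtain ⟨d1, hd1⟩ : ∃ d, d = 1 - K * h ^ 2 := ⟨_, rfl⟩
      obtain ⟨d2, hd2⟩ : ∃ d, d = 1 - K * g ^ 2 := ⟨_, rfl⟩
      rw [← hd1] at h1
      rw [← hd2] at g1
      rw [← hd1, ← hd2]
      field_simp
      rw [hd1, hd2]
      ring
    rw [← h3]
    exact (md_le_md hyr (hz.mono (by linarith) (by linarith))).2 (by linarith)
  have hρ : g / h * U ≤ U := mul_le_of_le_one_left hU ((div_le_one hh).2 hgh)
  have hρ0 : 0 < g / h * U := by positivity
  -- The third vertex q runs along the hyperbola of points (a, g²/a) at distance x from p, and F is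
  -- the energy between q and r. At a = U the two are null related. At a = (g/h) U the vertex lies
  -- on [p, r], at distance z - x ≥ y from r.
  set F : ℝ → ℝ := fun a => 2 * (U - a) * (V - g ^ 2 / a) / ((1 - K * g ^ 2) * (1 - K * h ^ 2))
  have hF : ContinuousOn F (Icc (g / h * U) U) := by
    have : ∀ a ∈ Icc (g / h * U) U, a ≠ 0 := fun a ha => (hρ0.trans_le ha.1).ne'
    fun_prop (disch := assumption)
  obtain ⟨a, ha, hFa⟩ : md K y ∈ F '' Icc (g / h * U) U := by
    refine intermediate_value_Icc' hρ hF ⟨?_, ?_⟩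
    · simp [F, md_nonneg]
    · refine hmd.trans_eq ?_
      have : 2 * (U - g / h * U) * (V - g ^ 2 / (g / h * U)) = 2 * (h - g) ^ 2 := by
        have e : g ^ 2 / (g / h * U) = g / h * V := by
          field_simp; linear_combination -hUV
        rw [e]
        have : 2 * (U - g / h * U) * (V - g / h * V) = 2 * (1 - g / h) ^ 2 * (U * V) := by ring
        rw [this, hUV]; field_simp
      simp only [F]
      rw [this, mul_comm (1 - K * g ^ 2)]
  have ha0 : 0 < a := hρ0.trans_le ha.1
  have hb : g ^ 2 / a ≤ V := by
    rw [div_le_iff₀ ha0]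
    have h3 : V * (g / h * U) ≤ V * a := mul_le_mul_of_nonneg_left ha.1 hV
    have h4 : V * (g / h * U) = g * h := by
      rw [show V * (g / h * U) = g / h * (U * V) by ring, hUV]; field_simp
    nlinarith
  obtain ⟨q, hq, hqr, hqU, hqV, -, -⟩ := hex ha0.le ha.2 (by positivity) hb
  have hUVq : chartU p q * chartV p q = g ^ 2 := by rw [hqU, hqV]; field_simp
  refine ⟨p, q, r, hpr, hq.1, hqr, ?_, ?_, hts⟩
  · rw [← md_inj hq.ts_eq.1 hxr, hq.ts_eq.2.2, hq.energy_chart_self, mul_assoc, mul_assoc K, hUVq,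
      g2]
  · have hqr' := hpr.of_between hq.1 hqr (causal_refl r)
    rw [← md_inj hqr'.ts_eq.1 hyr, hqr'.ts_eq.2.2, hench hq, mul_assoc K, hUVq, hqU, hqV, ← hFa]

end Model

/-! ### Timelike geodesics in Lorentzian pre-length spaces -/

open LorentzianPreLengthSpace

section

variable {X : Type*} [MetricSpace X] [LorentzianPreLengthSpace X] {x y z w : X}

/-- Push-up follows from the reverse triangle inequality, since ≪ is positivity of τ. -/
theorem chron_of_chron_of_causal (h : chron x y) (h' : causal y z) : chron x z := by
  rw [← tau_pos_iff] at h ⊢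
  exact h.trans_le (le_self_add.trans (tau_add_le x y z
    (causal_of_chron _ _ (tau_pos_iff _ _ |>.1 h)) h'))

theorem chron_of_causal_of_chron (h : causal x y) (h' : chron y z) : chron x z := by
  have h'' := h'
  rw [← tau_pos_iff] at h' ⊢
  exact h'.trans_le (le_add_self.trans (tau_add_le x y z h (causal_of_chron _ _ h'')))

/-- Finiteness of τ(x, y) forces τ(x, x) = 0 by the reverse triangle inequality for x, x, y. A
causal return from y would make τ(x, x) positive. -/
theorem not_causal_of_chron (h : chron x y) (hf : tau x y ≠ ⊤) : ¬ causal y x := by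
  intro h'
  have hc := causal_of_chron _ _ h
  have h1 := tau_add_le x x y (causal_refl x) hc
  have h2 := tau_add_le x y x hc h'
  have h3 := (tau_pos_iff x y).2 h
  have h4 : tau x x = 0 := by
    by_contra h5
    rw [add_comm] at h1
    exact h1.not_gt (ENNReal.lt_add_right hf h5)
  rw [h4] at h2
  exact absurd (h3.trans_le (le_self_add.trans h2)) (lt_irrefl _)

theorem tau_eq_zero_of_chron (h : chron x y) (hf : tau x y ≠ ⊤) : tau y x = 0 :=
  tau_eq_zero _ _ (not_causal_of_chron h hf)

theorem tauSym_eq_of_chron (h : chron x y) (hf : tau x y ≠ ⊤) : tauSym x y = tau x y := by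
  simp [tauSym, tau_eq_zero_of_chron h hf]

theorem chron_or_of_tauSym_pos (h : 0 < tauSym x y) : chron x y ∨ chron y x := by
  rcases lt_max_iff.1 h with h | h
  · exact Or.inl ((tau_pos_iff _ _).1 h)
  · exact Or.inr ((tau_pos_iff _ _).1 h)

/-- The sums over partitions telescope if τ is additive along γ. Conversely, a partition with three
points bounds the infimum and gives the nontrivial half of additivity. -/
theorem isFutureGeodesic_iff {γ : Path x y} :
    IsFutureGeodesic γ ↔ (∀ s t : I, s ≤ t → causal (γ s) (γ t)) ∧
      (∀ s, tau (γ s) (γ s) = 0) ∧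
      ∀ s t u : I, s ≤ t → t ≤ u → tau (γ s) (γ u) = tau (γ s) (γ t) + tau (γ t) (γ u) := by
  constructor
  · rintro ⟨hc, hl⟩
    have h0 : ∀ s, tau (γ s) (γ s) = 0 := by
      intro s
      rw [hl s s le_rfl, ← nonpos_iff_eq_zero]
      -- The partition consisting of a single point has an empty sum, so constant pieces have length
      -- zero.
      refine iInf_le_of_le 0 (iInf_le_of_le (fun _ => s) (iInf_le_of_le ?_
        (iInf_le_of_le rfl (iInf_le_of_le rfl (by simp)))))
      intro a b hab
      exact absurd (Fin.ext (by omega)) hab.ne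
    refine ⟨hc, h0, fun s t u hst htu => ?_⟩
    rcases hst.eq_or_lt with rfl | hst
    · rw [h0, zero_add]
    rcases htu.eq_or_lt with rfl | htu
    · rw [h0, add_zero]
    refine le_antisymm ?_ (tau_add_le _ _ _ (hc _ _ hst.le) (hc _ _ htu.le))
    rw [hl s u (hst.trans htu).le]
    refine iInf_le_of_le 2 (iInf_le_of_le ![s, t, u] (iInf_le_of_le ?_
      (iInf_le_of_le rfl (iInf_le_of_le rfl ?_))))
    · rw [Fin.strictMono_iff_lt_succ]
      intro i
      fin_cases i
      · exact hst
      · exact htu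
    · simp [Fin.sum_univ_two]
  · rintro ⟨hc, h0, ha⟩
    refine ⟨hc, fun s t hst => le_antisymm ?_ ?_⟩
    · refine le_iInf fun n => le_iInf fun u => le_iInf fun hu => le_iInf fun hs => le_iInf fun ht =>
        le_of_eq ?_
      have key : ∀ (n : ℕ) (u : Fin (n + 1) → I), Monotone u →
          tau (γ (u 0)) (γ (u (Fin.last n))) =
            ∑ i : Fin n, tau (γ (u i.castSucc)) (γ (u i.succ)) := by
        intro n
        induction n with
        | zero => intro u _; simpa using h0 _
        | succ n ih =>
          intro u hu
          rw [Fin.sum_univ_castSucc, ha (u 0) (u (Fin.last n).castSucc) (u (Fin.last (n + 1)))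
            (hu (Fin.zero_le _)) (hu (Fin.le_last _))]
          have := ih (fun i => u i.castSucc) (hu.comp Fin.strictMono_castSucc.monotone)
          simp only [Fin.castSucc_zero] at this
          rw [this]
          rfl
      rw [← key n u hu.monotone, hs, ht]
    · rcases hst.eq_or_lt with rfl | hst
      · refine iInf_le_of_le 0 (iInf_le_of_le (fun _ => s) (iInf_le_of_le ?_
          (iInf_le_of_le rfl (iInf_le_of_le rfl (by simp)))))
        intro a b hab
        exact absurd (Fin.ext (by omega)) hab.ne
      · refine iInf_le_of_le 1 (iInf_le_of_le ![s, t] (iInf_le_of_le ?_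
          (iInf_le_of_le rfl (iInf_le_of_le rfl ?_))))
        · rw [Fin.strictMono_iff_lt_succ]
          intro i
          fin_cases i
          exact hst
        · simp

theorem IsFutureTimelikeGeodesic.subpath {γ : Path x y} (h : IsFutureTimelikeGeodesic γ)
    {s t : I} (hst : s < t) : IsFutureTimelikeGeodesic (γ.subpath s t) := by
  have hm : StrictMono (Icc.convexComb s t) := by
    intro a b hab
    have h1 : (a : ℝ) < b := hab
    have h2 : (s : ℝ) < t := hst
    change (Icc.convexComb s t a : ℝ) < Icc.convexComb s t b
    simp only [Icc.coe_convexComb]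
    nlinarith
  obtain ⟨h1, h2⟩ := h
  rw [isFutureGeodesic_iff] at h1
  refine ⟨isFutureGeodesic_iff.2 ⟨fun a b hab => h1.1 _ _ (hm.monotone hab), fun a => h1.2.1 _,
    fun a b c hab hbc => h1.2.2 _ _ _ (hm.monotone hab) (hm.monotone hbc)⟩,
    fun a b hab => h2 _ _ (hm hab)⟩

/-- `S` is the image of a timelike geodesic from `x` to `y`. -/
def IsSide (S : Set X) (x y : X) : Prop := ∃ γ : Path x y, IsTimelikeGeodesic γ ∧ range γ = S

theorem IsTimelikeGeodesic.symm {γ : Path x y} (h : IsTimelikeGeodesic γ) :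
    IsTimelikeGeodesic γ.symm := by
  rcases h with h | h
  · exact Or.inr (by rwa [Path.symm_symm])
  · exact Or.inl h

theorem IsSide.symm {S : Set X} (h : IsSide S x y) : IsSide S y x := by
  obtain ⟨γ, h, hS⟩ := h
  exact ⟨γ.symm, h.symm, by rw [Path.symm_range, hS]⟩

/-- The metric properties of timelike geodesics that do not depend on the time orientation. -/
theorem IsTimelikeGeodesic.ts_props {γ : Path x y} (h : IsTimelikeGeodesic γ)
    (hf : tauSym x y ≠ ⊤) :
    (∀ s t u : I, s ≤ t → t ≤ u → ts (γ s) (γ u) = ts (γ s) (γ t) + ts (γ t) (γ u)) ∧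
    (∀ s t : I, s < t → 0 < ts (γ s) (γ t)) ∧ (∀ s t, tauSym (γ s) (γ t) ≤ tauSym x y) ∧
    ∀ s, ts (γ s) (γ s) = 0 := by
  have key : ∀ {x y : X} {γ : Path x y}, IsFutureTimelikeGeodesic γ → tauSym x y ≠ ⊤ →
      (∀ s t u : I, s ≤ t → t ≤ u → ts (γ s) (γ u) = ts (γ s) (γ t) + ts (γ t) (γ u)) ∧
      (∀ s t : I, s < t → 0 < ts (γ s) (γ t)) ∧ (∀ s t, tauSym (γ s) (γ t) ≤ tauSym x y) ∧
      ∀ s, ts (γ s) (γ s) = 0 := by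
    intro x y γ ⟨h1, h2⟩ hf
    rw [isFutureGeodesic_iff] at h1
    obtain ⟨hc, h0, ha⟩ := h1
    have hle : ∀ s t : I, s ≤ t → tau (γ s) (γ t) ≤ tauSym x y := by
      intro s t hst
      have e1 := ha 0 s 1 s.2.1 s.2.2
      have e2 := ha s t 1 hst t.2.2
      rw [γ.source, γ.target] at e1
      rw [γ.target] at e2
      calc tau (γ s) (γ t) ≤ tau (γ s) y := e2 ▸ le_self_add
        _ ≤ tau x y := e1 ▸ le_add_self
        _ ≤ _ := le_max_left _ _
    have hne : ∀ s t : I, s ≤ t → tau (γ s) (γ t) ≠ ⊤ := fun s t hst =>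
      ne_top_of_le_ne_top hf (hle s t hst)
    have hsym : ∀ s t : I, s ≤ t → tauSym (γ s) (γ t) = tau (γ s) (γ t) := by
      intro s t hst
      rcases hst.eq_or_lt with rfl | hst'
      · simp [tauSym]
      · exact tauSym_eq_of_chron (h2 _ _ hst') (hne _ _ hst)
    refine ⟨fun s t u hst htu => ?_, fun s t hst => ?_, fun s t => ?_, fun s => ?_⟩
    · rw [ts, ts, ts, hsym _ _ hst, hsym _ _ htu, hsym _ _ (hst.trans htu), ha s t u hst htu,
        ENNReal.toReal_add (hne _ _ hst) (hne _ _ htu)]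
    · rw [ts, hsym _ _ hst.le]
      exact ENNReal.toReal_pos ((tau_pos_iff _ _).2 (h2 _ _ hst)).ne' (hne _ _ hst.le)
    · rcases le_total s t with hst | hst
      · rw [hsym _ _ hst]; exact hle _ _ hst
      · rw [tauSym_comm, hsym _ _ hst]; exact hle _ _ hst
    · simp [ts, tauSym, h0]
  rcases h with h | h
  · exact key h hf
  · obtain ⟨h1, h2, h3, h4⟩ := key h (tauSym_comm x y ▸ hf)
    have e : ∀ s, γ s = γ.symm (unitInterval.symm s) := fun s => by simp [Path.symm_apply]
    refine ⟨fun s t u hst htu => ?_, fun s t hst => ?_, fun s t => ?_, fun s => ?_⟩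
    · rw [e s, e t, e u, ts_comm, add_comm, h1 (unitInterval.symm u) (unitInterval.symm t)
        (unitInterval.symm s) (by simpa using htu) (by simpa using hst), ts_comm (γ.symm (unitInterval.symm s)) (γ.symm (unitInterval.symm t)),
        ts_comm (γ.symm (unitInterval.symm t)) (γ.symm (unitInterval.symm u))]
    · rw [e s, e t, ts_comm]
      exact h2 _ _ (by simpa using hst)
    · rw [e s, e t, tauSym_comm x]
      exact h3 _ _
    · rw [e s]; exact h4 _

theorem lowerSemicontinuous_tauSym (x : X) : LowerSemicontinuous fun z : X => tauSym x z :=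
  (tau_lowerSemicontinuous.comp (g := fun z : X => (x, z)) (by fun_prop)).sup
    (tau_lowerSemicontinuous.comp (g := fun z : X => (z, x)) (by fun_prop))

theorem lowerSemicontinuous_ts {α : Type*} [TopologicalSpace α] {g : α → X} (hg : Continuous g)
    (x : X) (hf : ∀ s, tauSym x (g s) ≠ ⊤) : LowerSemicontinuous fun s => ts x (g s) := by
  intro s c hc
  rcases lt_or_ge c 0 with h | h
  · exact Eventually.of_forall fun t => h.trans_le ENNReal.toReal_nonneg
  · have h1 := (lowerSemicontinuous_tauSym x).comp hg s (ENNReal.ofReal c)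
      ((ENNReal.ofReal_lt_iff_lt_toReal h (hf s)).2 hc)
    filter_upwards [h1] with t ht
    exact (ENNReal.ofReal_lt_iff_lt_toReal h (hf t)).1 ht

/-- A path with additive finite separation has a continuous length function. -/
theorem continuous_ts_path {γ : Path x y} (hf : ∀ s t, tauSym (γ s) (γ t) ≠ ⊤)
    (ha : ∀ s, ts x y = ts x (γ s) + ts (γ s) y) : Continuous fun s => ts x (γ s) := by
  rw [continuous_iff_lower_upperSemicontinuous]
  refine ⟨lowerSemicontinuous_ts γ.continuous x fun s => ?_, ?_⟩
  · simpa using hf 0 s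
  -- By additivity the distance from x is a constant minus the distance to y, so lower
  -- semicontinuity of the latter is upper semicontinuity of the former.
  · have h1 := lowerSemicontinuous_ts γ.continuous y fun s => by simpa using hf 1 s
    intro s c hc
    have h2 := h1 s (ts x y - c) (by
      have := ha s
      have hc' : ts x (γ s) < c := hc
      change ts x y - c < ts y (γ s)
      rw [ts_comm y]; linarith)
    filter_upwards [h2] with t ht
    have := ha t
    rw [ts_comm y] at ht
    linarith

/-- The distance from x is a continuous, strictly increasing coordinate on the side. Every metric
fact about sides below is read off from it. -/
theorem IsSide.exists_param {S : Set X} (h : IsSide S x y) (hf : tauSym x y ≠ ⊤) :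
    ∃ γ : Path x y, IsTimelikeGeodesic γ ∧ range γ = S ∧ StrictMono (fun s => ts x (γ s)) ∧
      Continuous (fun s => ts x (γ s)) ∧
      (∀ s t : I, s ≤ t → ts (γ s) (γ t) = ts x (γ t) - ts x (γ s)) ∧
      (∀ s t, tauSym (γ s) (γ t) ≤ tauSym x y) ∧ ts x (γ 0) = 0 := by
  obtain ⟨γ, hγ, hS⟩ := h
  obtain ⟨h1, h2, h3, h4⟩ := hγ.ts_props hf
  have h5 : ∀ s t : I, s ≤ t → ts (γ s) (γ t) = ts x (γ t) - ts x (γ s) := by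
    intro s t hst
    have := h1 0 s t s.2.1 hst
    rw [γ.source] at this
    linarith
  refine ⟨γ, hγ, hS, fun s t hst => ?_, ?_, h5, h3, ?_⟩
  · have := h2 s t hst
    rw [h5 s t hst.le] at this
    simpa using this
  · refine continuous_ts_path (fun s t => ne_top_of_le_ne_top hf (h3 s t)) fun s => ?_
    have := h1 0 s 1 s.2.1 s.2.2
    rwa [γ.source, γ.target] at this
  · have := h4 0
    rwa [γ.source] at this ⊢

/-! ### Distances and points on a single side -/

section Side

variable {S : Set X}

theorem IsSide.left_mem (h : IsSide S x y) : x ∈ S := by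
  obtain ⟨γ, -, rfl⟩ := h
  exact ⟨0, γ.source⟩

theorem IsSide.right_mem (h : IsSide S x y) : y ∈ S := h.symm.left_mem

theorem IsSide.ts_self (h : IsSide S x y) (hf : tauSym x y ≠ ⊤) : ts x x = 0 := by
  obtain ⟨γ, -, -, -, -, -, -, h0⟩ := h.exists_param hf
  rwa [γ.source] at h0

theorem IsSide.ts_eq_sub (h : IsSide S x y) (hf : tauSym x y ≠ ⊤) (hz : z ∈ S) (hw : w ∈ S)
    (hzw : ts x z ≤ ts x w) : ts z w = ts x w - ts x z := by
  obtain ⟨γ, -, rfl, hm, -, ha, -, -⟩ := h.exists_param hf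
  obtain ⟨s, rfl⟩ := hz
  obtain ⟨t, rfl⟩ := hw
  exact ha s t (hm.le_iff_le.1 hzw)

theorem IsSide.tauSym_le (h : IsSide S x y) (hf : tauSym x y ≠ ⊤) (hz : z ∈ S) (hw : w ∈ S) :
    tauSym z w ≤ tauSym x y := by
  obtain ⟨γ, -, rfl, -, -, -, hle, -⟩ := h.exists_param hf
  obtain ⟨s, rfl⟩ := hz
  obtain ⟨t, rfl⟩ := hw
  exact hle s t

theorem IsSide.ts_le (h : IsSide S x y) (hf : tauSym x y ≠ ⊤) (hz : z ∈ S) :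
    ts x z ≤ ts x y :=
  ENNReal.toReal_mono hf (h.tauSym_le hf h.left_mem hz)

theorem IsSide.ts_add (h : IsSide S x y) (hf : tauSym x y ≠ ⊤) (hz : z ∈ S) :
    ts x z + ts z y = ts x y := by
  rw [h.ts_eq_sub hf hz h.right_mem (h.ts_le hf hz)]; ring

theorem IsSide.exists_ts_eq (h : IsSide S x y) (hf : tauSym x y ≠ ⊤) {r : ℝ} (hr : 0 ≤ r)
    (hr' : r ≤ ts x y) : ∃ z ∈ S, ts x z = r := by
  obtain ⟨γ, -, rfl, -, hc, -, -, h0⟩ := h.exists_param hf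
  obtain ⟨s, hs⟩ := intermediate_value_univ (0 : I) 1 hc
    (show r ∈ Icc _ _ by simp only [h0, γ.target]; exact ⟨hr, hr'⟩)
  exact ⟨γ s, mem_range_self s, hs⟩

theorem IsSide.eq_of_ts_eq (h : IsSide S x y) (hf : tauSym x y ≠ ⊤) (hz : z ∈ S) (hw : w ∈ S)
    (hzw : ts x z = ts x w) : z = w := by
  obtain ⟨γ, -, rfl, hm, -, -, -, -⟩ := h.exists_param hf
  obtain ⟨s, rfl⟩ := hz
  obtain ⟨t, rfl⟩ := hw
  rw [hm.injective hzw]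

theorem IsSide.ts_pos (h : IsSide S x y) (hf : tauSym x y ≠ ⊤) (hz : z ∈ S) (hzx : z ≠ x) :
    0 < ts x z := by
  refine ENNReal.toReal_nonneg.lt_of_ne fun h0 => hzx ?_
  exact h.eq_of_ts_eq hf hz h.left_mem (by rw [h.ts_self hf]; exact h0.symm)

/-- Geodesics approach their endpoint. -/
theorem IsSide.eventually_mem (h : IsSide S x y) (hf : tauSym x y ≠ ⊤) {V : Set X}
    (hV : V ∈ 𝓝 x) : ∃ ε > 0, ∀ z ∈ S, ts x z < ε → z ∈ V := by
  obtain ⟨γ, -, rfl, hm, -, -, -, h0⟩ := h.exists_param hf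
  have h1 : ∀ᶠ s in 𝓝 (0 : I), γ s ∈ V :=
    γ.continuous.continuousAt.eventually (by rwa [γ.source])
  have h2 : ∃ s : I, 0 < s ∧ ∀ t < s, γ t ∈ V := by
    rcases (nhds_bot_basis (α := I)).mem_iff.1 (show {s | γ s ∈ V} ∈ 𝓝 ⊥ from h1)
      with ⟨s, hs, hsub⟩
    exact ⟨s, hs, fun t ht => hsub ht⟩
  obtain ⟨s, hs, hst⟩ := h2
  refine ⟨ts x (γ s), ?_, ?_⟩
  · rw [← h0]; exact hm hs
  · rintro _ ⟨t, rfl⟩ ht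
    exact hst t (hm.lt_iff_lt.1 ht)

/-- Segments of timelike geodesics. -/
theorem IsSide.exists_subside (h : IsSide S x y) (hf : tauSym x y ≠ ⊤) (hz : z ∈ S)
    (hw : w ∈ S) (hzw : ts x z < ts x w) :
    ∃ S' ⊆ S, IsSide S' z w ∧ ∀ v ∈ S, ts x z ≤ ts x v → ts x v ≤ ts x w → v ∈ S' := by
  obtain ⟨γ, hγ, rfl, hm, -, -, -, -⟩ := h.exists_param hf
  obtain ⟨s, rfl⟩ := hz
  obtain ⟨t, rfl⟩ := hw
  have hst : s < t := hm.lt_iff_lt.1 hzw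
  refine ⟨range (γ.subpath s t), ?_, ⟨γ.subpath s t, ?_, rfl⟩, ?_⟩
  · rintro _ ⟨a, rfl⟩
    exact mem_range_self _
  · rcases hγ with hγ | hγ
    · exact Or.inl (hγ.subpath hst)
    · refine Or.inr ?_
      have h1 := hγ.subpath (s := unitInterval.symm t) (t := unitInterval.symm s) (by simpa using hst)
      have h2 : ∀ a, (γ.subpath s t).symm a =
          (γ.symm.subpath (unitInterval.symm t) (unitInterval.symm s)) a := by
        intro a
        rw [Path.symm_subpath]
        simp only [Path.subpath, Path.coe_mk_mk, Function.comp_apply, Path.symm_apply]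
        congr 1
        ext
        simp only [Icc.coe_convexComb, unitInterval.coe_symm_eq]
        ring
      obtain ⟨h3, h4⟩ := h1
      rw [isFutureGeodesic_iff] at h3
      simp only [← h2] at h3 h4
      exact ⟨isFutureGeodesic_iff.2 h3, h4⟩
  · rintro _ ⟨a, rfl⟩ h1 h2
    rw [Path.range_subpath]
    refine mem_image_of_mem _ ?_
    rw [uIcc_of_le hst.le]
    exact ⟨hm.le_iff_le.1 h1, hm.le_iff_le.1 h2⟩

end Side

/-- Geodesics between timelike related points can be parametrised as timelike geodesics. -/
theorem exists_timelike_of_regular (hreg : Regular X) (hxy : chron x y) (hf : tau x y ≠ ⊤)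
    {γ : Path x y} (hγ : IsFutureGeodesic γ) :
    ∃ γ' : Path x y, IsFutureTimelikeGeodesic γ' ∧ range γ' ⊆ range γ := by
  have hreg' := hreg x y γ hxy hγ
  obtain ⟨hc, h0, ha⟩ := isFutureGeodesic_iff.1 hγ
  have hne : ∀ s t : I, s ≤ t → tau (γ s) (γ t) ≠ ⊤ := by
    intro s t hst
    have e1 := ha 0 s 1 s.2.1 s.2.2
    have e2 := ha s t 1 hst t.2.2
    rw [γ.source, γ.target] at e1
    rw [γ.target] at e2
    refine ne_top_of_le_ne_top hf ?_
    calc tau (γ s) (γ t) ≤ tau (γ s) y := e2 ▸ le_self_add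
      _ ≤ tau x y := e1 ▸ le_add_self
  have hsym : ∀ s t : I, s ≤ t → tauSym (γ s) (γ t) = tau (γ s) (γ t) := by
    intro s t hst
    by_cases h : γ s = γ t
    · simp [tauSym, h]
    · have hst' : s < t := hst.lt_of_ne fun e => h (by rw [e])
      exact tauSym_eq_of_chron (hreg' s t hst' h) (hne _ _ hst)
  have hadd : ∀ s t u : I, s ≤ t → t ≤ u → ts (γ s) (γ u) = ts (γ s) (γ t) + ts (γ t) (γ u) := by
    intro s t u hst htu
    rw [ts, ts, ts, hsym _ _ hst, hsym _ _ htu, hsym _ _ (hst.trans htu), ha s t u hst htu,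
      ENNReal.toReal_add (hne _ _ hst) (hne _ _ htu)]
  have hcont : Continuous fun s => ts x (γ s) := by
    refine continuous_ts_path (fun s t => ?_) fun s => ?_
    · rcases le_total s t with h | h
      · rw [hsym _ _ h]; exact hne _ _ h
      · rw [tauSym_comm, hsym _ _ h]; exact hne _ _ h
    · have := hadd 0 s 1 s.2.1 s.2.2
      rwa [γ.source, γ.target] at this
  have hL : 0 < ts x y := by
    have := hsym 0 1 zero_le_one
    rw [γ.source, γ.target] at this
    rw [ts, this]
    exact ENNReal.toReal_pos ((tau_pos_iff _ _).2 hxy).ne' hf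
  have hsub : ∀ s t : I, s ≤ t → ts x (γ t) = ts x (γ s) + ts (γ s) (γ t) := by
    intro s t hst
    have := hadd 0 s t s.2.1 hst
    rwa [γ.source] at this
  have hmono : Monotone fun s => ts x (γ s) := fun s t hst => by
    change ts x (γ s) ≤ ts x (γ t)
    rw [hsub s t hst]
    exact le_add_of_nonneg_right ENNReal.toReal_nonneg
  have hx0 : ts x (γ 0) = 0 := by
    have := h0 0
    rw [γ.source] at this ⊢
    simp [ts, tauSym, this]
  have heq : ∀ s t : I, ts x (γ s) = ts x (γ t) → γ s = γ t := by
    have : ∀ s t : I, s ≤ t → ts x (γ s) = ts x (γ t) → γ s = γ t := by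
      intro s t hst h
      by_contra hne'
      have hst' : s < t := hst.lt_of_ne fun e => hne' (by rw [e])
      have h1 := hreg' s t hst' hne'
      have h2 := hsub s t hst
      have h3 : 0 < ts (γ s) (γ t) := by
        rw [ts, hsym _ _ hst]
        exact ENNReal.toReal_pos ((tau_pos_iff _ _).2 h1).ne' (hne _ _ hst)
      linarith
    intro s t h
    rcases le_total s t with hst | hst
    · exact this s t hst h
    · exact (this t s hst h.symm).symm
  have hmem : ∀ s : I, ts x (γ s) / ts x y ∈ I := fun s => by
    have h1 := hmono (show s ≤ 1 from s.2.2)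
    simp only [γ.target] at h1
    exact ⟨div_nonneg ENNReal.toReal_nonneg hL.le, (div_le_one hL).2 h1⟩
  -- Normalised distance from x identifies exactly the parameters at which γ takes the same value,
  -- by regularity.
  let φ : I → I := fun s => ⟨ts x (γ s) / ts x y, hmem s⟩
  have hφc : Continuous φ := (hcont.div_const _).subtype_mk _
  have hφ0 : φ 0 = 0 := Subtype.ext (by
    change ts x (γ 0) / ts x y = 0
    rw [hx0, zero_div])
  have hφ1 : φ 1 = 1 := Subtype.ext (by simp [φ, hL.ne'])
  have hφs : Function.Surjective φ := by
    intro a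
    obtain ⟨s, hs⟩ := intermediate_value_univ (0 : I) 1 hφc
      (show a ∈ Icc (φ 0) (φ 1) by rw [hφ0, hφ1]; exact ⟨a.2.1, a.2.2⟩)
    exact ⟨s, hs⟩
  -- A continuous surjection of compact Hausdorff spaces is a quotient map. So γ ∘ g is continuous
  -- for an arbitrary section g of φ, although g itself may jump.
  have hφq : IsQuotientMap φ := (hφc.isClosedMap).isQuotientMap hφc hφs
  choose g hg using hφs
  have hφγ : ∀ s t, φ s = φ t → γ s = γ t := fun s t h => by
    refine heq s t ?_
    have := congrArg Subtype.val h
    simp only [φ] at this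
    rwa [div_left_inj' hL.ne'] at this
  have hγg : Continuous (γ ∘ g) := by
    rw [hφq.continuous_iff]
    convert γ.continuous using 1
    ext s
    exact hφγ _ _ (hg _)
  have hgm : StrictMono g := by
    intro a b hab
    by_contra! h
    have h1 : φ (g b) ≤ φ (g a) := by
      change ts x (γ (g b)) / ts x y ≤ ts x (γ (g a)) / ts x y
      have := hmono h
      simp only at this
      gcongr
    rw [hg, hg] at h1
    exact absurd h1 hab.not_ge
  refine ⟨⟨⟨γ ∘ g, hγg⟩, ?_, ?_⟩, ⟨isFutureGeodesic_iff.2 ⟨fun a b hab => hc _ _ (hgm.monotone hab),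
    fun a => h0 _, fun a b c hab hbc => ha _ _ _ (hgm.monotone hab) (hgm.monotone hbc)⟩,
    fun a b hab => hreg' _ _ (hgm hab) fun h => ?_⟩, ?_⟩
  · have : γ (g 0) = γ 0 := hφγ _ _ ((hg 0).trans hφ0.symm)
    simpa using this
  · have : γ (g 1) = γ 1 := hφγ _ _ ((hg 1).trans hφ1.symm)
    simpa using this
  · have h1 : φ (g a) = φ (g b) := Subtype.ext (by
      change ts x (γ (g a)) / ts x y = ts x (γ (g b)) / ts x y
      rw [show γ (g a) = γ (g b) from h])
    rw [hg, hg] at h1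
    exact hab.ne h1
  · rintro _ ⟨a, rfl⟩
    exact mem_range_self _

end

/-! ### Hinge comparison -/

/-- The coefficient of a hinge: plus or minus the hyperbolic cosine of the comparison angle. -/
def coef {X : Type*} [CausalData X] (K : ℝ) (a p q : X) : ℝ :=
  hingeNum K (ts a p) (ts a q) (ts p q) / (sn K (ts a p) * sn K (ts a q))

theorem coef_comm {X : Type*} [CausalData X] (K : ℝ) (a p q : X) : coef K a p q = coef K a q p := by
  rw [coef, coef, hingeNum_comm, ts_comm p q, mul_comm (sn K (ts a p))]

/-- Timelike related points at distance less than the diameter. -/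
def Near {X : Type*} [CausalData X] (K : ℝ) (x y : X) : Prop :=
  0 < tauSym x y ∧ tauSym x y < modelDiam K

section

variable {X : Type*} [MetricSpace X] [LorentzianPreLengthSpace X] {K : ℝ} {U : Set X}
  {x y z w a b c p q : X}

theorem Near.symm (h : Near K x y) : Near K y x := by rwa [Near, tauSym_comm]

theorem Near.ne_top (h : Near K x y) : tauSym x y ≠ ⊤ := h.2.ne_top

theorem Near.inRange (h : Near K x y) : InRange K (ts x y) := (inRange_of_lt_modelDiam h.2).1

theorem Near.ts_pos (h : Near K x y) : 0 < ts x y := ENNReal.toReal_pos h.1.ne' h.ne_top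

theorem Near.chron_or (h : Near K x y) : chron x y ∨ chron y x := chron_or_of_tauSym_pos h.1

theorem Near.sn_pos (h : Near K x y) : 0 < sn K (ts x y) := Lorentz.sn_pos h.inRange h.ts_pos

theorem tauSym_pos_iff (h : tauSym x y ≠ ⊤) : 0 < tauSym x y ↔ 0 < ts x y :=
  ⟨fun h' => ENNReal.toReal_pos h'.ne' h, fun h' => (ENNReal.toReal_pos_iff.1 h').1⟩

theorem tau_le_of_between (h1 : causal x z) (h2 : causal w y) :
    tau z w ≤ tau x y := by
  by_cases h : causal z w
  · calc tau z w ≤ tau x w := le_add_self.trans (tau_add_le _ _ _ h1 h)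
      _ ≤ tau x y := le_self_add.trans (tau_add_le _ _ _ (causal_trans _ _ _ h1 h) h2)
  · rw [tau_eq_zero _ _ h]; exact zero_le

theorem ts_add_le (h1 : chron x y) (h2 : chron y z) (hf : tauSym x z ≠ ⊤) :
    ts x y + ts y z ≤ ts x z := by
  have h3 := tau_add_le x y z (causal_of_chron _ _ h1) (causal_of_chron _ _ h2)
  have h4 : tau x z ≠ ⊤ := ne_top_of_le_ne_top hf (le_max_left _ _)
  have h5 : tau x y ≠ ⊤ := ne_top_of_le_ne_top h4 (le_self_add.trans h3)
  have h6 : tau y z ≠ ⊤ := ne_top_of_le_ne_top h4 (le_add_self.trans h3)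
  rw [ts, ts, ts, tauSym_eq_of_chron h1 h5, tauSym_eq_of_chron h2 h6,
    tauSym_eq_of_chron (chron_trans _ _ _ h1 h2) h4, ← ENNReal.toReal_add h5 h6]
  exact ENNReal.toReal_mono h4 h3

theorem IsSide.causal_of_mem {S : Set X} (h : IsSide S x y) (hxy : chron x y)
    (hf : tauSym x y ≠ ⊤) (hz : z ∈ S) : causal x z ∧ causal z y := by
  obtain ⟨γ, hγ | hγ, rfl⟩ := h
  · obtain ⟨s, rfl⟩ := hz
    have h1 := hγ.1.1 0 s s.2.1
    have h2 := hγ.1.1 s 1 s.2.2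
    rw [γ.source] at h1
    rw [γ.target] at h2
    exact ⟨h1, h2⟩
  · have h1 := hγ.1.1 0 1 zero_le_one
    rw [γ.symm.source, γ.symm.target] at h1
    exact absurd h1 (not_causal_of_chron hxy (ne_top_of_le_ne_top hf (le_max_left _ _)))

theorem exists_side (hreg : Regular X) (hU : IsUpperComparisonNhd K U) (hx : x ∈ U) (hy : y ∈ U)
    (h : Near K x y) : ∃ S ⊆ U, IsSide S x y := by
  have key : ∀ {x y}, x ∈ U → y ∈ U → Near K x y → chron x y → ∃ S ⊆ U, IsSide S x y := by
    intro x y hx hy h hc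
    have hlt := (le_max_left _ _).trans_lt h.2
    obtain ⟨γ, hγ, hsub⟩ := hU.exists_geodesic x hx y hy hc hlt
    obtain ⟨γ', h1, h2⟩ := exists_timelike_of_regular hreg hc hlt.ne_top hγ
    exact ⟨range γ', h2.trans hsub, γ', Or.inl h1, rfl⟩
  rcases h.chron_or with h' | h'
  · exact key hx hy h h'
  · obtain ⟨S, hS, hS'⟩ := key hy hx h.symm h'
    exact ⟨S, hS, hS'.symm⟩

/-- A triangle of timelike geodesics, given by their images, in a comparison neighbourhood. -/
structure SideTriangle (K : ℝ) (U : Set X) (a b c : X) (S₁ S₂ S₃ : Set X) : Prop where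
  ab : IsSide S₁ a b
  ac : IsSide S₂ a c
  bc : IsSide S₃ b c
  sub_ab : S₁ ⊆ U
  sub_ac : S₂ ⊆ U
  sub_bc : S₃ ⊆ U
  near_ab : Near K a b
  near_ac : Near K a c
  near_bc : Near K b c

/-! ### Triangles given by their sides, and monotonicity of the hinge coefficient -/

section SideTriangle

variable {S₁ S₂ S₃ : Set X}

theorem SideTriangle.swap_right (T : SideTriangle K U a b c S₁ S₂ S₃) :
    SideTriangle K U a c b S₂ S₁ S₃ :=
  ⟨T.ac, T.ab, T.bc.symm, T.sub_ac, T.sub_ab, T.sub_bc, T.near_ac, T.near_ab, T.near_bc.symm⟩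

theorem SideTriangle.swap_left (T : SideTriangle K U a b c S₁ S₂ S₃) :
    SideTriangle K U b a c S₁ S₃ S₂ :=
  ⟨T.ab.symm, T.bc, T.ac, T.sub_ab, T.sub_bc, T.sub_ac, T.near_ab.symm, T.near_bc, T.near_ac⟩

/-- Whatever the time directions at a, both orders of p and q fit causally between two vertices, so
their separations are bounded by those of the sides. -/
theorem SideTriangle.tauSym_lt (T : SideTriangle K U a b c S₁ S₂ S₃) (hp : p ∈ S₁)
    (hq : q ∈ S₂) : tauSym p q < modelDiam K := by
  have hl := fun x y : X => le_max_left (tau x y) (tau y x)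
  have hr := fun x y : X => le_max_right (tau x y) (tau y x)
  have hb := T.near_ab.2
  have hc := T.near_ac.2
  have hbc := T.near_bc.2
  have cc := fun {x y : X} => causal_of_chron x y
  rcases T.near_ab.chron_or with h1 | h1 <;> rcases T.near_ac.chron_or with h2 | h2
  · obtain ⟨h3, h4⟩ := T.ab.causal_of_mem h1 T.near_ab.ne_top hp
    obtain ⟨h5, h6⟩ := T.ac.causal_of_mem h2 T.near_ac.ne_top hq
    exact max_lt (((tau_le_of_between h3 h6).trans (hl _ _)).trans_lt hc)
      (((tau_le_of_between h5 h4).trans (hl _ _)).trans_lt hb)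
  · obtain ⟨h3, h4⟩ := T.ab.causal_of_mem h1 T.near_ab.ne_top hp
    obtain ⟨h5, h6⟩ := T.ac.symm.causal_of_mem h2 T.near_ac.symm.ne_top hq
    exact max_lt (((tau_le_of_between h3 (causal_trans _ _ _ h6 (cc h1))).trans
      (hl _ _)).trans_lt hb) (((tau_le_of_between h5 h4).trans
      (hr _ _)).trans_lt hbc)
  · obtain ⟨h3, h4⟩ := T.ab.symm.causal_of_mem h1 T.near_ab.symm.ne_top hp
    obtain ⟨h5, h6⟩ := T.ac.causal_of_mem h2 T.near_ac.ne_top hq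
    exact max_lt (((tau_le_of_between h3 h6).trans
      (hl _ _)).trans_lt hbc) (((tau_le_of_between (causal_trans _ _ _ (cc h1) h5) h4).trans
      (hr _ _)).trans_lt hb)
  · obtain ⟨h3, h4⟩ := T.ab.symm.causal_of_mem h1 T.near_ab.symm.ne_top hp
    obtain ⟨h5, h6⟩ := T.ac.symm.causal_of_mem h2 T.near_ac.symm.ne_top hq
    exact max_lt (((tau_le_of_between h3 h6).trans (hr _ _)).trans_lt hb)
      (((tau_le_of_between h5 h4).trans (hr _ _)).trans_lt hc)

theorem SideTriangle.near_of_pos (T : SideTriangle K U a b c S₁ S₂ S₃) (hp : p ∈ S₁)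
    (hq : q ∈ S₂) (h : 0 < tauSym p q) : Near K p q := ⟨h, T.tauSym_lt hp hq⟩

theorem SideTriangle.near_left (T : SideTriangle K U a b c S₁ S₂ S₃) (hp : p ∈ S₁)
    (hpa : p ≠ a) : Near K a p := by
  have h1 := (T.ab.tauSym_le T.near_ab.ne_top T.ab.left_mem hp).trans_lt T.near_ab.2
  exact ⟨(tauSym_pos_iff h1.ne_top).2 (T.ab.ts_pos T.near_ab.ne_top hp hpa), h1⟩

theorem exists_isComparisonTriangle_of_chron (h1 : chron x y) (h2 : chron y z)
    (h3 : tau x z < modelDiam K) :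
    ∃ x' y' z' : Model K, IsComparisonTriangle x y z x' y' z' := by
  have h4 := chron_trans _ _ _ h1 h2
  have h5 := tau_add_le x y z (causal_of_chron _ _ h1) (causal_of_chron _ _ h2)
  have h6 := (le_self_add.trans h5).trans_lt h3
  have h7 := (le_add_self.trans h5).trans_lt h3
  have e := fun {x y : X} (h : chron x y) (h' : tau x y < modelDiam K) =>
    tauSym_eq_of_chron h h'.ne_top
  have n1 : Near K x y := ⟨by rw [e h1 h6]; exact (tau_pos_iff _ _).2 h1, by rwa [e h1 h6]⟩
  have n2 : Near K y z := ⟨by rw [e h2 h7]; exact (tau_pos_iff _ _).2 h2, by rwa [e h2 h7]⟩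
  have n3 : Near K x z := ⟨by rw [e h4 h3]; exact (tau_pos_iff _ _).2 h4, by rwa [e h4 h3]⟩
  obtain ⟨x', y', z', hr, hxy, hyz, t1, t2, t3⟩ :=
    Model.exists_triangle n1.ts_pos n2.ts_pos (ts_add_le h1 h2 n3.ne_top) n3.inRange
  have r1 := hr.of_between (Model.causal_refl x') hxy hyz
  have r2 := hr.of_between hxy hyz (Model.causal_refl z')
  have key : ∀ {x y : X} {x' y' : Model K}, chron x y → tau x y < modelDiam K →
      Model.Reach x' y' → ts x' y' = ts x y → tau x' y' = tau x y ∧ tau y' x' = tau y x := by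
    intro x y x' y' hc hlt hR ht
    refine ⟨?_, ?_⟩
    · rw [hR.ts_eq.2.1, ht, ts, e hc hlt, ENNReal.ofReal_toReal hlt.ne_top]
    · rw [Model.tau_eq_zero_of_causal hR.1, tau_eq_zero_of_chron hc hlt.ne_top]
  obtain ⟨k1, k1'⟩ := key h1 h6 r1 t1
  obtain ⟨k2, k2'⟩ := key h2 h7 r2 t2
  obtain ⟨k3, k3'⟩ := key h4 h3 hr t3
  have s1 : tauSym x' y' = tauSym x y := by rw [tauSym, tauSym, k1, k1']
  have s2 : tauSym y' z' = tauSym y z := by rw [tauSym, tauSym, k2, k2']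
  have s3 : tauSym x' z' = tauSym x z := by rw [tauSym, tauSym, k3, k3']
  exact ⟨x', y', z', s1 ▸ n1.1, s3 ▸ n3.1, s2 ▸ n2.1, s1 ▸ n1.2, s3 ▸ n3.2, s2 ▸ n2.2,
    k1, k1', k3, k3', k2, k2'⟩

theorem exists_isComparisonTriangle (h1 : Near K x y) (h2 : Near K x z) (h3 : Near K y z) :
    ∃ x' y' z' : Model K, IsComparisonTriangle x y z x' y' z' := by
  have hl := fun {x y : X} (h : Near K x y) => (le_max_left (tau x y) (tau y x)).trans_lt h.2
  have cyc : ∀ {x y z : X}, Near K x z → chron x y → chron y z → chron z x → False := by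
    intro x y z h h1 h2 h3
    exact not_causal_of_chron (chron_trans _ _ _ h1 h2) (hl h).ne_top (causal_of_chron _ _ h3)
  rcases h1.chron_or with c1 | c1 <;> rcases h2.chron_or with c2 | c2 <;>
    rcases h3.chron_or with c3 | c3
  · exact exists_isComparisonTriangle_of_chron c1 c3 (hl h2)
  · obtain ⟨_, _, _, h⟩ := exists_isComparisonTriangle_of_chron c2 c3 (hl h1)
    exact ⟨_, _, _, h.swap_right⟩
  · exact (cyc h2 c1 c3 c2).elim
  · obtain ⟨_, _, _, h⟩ := exists_isComparisonTriangle_of_chron c2 c1 (hl h3.symm)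
    exact ⟨_, _, _, h.swap_left.swap_right⟩
  · obtain ⟨_, _, _, h⟩ := exists_isComparisonTriangle_of_chron c1 c2 (hl h3)
    exact ⟨_, _, _, h.swap_left⟩
  · exact (cyc h1 c2 c3 c1).elim
  · obtain ⟨_, _, _, h⟩ := exists_isComparisonTriangle_of_chron c3 c2 (hl h1.symm)
    exact ⟨_, _, _, h.swap_right.swap_left⟩
  · obtain ⟨_, _, _, h⟩ := exists_isComparisonTriangle_of_chron c3 c1 (hl h2.symm)
    exact ⟨_, _, _, h.swap_left.swap_right.swap_left⟩

/-- The comparison condition for points on two sides. -/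
theorem SideTriangle.tau_le (T : SideTriangle K U a b c S₁ S₂ S₃)
    (hU : IsUpperComparisonNhd K U) {a' b' c' p' q' : Model K}
    (hT : IsComparisonTriangle a b c a' b' c') (hp : p ∈ S₁) (hq : q ∈ S₂)
    (hp' : p' ∈ Model.segment a' b') (hpp : tauSym a' p' = tauSym a p)
    (hq' : q' ∈ Model.segment a' c') (hqq : tauSym a' q' = tauSym a q) :
    tau p' q' ≤ tau p q ∧ tau q' p' ≤ tau q p := by
  obtain ⟨γ₁, g1, rfl⟩ := T.ab
  obtain ⟨γ₂, g2, rfl⟩ := T.ac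
  obtain ⟨γ₃, g3, rfl⟩ := T.bc
  have := hU.comparison ⟨a, b, c, γ₁, γ₂, γ₃, g1, g2, g3⟩ ⟨T.sub_ab, T.sub_ac, T.sub_bc⟩
    a' b' c' hT
  exact ⟨this p q p' q' (Or.inl ⟨hp, hp', hpp⟩) (Or.inr (Or.inl ⟨hq, hq', hqq⟩)),
    this q p q' p' (Or.inr (Or.inl ⟨hq, hq', hqq⟩)) (Or.inl ⟨hp, hp', hpp⟩)⟩

/-- The hinge term scales with `sn` along each side, so applying `Diamond.hinge_of_mem_segment` to
both sides leaves the coefficient of the whole triangle. The truncated energy then also covers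
comparison points that are not causally related. -/
theorem energy_comparison_point {a' b' c' p' q' : Model K}
    (hT : IsComparisonTriangle a b c a' b' c') (hp' : p' ∈ Model.segment a' b')
    (hq' : q' ∈ Model.segment a' c') :
    (md K (ts a' p') + md K (ts a' q') + K * md K (ts a' p') * md K (ts a' q') -
      Model.energy p' q') = sn K (ts a' p') * sn K (ts a' q') * coef K a b c ∧
    InRange K (ts p' q') ∧ tauSym p' q' = ENNReal.ofReal (ts p' q') ∧
      md K (ts p' q') = max (Model.energy p' q') 0 ∧
      InRange K (ts a' p') ∧ tauSym a' p' = ENNReal.ofReal (ts a' p') := by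
  obtain ⟨o, m, ha, hb, hc⟩ := hT.exists_diamond
  have hp := ha.of_mem_segment hb hp'
  have hq := ha.of_mem_segment hc hq'
  have e1 := ha.hinge_of_mem_segment hb hq hp' (hT.ts_pq ▸ hT.ts_pos)
  have e2 := ha.hinge_of_mem_segment hc hb hq' (hT.ts_pr ▸ hT.swap_right.ts_pos)
  rw [Model.hinge_comm a' q', Model.hinge_comm a' c', hT.hinge_eq] at e2
  rw [hT.ts_pq] at e1
  rw [hT.ts_pr] at e2
  have h1 := sn_pos hT.inRange hT.ts_pos
  have h2 := sn_pos hT.swap_right.inRange hT.swap_right.ts_pos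
  refine ⟨?_, (hp.ts_eq hq).1, (hp.ts_eq hq).2.1, (hp.ts_eq hq).2.2, (ha.ts_eq hp).1,
    (ha.ts_eq hp).2.1⟩
  have e3 := (ha.ts_add hb hp').2.1
  have e4 := (ha.ts_add hc hq').2.1
  rw [Model.hinge, e3, e4] at e1
  rw [coef]
  field_simp
  linear_combination sn K (ts a c) * e1 + sn K (ts a' p') * e2

theorem SideTriangle.exists_comparison_point (T : SideTriangle K U a b c S₁ S₂ S₃)
    {a' b' c' : Model K} (hT : IsComparisonTriangle a b c a' b' c') (hp : p ∈ S₁) :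
    ∃ p' ∈ Model.segment a' b', tauSym a' p' = tauSym a p ∧ ts a' p' = ts a p := by
  obtain ⟨o, m, ha, hb, hc⟩ := hT.exists_diamond
  obtain ⟨p', hp', h⟩ := ha.exists_mem_segment hb (hT.ts_pq ▸ hT.ts_pos) (s := ts a p)
    ENNReal.toReal_nonneg (hT.ts_pq ▸ T.ab.ts_le T.near_ab.ne_top hp)
  refine ⟨p', hp', ?_, h⟩
  rw [(ha.ts_eq (ha.of_mem_segment hb hp')).2.1, h, ts, ENNReal.ofReal_toReal]
  exact ne_top_of_le_ne_top T.near_ab.ne_top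
    (T.ab.tauSym_le T.near_ab.ne_top T.ab.left_mem hp)

/-- Hinge comparison: the coefficient of a hinge increases along its sides. -/
theorem SideTriangle.coef_le (T : SideTriangle K U a b c S₁ S₂ S₃)
    (hU : IsUpperComparisonNhd K U) (hp : p ∈ S₁) (hq : q ∈ S₂) (hpa : p ≠ a) (hqa : q ≠ a) :
    coef K a p q ≤ coef K a b c := by
  obtain ⟨a', b', c', hT⟩ := exists_isComparisonTriangle T.near_ab T.near_ac T.near_bc
  obtain ⟨p', hp', h1, h2⟩ := T.exists_comparison_point hT hp
  obtain ⟨q', hq', h3, h4⟩ := T.swap_right.exists_comparison_point hT.swap_right hq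
  obtain ⟨e1, e2, e3, e4, -⟩ := energy_comparison_point hT hp' hq'
  obtain ⟨l1, l2⟩ := T.tau_le hU hT hp hq hp' h1 hq' h3
  have hlt := T.tauSym_lt hp hq
  have hr : InRange K (ts p q) := (inRange_of_lt_modelDiam hlt).1
  -- The opposite side enters the hinge term with a minus sign, so a larger separation in X means a
  -- smaller coefficient.
  have hle : ts p' q' ≤ ts p q := ENNReal.toReal_mono hlt.ne_top (max_le_max l1 l2)
  have h5 := (md_le_md e2 hr).2 hle
  rw [e4] at h5
  have h6 := (le_max_left _ _).trans h5
  rw [h2, h4] at e1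
  have h7 := (T.near_left hp hpa).sn_pos
  have h8 := (T.swap_right.near_left hq hqa).sn_pos
  rw [coef, div_le_iff₀ (by positivity), mul_comm (coef K a b c), ← e1, hingeNum]
  linarith

end SideTriangle

end

/-! ### Rigidity of the hinge comparison -/

/-- Stewart's identity: the two ways to compute the length of a cevian. -/
theorem hingeNum_switch (K L M N t r : ℝ) :
    hingeNum K L t r * sn K M - hingeNum K L M N * sn K t =
      hingeNum K N (M - t) r * sn K M - hingeNum K N M L * sn K (M - t) := by
  simp only [hingeNum, md_sub, sn_sub]
  have h1 := sn_sq K M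
  have h2 := sn_sq K t
  linear_combination (sn K t + K * md K N * sn K t) * h1

/-- A side of length X seen after moving its endpoint by t under the coefficient H has length X - tH
to first order. The sign of H' - H thus decides which of the two expressions is larger for small t.
-/
theorem hasDerivAt_hinge (K X H H' : ℝ) :
    HasDerivAt (fun t => md K X + md K t + K * md K X * md K t - sn K X * sn K t * H -
      md K (X - t * H')) (sn K X * (H' - H)) 0 := by
  have h1 := hasDerivAt_md K 0
  have h2 := hasDerivAt_sn K 0
  have h3 : HasDerivAt (fun t => X - t * H') (-H') 0 := by
    simpa using ((hasDerivAt_id (0 : ℝ)).mul_const H').const_sub X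
  have h4 : HasDerivAt (fun t => md K (X - t * H')) (sn K X * -H') 0 := by
    simpa [Function.comp_def] using (hasDerivAt_md K (X - 0 * H')).comp (0 : ℝ) h3
  have h5 := ((((h1.const_add (md K X)).add (h1.const_mul (K * md K X))).sub
    ((h2.const_mul (sn K X)).mul_const H)).sub h4)
  refine h5.congr_deriv ?_
  simp
  ring

theorem eventually_hinge_lt {K X H H' : ℝ} (hX : InRange K X) (h0 : 0 < X) (h : H' < H) :
    ∀ᶠ t in 𝓝[>] (0 : ℝ),
      md K X + md K t + K * md K X * md K t - sn K X * sn K t * H < md K (X - t * H') := by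
  have h1 := (hasDerivAt_hinge K X H H').tendsto_slope_zero_right
  have h2 : sn K X * (H' - H) < 0 := mul_neg_of_pos_of_neg (sn_pos hX h0) (sub_neg.2 h)
  filter_upwards [h1.eventually_lt_const h2, self_mem_nhdsWithin] with t ht ht0
  have ht0 : 0 < t := ht0
  simp only [zero_add, sub_zero, md_zero, sn_zero, mul_zero, zero_mul, add_zero, sub_self,
    smul_eq_mul] at ht
  have := neg_of_mul_neg_right ht (inv_nonneg.2 ht0.le)
  linarith

theorem eventually_lt_hinge {K X H H' : ℝ} (hX : InRange K X) (h0 : 0 < X) (h : H < H') :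
    ∀ᶠ t in 𝓝[>] (0 : ℝ),
      md K (X - t * H') < md K X + md K t + K * md K X * md K t - sn K X * sn K t * H := by
  have h1 := (hasDerivAt_hinge K X H H').tendsto_slope_zero_right
  have h2 : 0 < sn K X * (H' - H) := mul_pos (sn_pos hX h0) (sub_pos.2 h)
  filter_upwards [h1.eventually_const_lt h2, self_mem_nhdsWithin] with t ht ht0
  have ht0 : 0 < t := ht0
  simp only [zero_add, sub_zero, md_zero, sn_zero, mul_zero, zero_mul, add_zero, sub_self,
    smul_eq_mul] at ht
  have := pos_of_mul_pos_right ht (inv_nonneg.2 ht0.le)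
  linarith

/-- First variation: moving the common endpoint of two collinear segments by a small amount `t`
changes their lengths by at most the angle terms. -/
theorem eventually_not_first_variation {K L s H H' : ℝ} (hL : InRange K L) (hs : 0 < s)
    (hsL : s < L) (h : H' < H) :
    ∀ᶠ t in 𝓝[>] (0 : ℝ), ∀ D d : ℝ, InRange K D → 0 ≤ d → d + (L - s) ≤ D →
      md K D = md K L + md K t + K * md K L * md K t - sn K L * sn K t * H →
      md K s + md K t + K * md K s * md K t - sn K s * sn K t * H' ≤ md K d → False := by
  -- A slope strictly between H' and H gives d ≥ s - tG and D < L - tG, which contradicts d + (L -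
  -- s) ≤ D.
  obtain ⟨G, hG1, hG2⟩ := exists_between h
  have hc : Tendsto (fun t : ℝ => s - t * G) (𝓝[>] 0) (𝓝 s) := by
    have : Continuous fun t : ℝ => s - t * G := by fun_prop
    simpa using (this.tendsto 0).mono_left nhdsWithin_le_nhds
  filter_upwards [eventually_hinge_lt hL (hs.trans hsL) hG2,
    eventually_lt_hinge (hL.mono hs.le hsL.le) hs hG1, hc.eventually_const_lt hs,
    hc.eventually_lt_const hsL] with t h1 h2 h3 h4 D d hD hd hdD e1 e2
  have hdr : InRange K d := hD.mono hd (by linarith)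
  have h5 : s - t * G ≤ d :=
    ((md_lt_md (hL.mono h3.le h4.le) hdr).1 (h2.trans_le e2)).le
  have h6 : L - t * G ≤ D := by linarith
  have h7 := (md_le_md (hD.mono (by linarith) h6) hD).2 h6
  linarith

/-! ### Rigid hinges and rigid cevians -/

section

variable {X : Type*} [MetricSpace X] [LorentzianPreLengthSpace X] {K : ℝ} {U : Set X}
  {x y z w a b c p q : X} {S₁ S₂ S₃ : Set X}

theorem SideTriangle.near_left' (T : SideTriangle K U a b c S₁ S₂ S₃) (hp : p ∈ S₂)
    (hpa : p ≠ a) : Near K a p := T.swap_right.near_left hp hpa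

theorem IsSide.exists_initial {S : Set X} (h : IsSide S a b) (hf : tauSym a b ≠ ⊤) (hp : p ∈ S)
    (hpa : p ≠ a) :
    ∃ S' ⊆ S, IsSide S' a p ∧ ∀ v ∈ S, ts a v ≤ ts a p → v ∈ S' := by
  obtain ⟨S', h1, h2, h3⟩ := h.exists_subside hf h.left_mem hp
    (by rw [h.ts_self hf]; exact h.ts_pos hf hp hpa)
  exact ⟨S', h1, h2, fun v hv hle => h3 v hv (by rw [h.ts_self hf]; exact ENNReal.toReal_nonneg) hle⟩

theorem SideTriangle.exists_sub (T : SideTriangle K U a b c S₁ S₂ S₃) (hreg : Regular X)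
    (hU : IsUpperComparisonNhd K U) (hp : p ∈ S₁) (hq : q ∈ S₂) (hpa : p ≠ a) (hqa : q ≠ a)
    (h : 0 < tauSym p q) :
    ∃ S₁' S₂' S₃', SideTriangle K U a p q S₁' S₂' S₃' ∧ S₁' ⊆ S₁ ∧ S₂' ⊆ S₂ ∧
      (∀ v ∈ S₁, ts a v ≤ ts a p → v ∈ S₁') ∧ (∀ v ∈ S₂, ts a v ≤ ts a q → v ∈ S₂') := by
  obtain ⟨S₁', h1, h2, h3⟩ := T.ab.exists_initial T.near_ab.ne_top hp hpa
  obtain ⟨S₂', k1, k2, k3⟩ := T.ac.exists_initial T.near_ac.ne_top hq hqa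
  have hn := T.near_of_pos hp hq h
  obtain ⟨S₃', l1, l2⟩ := exists_side hreg hU (T.sub_ab hp) (T.sub_ac hq) hn
  exact ⟨S₁', S₂', S₃', ⟨h2, k2, l2, h1.trans T.sub_ab, k1.trans T.sub_ac, l1, T.near_left hp hpa,
    T.near_left' hq hqa, hn⟩, h1, k1, h3, k3⟩

/-- The distances from `b` to the points of the side `S₂` are those of the comparison triangle. -/
def RayRigid (K : ℝ) (a b c : X) (S₂ : Set X) : Prop :=
  ∀ x ∈ S₂, x ≠ a → 0 < tauSym b x → coef K a b x = coef K a b c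

/-- The distances between points of the sides at `a` are those of the comparison triangle. -/
def HingeRigid (K : ℝ) (a b c : X) (S₁ S₂ : Set X) : Prop :=
  ∀ p ∈ S₁, ∀ q ∈ S₂, p ≠ a → q ≠ a → 0 < tauSym p q → coef K a p q = coef K a b c

theorem HingeRigid.swap (h : HingeRigid K a b c S₁ S₂) : HingeRigid K a c b S₂ S₁ :=
  fun p hp q hq hpa hqa hpq => by
    rw [coef_comm, h q hq p hp hqa hpa (by rwa [tauSym_comm]), coef_comm]

theorem SideTriangle.ne_ab (T : SideTriangle K U a b c S₁ S₂ S₃) : b ≠ a := by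
  rintro rfl
  have := T.near_ab.ts_pos
  rw [T.ab.ts_self T.near_ab.ne_top] at this
  exact this.false

theorem SideTriangle.rayRigid_of_hingeRigid (T : SideTriangle K U a b c S₁ S₂ S₃)
    (h : HingeRigid K a b c S₁ S₂) : RayRigid K a b c S₂ := fun x hx hxa hbx =>
  h b T.ab.right_mem x hx T.ne_ab hxa hbx

/-- Stewart's identity: the defects of the cevian [b, x] measured at a and at c agree up to positive
factors, so they vanish together. -/
theorem SideTriangle.coef_switch (T : SideTriangle K U a b c S₁ S₂ S₃) (hx : x ∈ S₂)
    (hxa : x ≠ a) (hxc : x ≠ c) : coef K a b x = coef K a b c ↔ coef K c b x = coef K c b a := by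
  have h1 := T.near_ab.sn_pos
  have h2 := T.near_ac.sn_pos
  have h3 := T.near_bc.sn_pos
  have h4 := (T.near_left' hx hxa).sn_pos
  have h5 := (T.swap_right.swap_left.near_left hx hxc).sn_pos
  have h6 := T.ac.ts_add T.near_ac.ne_top hx
  have h7 : ts c x = ts a c - ts a x := by rw [ts_comm c]; linarith
  have key := hingeNum_switch K (ts a b) (ts a c) (ts b c) (ts a x) (ts b x)
  rw [← h7] at key
  simp only [coef, ts_comm c b, ts_comm c a, ts_comm b a]
  rw [div_eq_div_iff (by positivity) (by positivity),
    div_eq_div_iff (by positivity) (by positivity)]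
  constructor
  · intro h
    have h8 : hingeNum K (ts a b) (ts a x) (ts b x) * sn K (ts a c) -
        hingeNum K (ts a b) (ts a c) (ts b c) * sn K (ts a x) = 0 :=
      (mul_eq_zero.1 (by linear_combination h :
        sn K (ts a b) * _ = 0)).resolve_left h1.ne'
    rw [h8] at key
    linear_combination -sn K (ts b c) * key
  · intro h
    have h8 : hingeNum K (ts b c) (ts c x) (ts b x) * sn K (ts a c) -
        hingeNum K (ts b c) (ts a c) (ts a b) * sn K (ts c x) = 0 :=
      (mul_eq_zero.1 (by linear_combination h :
        sn K (ts b c) * _ = 0)).resolve_left h3.ne'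
    rw [h8] at key
    linear_combination sn K (ts a b) * key

/-- Monotonicity in the triangles a, b, y and a, b, c places the coefficient at y between those at x
and at c. -/
theorem SideTriangle.coef_eq_of_le (T : SideTriangle K U a b c S₁ S₂ S₃) (hreg : Regular X)
    (hU : IsUpperComparisonNhd K U) (hx : x ∈ S₂) (hxa : x ≠ a)
    (h : coef K a b x = coef K a b c) (hy : y ∈ S₂) (hya : y ≠ a) (hby : 0 < tauSym b y)
    (hxy : ts a x ≤ ts a y) : coef K a b y = coef K a b c := by
  obtain ⟨R₁, R₂, R₃, T', -, -, -, hR₂⟩ :=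
    T.exists_sub hreg hU T.ab.right_mem hy T.ne_ab hya hby
  have h1 := T'.coef_le hU T'.ab.right_mem (hR₂ x hx hxy) T.ne_ab hxa
  have h2 := T.coef_le hU T.ab.right_mem hy T.ne_ab hya
  exact le_antisymm h2 (h ▸ h1)

theorem SideTriangle.reverse (T : SideTriangle K U a b c S₁ S₂ S₃) :
    SideTriangle K U c b a S₃ S₂ S₁ :=
  T.swap_right.swap_left.swap_right

/-- Points beyond x are handled by monotonicity from a. Points before x are beyond x when seen from
c, and `coef_switch` translates between the two views. -/
theorem SideTriangle.rayRigid_of_coef_eq (T : SideTriangle K U a b c S₁ S₂ S₃) (hreg : Regular X)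
    (hU : IsUpperComparisonNhd K U) (hx : x ∈ S₂) (hxa : x ≠ a) (hxc : x ≠ c)
    (h : coef K a b x = coef K a b c) : RayRigid K a b c S₂ := by
  intro y hy hya hby
  rcases le_total (ts a x) (ts a y) with hxy | hxy
  · exact T.coef_eq_of_le hreg hU hx hxa h hy hya hby hxy
  · by_cases hyc : y = c
    · rw [hyc]
    · have e1 := T.ac.ts_add T.near_ac.ne_top hx
      have e2 := T.ac.ts_add T.near_ac.ne_top hy
      exact (T.coef_switch hy hya hyc).2 (T.reverse.coef_eq_of_le hreg hU
        hx hxc ((T.coef_switch hx hxa hxc).1 h) hy hyc hby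
        (by rw [ts_comm c, ts_comm c]; linarith))

theorem SideTriangle.rayRigid_reverse (T : SideTriangle K U a b c S₁ S₂ S₃)
    (h : RayRigid K a b c S₂) : RayRigid K c b a S₂ := by
  intro x hx hxc hbx
  by_cases hxa : x = a
  · rw [hxa]
  · exact (T.coef_switch hx hxa hxc).1 (h x hx hxa hbx)

theorem isOpen_chron_left (p : X) : IsOpen {z | chron z p} := by
  have := (tau_lowerSemicontinuous.comp (g := fun z : X => (z, p))
    (by fun_prop)).isOpen_preimage 0
  convert this using 1
  ext z
  exact (tau_pos_iff z p).symm

theorem isOpen_chron_right (p : X) : IsOpen {z | chron p z} := by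
  have := (tau_lowerSemicontinuous.comp (g := fun z : X => (p, z))
    (by fun_prop)).isOpen_preimage 0
  convert this using 1
  ext z
  exact (tau_pos_iff p z).symm

theorem tauSym_pos_of_chron (h : chron x y) : 0 < tauSym x y :=
  ((tau_pos_iff _ _).2 h).trans_le (le_max_left _ _)

theorem IsSide.chron_of_ts_lt {S : Set X} (h : IsSide S a b) (hab : chron a b)
    (hf : tauSym a b ≠ ⊤) (hp : p ∈ S) (hq : q ∈ S) (hpq : ts a p < ts a q) : chron p q := by
  obtain ⟨γ, hγ, rfl, hm, -⟩ := h.exists_param hf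
  obtain ⟨s, rfl⟩ := hp
  obtain ⟨t, rfl⟩ := hq
  rcases hγ with hγ | hγ
  · exact hγ.2 _ _ (hm.lt_iff_lt.1 hpq)
  · have h1 := hγ.2 0 1 zero_lt_one
    rw [γ.symm.source, γ.symm.target] at h1
    exact absurd (causal_of_chron _ _ h1)
      (not_causal_of_chron hab (ne_top_of_le_ne_top hf (le_max_left _ _)))

/-- Points near the initial point of a side see each point of the side in the same time
direction as the initial point does. -/
theorem SideTriangle.exists_ts_add_le (T : SideTriangle K U a b c S₁ S₂ S₃) (hp : p ∈ S₁)
    (hpa : p ≠ a) (hpb : p ≠ b) :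
    ∃ ε > 0, ∀ z ∈ S₂, ts a z < ε → 0 < tauSym p z ∧ 0 < tauSym b z ∧
      ts p z + (ts a b - ts a p) ≤ ts b z := by
  have hf := T.near_ab.ne_top
  have h0 := T.ab.ts_pos hf hp hpa
  have h1 := T.ab.ts_add hf hp
  have h2 := T.ab.symm.ts_pos T.near_ab.symm.ne_top hp hpb
  rw [ts_comm b] at h2
  have haa := T.ab.ts_self hf
  have e : ts a b - ts a p = ts p b := by linarith
  rw [e]
  rcases T.near_ab.chron_or with hab | hba
  · have c1 := T.ab.chron_of_ts_lt hab hf T.ab.left_mem hp (by rwa [haa])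
    have c2 := T.ab.chron_of_ts_lt hab hf hp T.ab.right_mem (by linarith)
    obtain ⟨ε, hε, h⟩ := T.ac.eventually_mem T.near_ac.ne_top
      ((isOpen_chron_left p).mem_nhds c1)
    refine ⟨ε, hε, fun z hz hza => ?_⟩
    have c3 : chron z p := h z hz hza
    have c4 := chron_trans _ _ _ c3 c2
    have := ts_add_le c3 c2 (by
      rw [tauSym_comm]; exact (T.tauSym_lt T.ab.right_mem hz).ne_top)
    rw [tauSym_comm p, tauSym_comm b, ts_comm p z, ts_comm b z]
    exact ⟨tauSym_pos_of_chron c3, tauSym_pos_of_chron c4, this⟩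
  · have hba' := T.near_ab.symm.ne_top
    have c1 := T.ab.symm.chron_of_ts_lt hba hba' hp T.ab.left_mem
      (by rw [ts_comm b p, ts_comm b a]; linarith)
    have c2 := T.ab.symm.chron_of_ts_lt hba hba' T.ab.right_mem hp
      (by rw [T.ab.symm.ts_self hba', ts_comm b p]; linarith)
    obtain ⟨ε, hε, h⟩ := T.ac.eventually_mem T.near_ac.ne_top
      ((isOpen_chron_right p).mem_nhds c1)
    refine ⟨ε, hε, fun z hz hza => ?_⟩
    have c3 : chron p z := h z hz hza
    have c4 := chron_trans _ _ _ c2 c3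
    have := ts_add_le c2 c3 (T.tauSym_lt T.ab.right_mem hz).ne_top
    refine ⟨tauSym_pos_of_chron c3, tauSym_pos_of_chron c4, ?_⟩
    rw [ts_comm p b]; linarith

/-- Suppose that the coefficient of p, q is too small. Monotonicity in the triangle a, p, q keeps it
at most this small for p and every z near a on the second side, which bounds the separation of p and
z from below. The separation of b and z is known exactly. Since p lies between a and b, the reverse
triangle inequality through p contradicts first variation as z tends to a. -/
theorem SideTriangle.hingeRigid_of_rayRigid (T : SideTriangle K U a b c S₁ S₂ S₃)
    (hreg : Regular X) (hU : IsUpperComparisonNhd K U) (h : RayRigid K a b c S₂) :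
    HingeRigid K a b c S₁ S₂ := by
  intro p hp q hq hpa hqa hpq
  by_cases hpb : p = b
  · subst hpb; exact h q hq hqa hpq
  by_contra hne
  have hlt := (T.coef_le hU hp hq hpa hqa).lt_of_ne hne
  have hf := T.near_ab.ne_top
  have hs := T.ab.ts_pos hf hp hpa
  have h1 := T.ab.ts_add hf hp
  have h2 := T.ab.symm.ts_pos T.near_ab.symm.ne_top hp hpb
  rw [ts_comm b] at h2
  obtain ⟨ε, hε, hz⟩ := T.exists_ts_add_le hp hpa hpb
  obtain ⟨R₁, R₂, R₃, T', -, -, -, hR₂⟩ := T.exists_sub hreg hU hp hq hpa hqa hpq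
  have hq0 := T.ac.ts_pos T.near_ac.ne_top hq hqa
  have hqc := T.ac.ts_le T.near_ac.ne_top hq
  obtain ⟨t, h3, ht, ht'⟩ := ((eventually_not_first_variation T.near_ab.inRange hs
    (by linarith : ts a p < ts a b) hlt).and
    (Ioo_mem_nhdsGT (lt_min hε hq0))).exists
  obtain ⟨z, hzS, rfl⟩ := T.ac.exists_ts_eq T.near_ac.ne_top ht.le
    ((ht'.trans_le (min_le_right _ _)).le.trans hqc)
  have hza : z ≠ a := by
    rintro rfl
    rw [T.ac.ts_self T.near_ac.ne_top] at ht
    exact ht.false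
  obtain ⟨z1, z2, z3⟩ := hz z hzS (ht'.trans_le (min_le_left _ _))
  have h4 := h z hzS hza z2
  have h5 := T'.coef_le hU T'.ab.right_mem (hR₂ z hzS (ht'.trans_le (min_le_right _ _)).le) hpa hza
  have h6 := (T.near_left hp hpa).sn_pos
  have h7 := (T.near_left' hzS hza).sn_pos
  have h8 := T.near_ab.sn_pos
  refine h3 (ts b z) (ts p z) (T.near_of_pos T.ab.right_mem hzS z2).inRange
    ENNReal.toReal_nonneg z3 ?_ ?_
  · rw [← h4, coef, hingeNum]
    field_simp
    ring
  · rw [coef, div_le_iff₀ (by positivity), hingeNum] at h5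
    linarith

theorem SideTriangle.hingeRigid_iff (T : SideTriangle K U a b c S₁ S₂ S₃)
    (hreg : Regular X) (hU : IsUpperComparisonNhd K U) :
    HingeRigid K a b c S₁ S₂ ↔ RayRigid K a b c S₂ :=
  ⟨T.rayRigid_of_hingeRigid, T.hingeRigid_of_rayRigid hreg hU⟩

theorem SideTriangle.hingeRigid_reverse (T : SideTriangle K U a b c S₁ S₂ S₃)
    (hreg : Regular X) (hU : IsUpperComparisonNhd K U) (h : HingeRigid K a b c S₁ S₂) :
    HingeRigid K c b a S₃ S₂ :=
  T.reverse.hingeRigid_of_rayRigid hreg hU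
    (T.rayRigid_reverse (T.rayRigid_of_hingeRigid h))

/-- Rigidity at one vertex implies rigidity at all vertices. -/
theorem SideTriangle.hingeRigid_all (T : SideTriangle K U a b c S₁ S₂ S₃)
    (hreg : Regular X) (hU : IsUpperComparisonNhd K U) (h : HingeRigid K a b c S₁ S₂) :
    HingeRigid K b a c S₁ S₃ ∧ HingeRigid K c a b S₂ S₃ :=
  ⟨(T.swap_right.hingeRigid_reverse hreg hU h.swap).swap,
    (T.hingeRigid_reverse hreg hU h).swap⟩

end

/-! ### Angles -/

/-- In the degenerate case z = y - x the formula for `md_sub` gives the value one, and a shorter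
opposite side increases it. -/
theorem one_le_hinge {K x y z : ℝ} (hx : InRange K x) (hy : InRange K y) (hx0 : 0 < x)
    (hy0 : 0 < y) (hz : 0 ≤ z) (h : x + z ≤ y) : 1 ≤ hingeNum K x y z / (sn K x * sn K y) := by
  have h1 := sn_pos hx hx0
  have h2 := sn_pos hy hy0
  have h3 : InRange K (y - x) := hy.mono (by linarith) (by linarith)
  have h4 := (md_le_md (h3.mono hz (by linarith)) h3).2 (by linarith : z ≤ y - x)
  rw [md_sub] at h4
  rw [one_le_div (by positivity), hingeNum]
  linarith

theorem hinge_le_neg_one {K x y z : ℝ} (hx0 : 0 < x) (hy0 : 0 < y) (hz : InRange K z)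
    (h : x + y ≤ z) : hingeNum K x y z / (sn K x * sn K y) ≤ -1 := by
  have h1 := sn_pos (hz.mono hx0.le (by linarith)) hx0
  have h2 := sn_pos (hz.mono hy0.le (by linarith)) hy0
  have h4 := (md_le_md (hz.mono (by linarith) h) hz).2 h
  rw [md_add] at h4
  rw [div_le_iff₀ (by positivity), hingeNum]
  linarith

section

variable {X : Type*} [MetricSpace X] [LorentzianPreLengthSpace X] {K : ℝ} {U : Set X}
  {x y z w a b c p q : X} {S₁ S₂ S₃ : Set X}

theorem one_le_coef_of_chron (h1 : Near K a p) (h2 : Near K a q) (h : chron a p)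
    (hpq : chron p q) : 1 ≤ coef K a p q :=
  one_le_hinge h1.inRange h2.inRange h1.ts_pos h2.ts_pos ENNReal.toReal_nonneg
    (ts_add_le h hpq h2.ne_top)

theorem one_le_coef_of_chron' (h1 : Near K a p) (h2 : Near K a q) (h : chron q p)
    (hpa : chron p a) : 1 ≤ coef K a p q := by
  have := ts_add_le h hpa h2.symm.ne_top
  rw [ts_comm q p, ts_comm p a, ts_comm q a] at this
  exact one_le_hinge h1.inRange h2.inRange h1.ts_pos h2.ts_pos ENNReal.toReal_nonneg
    (by linarith)

theorem coef_le_neg_one_of_chron (h1 : Near K a p) (h2 : Near K a q) (h3 : tauSym p q < modelDiam K)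
    (h : chron p a) (hq : chron a q) : coef K a p q ≤ -1 := by
  have := ts_add_le h hq h3.ne_top
  rw [ts_comm p a] at this
  exact hinge_le_neg_one h1.ts_pos h2.ts_pos (inRange_of_lt_modelDiam h3).1 this

theorem SideTriangle.chron_of_chron (T : SideTriangle K U a b c S₁ S₂ S₃) (h : chron a b)
    (hp : p ∈ S₁) (hpa : p ≠ a) : chron a p :=
  T.ab.chron_of_ts_lt h T.near_ab.ne_top T.ab.left_mem hp
    (by rw [T.ab.ts_self T.near_ab.ne_top]; exact T.ab.ts_pos T.near_ab.ne_top hp hpa)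

theorem SideTriangle.chron_of_chron' (T : SideTriangle K U a b c S₁ S₂ S₃) (h : chron b a)
    (hp : p ∈ S₁) (hpa : p ≠ a) : chron p a := by
  refine T.ab.symm.chron_of_ts_lt h T.near_ab.symm.ne_top hp T.ab.left_mem ?_
  have h1 := T.ab.ts_add T.near_ab.ne_top hp
  have h2 := T.ab.ts_pos T.near_ab.ne_top hp hpa
  rw [ts_comm b p, ts_comm b a]
  linarith

/-- Whether the sides at `a` have the same time direction determines the sign of the hinge
coefficients. -/
theorem SideTriangle.coef_sign (T : SideTriangle K U a b c S₁ S₂ S₃) :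
    (∀ p ∈ S₁, ∀ q ∈ S₂, p ≠ a → q ≠ a → 0 < tauSym p q → 1 ≤ coef K a p q) ∨
    (∀ p ∈ S₁, ∀ q ∈ S₂, p ≠ a → q ≠ a → 0 < tauSym p q → coef K a p q ≤ -1) := by
  rcases T.near_ab.chron_or with h1 | h1 <;> rcases T.near_ac.chron_or with h2 | h2
  · refine Or.inl fun p hp q hq hpa hqa hpq => ?_
    have n1 := T.near_left hp hpa
    have n2 := T.near_left' hq hqa
    have c1 := T.chron_of_chron h1 hp hpa
    have c2 := T.swap_right.chron_of_chron h2 hq hqa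
    rcases chron_or_of_tauSym_pos hpq with h | h
    · exact one_le_coef_of_chron n1 n2 c1 h
    · rw [coef_comm]; exact one_le_coef_of_chron n2 n1 c2 h
  · refine Or.inr fun p hp q hq hpa hqa hpq => ?_
    rw [coef_comm]
    exact coef_le_neg_one_of_chron (T.near_left' hq hqa) (T.near_left hp hpa)
      (tauSym_comm p q ▸ T.tauSym_lt hp hq) (T.swap_right.chron_of_chron' h2 hq hqa)
      (T.chron_of_chron h1 hp hpa)
  · refine Or.inr fun p hp q hq hpa hqa hpq => ?_
    exact coef_le_neg_one_of_chron (T.near_left hp hpa) (T.near_left' hq hqa)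
      (T.tauSym_lt hp hq) (T.chron_of_chron' h1 hp hpa)
      (T.swap_right.chron_of_chron h2 hq hqa)
  · refine Or.inl fun p hp q hq hpa hqa hpq => ?_
    have n1 := T.near_left hp hpa
    have n2 := T.near_left' hq hqa
    have c1 := T.chron_of_chron' h1 hp hpa
    have c2 := T.swap_right.chron_of_chron' h2 hq hqa
    rcases chron_or_of_tauSym_pos hpq with h | h
    · rw [coef_comm]; exact one_le_coef_of_chron' n2 n1 h c2
    · exact one_le_coef_of_chron' n1 n2 h c1

theorem IsTimelikeGeodesic.strictMono_ts {γ : Path x y} (h : IsTimelikeGeodesic γ)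
    (hf : tauSym x y ≠ ⊤) : StrictMono fun s => ts x (γ s) := by
  obtain ⟨h1, h2, -⟩ := h.ts_props hf
  intro s t hst
  have := h1 0 s t s.2.1 hst.le
  rw [γ.source] at this
  have := h2 s t hst
  simp only
  linarith

instance : (𝓝[>] (0 : I)).NeBot := nhdsGT_neBot_of_exists_gt ⟨1, zero_lt_one⟩

theorem SideTriangle.hasComparisonTriangle_iff {α : Path a b} {β : Path a c}
    (T : SideTriangle K U a b c (range α) (range β) S₃) {s t : I} :
    HasComparisonTriangle K a (α s) (β t) ↔ α s ≠ a ∧ β t ≠ a ∧ 0 < tauSym (α s) (β t) := by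
  constructor
  · rintro ⟨⟨a', b', c'⟩, h⟩
    have haa := T.ab.ts_self T.near_ab.ne_top
    refine ⟨fun e => ?_, fun e => ?_, ?_⟩
    · have := h.ts_pos
      rw [e, haa] at this
      exact this.false
    · have := h.swap_right.ts_pos
      rw [e, haa] at this
      exact this.false
    · rw [← h.swap_left.swap_right.tauSym_pq]
      exact h.timelike_qr
  · rintro ⟨h1, h2, h3⟩
    obtain ⟨a', b', c', h⟩ := exists_isComparisonTriangle (T.near_left (mem_range_self s) h1)
      (T.near_left' (mem_range_self t) h2)
      (T.near_of_pos (mem_range_self s) (mem_range_self t) h3)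
    exact ⟨(a', b', c'), h⟩

/-- For fixed s > 0 the point α s is timelike related to a, hence by lower semicontinuity to β t for
all small t. The limit superior in the angle is therefore not over an empty set of hinges. -/
theorem SideTriangle.neBot {α : Path a b} {β : Path a c} (hα : IsTimelikeGeodesic α)
    (hβ : IsTimelikeGeodesic β) (T : SideTriangle K U a b c (range α) (range β) S₃) :
    (𝓝[{st : I × I | HasComparisonTriangle K a (α st.1) (β st.2)}] (0, 0)).NeBot := by
  have hm₁ := hα.strictMono_ts T.near_ab.ne_top
  have hm₂ := hβ.strictMono_ts T.near_ac.ne_top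
  have hne₁ : ∀ s : I, 0 < s → α s ≠ a := fun s hs e => by
    have := hm₁ hs
    simp [e] at this
  have hne₂ : ∀ s : I, 0 < s → β s ≠ a := fun s hs e => by
    have := hm₂ hs
    simp [e] at this
  rw [← mem_closure_iff_nhdsWithin_neBot, mem_closure_iff_frequently, Filter.Frequently]
  intro hV
  rw [nhds_prod_eq] at hV
  have h1 := (hV.curry.filter_mono (nhdsWithin_le_nhds (s := Ioi 0))).and self_mem_nhdsWithin
  obtain ⟨s, hs, hs0⟩ := h1.exists
  have h2 : ∀ᶠ t in 𝓝 (0 : I), 0 < tauSym (α s) (β t) := by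
    refine ((lowerSemicontinuous_tauSym (α s)).comp β.continuous) 0 0 ?_
    change 0 < tauSym (α s) (β 0)
    rw [β.source, tauSym_comm]
    exact (T.near_left (mem_range_self s) (hne₁ s hs0)).1
  have h3 := ((hs.and h2).filter_mono (nhdsWithin_le_nhds (s := Ioi 0))).and self_mem_nhdsWithin
  obtain ⟨t, ⟨ht, ht'⟩, ht0⟩ := h3.exists
  exact ht (T.hasComparisonTriangle_iff.2 ⟨hne₁ s hs0, hne₂ t ht0, ht'⟩)

/-- The coefficient drops towards the vertex. If the sides have the same time direction it is at
least 1, so the angle is at most the comparison angle of every sub-hinge. Otherwise it is at most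
-1, its absolute value grows towards the vertex, and the angle is at least each of these comparison
angles. In both cases equality for the whole triangle leaves no room for any sub-hinge to drop. -/
theorem SideTriangle.angle_eq_iff {α : Path a b} {β : Path a c} (hα : IsTimelikeGeodesic α)
    (hβ : IsTimelikeGeodesic β) (T : SideTriangle K U a b c (range α) (range β) S₃)
    (hreg : Regular X) (hU : IsUpperComparisonNhd K U) :
    angle K α β = ENNReal.ofReal (Real.arcosh |coef K a b c|) ↔
      HingeRigid K a b c (range α) (range β) := by
  have hNB := T.neBot hα hβ
  have hm₁ := hα.strictMono_ts T.near_ab.ne_top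
  have hm₂ := hβ.strictMono_ts T.near_ac.ne_top
  have hF : (fun st : I × I => ENNReal.ofReal (comparisonAngle K a (α st.1) (β st.2)))
      =ᶠ[𝓝[{st : I × I | HasComparisonTriangle K a (α st.1) (β st.2)}] (0, 0)]
      fun st => ENNReal.ofReal (Real.arcosh |coef K a (α st.1) (β st.2)|) := by
    filter_upwards [self_mem_nhdsWithin] with st hst
    rw [comparisonAngle_eq hst, coef]
  have hlim : angle K α β = limsup
      (fun st : I × I => ENNReal.ofReal (Real.arcosh |coef K a (α st.1) (β st.2)|))
      (𝓝[{st : I × I | HasComparisonTriangle K a (α st.1) (β st.2)}] (0, 0)) :=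
    limsup_congr hF
  rw [hlim]
  constructor
  · rintro h _ ⟨s, rfl⟩ _ ⟨t, rfl⟩ hpa hqa hpq
    refine le_antisymm (T.coef_le hU (mem_range_self s) (mem_range_self t) hpa hqa) ?_
    have hs : 0 < s := unitInterval.pos_iff_ne_zero.2 fun e => hpa (by rw [e, α.source])
    have ht : 0 < t := unitInterval.pos_iff_ne_zero.2 fun e => hqa (by rw [e, β.source])
    obtain ⟨R₁, R₂, R₃, T', -, -, hR₁, hR₂⟩ :=
      T.exists_sub hreg hU (mem_range_self s) (mem_range_self t) hpa hqa hpq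
    have hev : ∀ᶠ st in 𝓝[{st : I × I | HasComparisonTriangle K a (α st.1) (β st.2)}] (0, 0),
        coef K a (α st.1) (β st.2) ≤ coef K a (α s) (β t) ∧
          HasComparisonTriangle K a (α st.1) (β st.2) := by
      have h1 : ∀ᶠ st : I × I in 𝓝 (0, 0), st.1 < s ∧ st.2 < t :=
        ((continuous_fst.tendsto (0, 0)).eventually_lt_const hs).and
          ((continuous_snd.tendsto (0, 0)).eventually_lt_const ht)
      filter_upwards [self_mem_nhdsWithin, h1.filter_mono nhdsWithin_le_nhds] with st h2 h3
      obtain ⟨k1, k2, -⟩ := T.hasComparisonTriangle_iff.1 h2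
      exact ⟨T'.coef_le hU (hR₁ _ (mem_range_self _) (hm₁ h3.1).le)
        (hR₂ _ (mem_range_self _) (hm₂ h3.2).le) k1 k2, h2⟩
    rcases T.coef_sign with hs | hs
    · have c1 := hs _ (mem_range_self s) _ (mem_range_self t) hpa hqa hpq
      have c2 := hs _ T.ab.right_mem _ T.ac.right_mem T.ne_ab T.swap_right.ne_ab T.near_bc.1
      have h2 : limsup
          (fun st : I × I => ENNReal.ofReal (Real.arcosh |coef K a (α st.1) (β st.2)|))
          (𝓝[{st : I × I | HasComparisonTriangle K a (α st.1) (β st.2)}] (0, 0)) ≤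
          ENNReal.ofReal (Real.arcosh |coef K a (α s) (β t)|) := by
        refine limsup_le_of_le (by isBoundedDefault) (hev.mono fun st ⟨h3, h4⟩ => ?_)
        obtain ⟨k1, k2, k3⟩ := T.hasComparisonTriangle_iff.1 h4
        have c3 := hs _ (mem_range_self _) _ (mem_range_self _) k1 k2 k3
        rw [abs_of_pos (by linarith), abs_of_pos (by linarith)]
        exact ENNReal.ofReal_le_ofReal
          ((Real.arcosh_le_arcosh (by linarith) (by linarith)).2 h3)
      rw [h, abs_of_pos (by linarith), abs_of_pos (by linarith),
        ENNReal.ofReal_le_ofReal_iff (Real.arcosh_nonneg c1),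
        Real.arcosh_le_arcosh (by linarith) (by linarith)] at h2
      exact h2
    · have c1 := hs _ (mem_range_self s) _ (mem_range_self t) hpa hqa hpq
      have c2 := hs _ T.ab.right_mem _ T.ac.right_mem T.ne_ab T.swap_right.ne_ab T.near_bc.1
      have h2 : ENNReal.ofReal (Real.arcosh |coef K a (α s) (β t)|) ≤ limsup
          (fun st : I × I => ENNReal.ofReal (Real.arcosh |coef K a (α st.1) (β st.2)|))
          (𝓝[{st : I × I | HasComparisonTriangle K a (α st.1) (β st.2)}] (0, 0)) := by
        refine le_limsup_of_frequently_le (hev.mono fun st ⟨h3, h4⟩ => ?_).frequently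
          (by isBoundedDefault)
        obtain ⟨k1, k2, k3⟩ := T.hasComparisonTriangle_iff.1 h4
        have c3 := hs _ (mem_range_self _) _ (mem_range_self _) k1 k2 k3
        rw [abs_of_neg (by linarith), abs_of_neg (by linarith)]
        exact ENNReal.ofReal_le_ofReal
          ((Real.arcosh_le_arcosh (by linarith) (by linarith)).2 (by linarith))
      rw [h, abs_of_neg (by linarith), abs_of_neg (by linarith),
        ENNReal.ofReal_le_ofReal_iff (Real.arcosh_nonneg (by linarith)),
        Real.arcosh_le_arcosh (by linarith) (by linarith)] at h2
      linarith
  · intro h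
    refine (limsup_congr ?_).trans (limsup_const _)
    filter_upwards [self_mem_nhdsWithin] with st hst
    obtain ⟨k1, k2, k3⟩ := T.hasComparisonTriangle_iff.1 hst
    rw [h _ (mem_range_self _) _ (mem_range_self _) k1 k2 k3]

end

/-! ### Points on segments of the model spaces -/

namespace Model

variable {K : ℝ} {o m p q r z w : Model K}

theorem left_mem_segment (h : causal p q ∨ causal q p) : p ∈ segment p q := by
  rcases h with h | h
  · exact Or.inl ⟨causal_refl p, h, by rw [Reach.tau_self, zero_add]⟩
  · exact Or.inr ⟨h, causal_refl p, by rw [Reach.tau_self, add_zero]⟩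

theorem right_mem_segment (h : causal p q ∨ causal q p) : q ∈ segment p q := by
  rw [segment_comm]; exact left_mem_segment h.symm

theorem ts_self (p : Model K) : ts p p = 0 := by simp [ts, tauSym, Reach.tau_self]

theorem Diamond.eq_of_mem_segment (hp : Diamond o m p) (hq : Diamond o m q) (hpq : 0 < ts p q)
    (hz : z ∈ segment p q) (hw : w ∈ segment p q) (h : ts p z = ts p w) : z = w := by
  have h1 := hp.vec_of_mem_segment hq hpq hz
  have h2 := hp.vec_of_mem_segment hq hpq hw
  rw [h, ← h2] at h1
  refine eq_of_vec_eq_smul (hp.of_mem_segment hq hz).reach (hp.of_mem_segment hq hw).reach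
    zero_le_one ?_
  rw [one_smul]
  exact smul_right_injective _ (sn_pos (hp.ts_eq hq).1 hpq).ne' h1

theorem Diamond.energy_of_mem_segment (hp : Diamond o m p) (hq : Diamond o m q)
    (hpq : 0 < ts p q) (hz : z ∈ segment p q) (hw : w ∈ segment p q) :
    energy z w = md K (ts p w - ts p z) := by
  have h1 := hp.hinge_of_mem_segment hq (hp.of_mem_segment hq hw) hz hpq
  have h2 := hp.hinge_of_mem_segment hq hq hw hpq
  have h3 := sn_pos (hp.ts_eq hq).1 hpq
  rw [hinge_comm p q w] at h1
  have e : hinge p q q = sn K (ts p q) ^ 2 := by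
    rw [sn_sq, ← hp.energy_eq hq hpq, hinge_self]
  have h4 : hinge p z w = sn K (ts p z) * sn K (ts p w) := by
    have h5 : hinge p w q = sn K (ts p w) * sn K (ts p q) := by
      apply mul_left_cancel₀ h3.ne'
      rw [h2, e]; ring
    apply mul_left_cancel₀ h3.ne'
    rw [h1, h5]; ring
  rw [hinge, (hp.ts_add hq hz).2.1, (hp.ts_add hq hw).2.1] at h4
  rw [md_sub]
  linear_combination -h4

theorem Diamond.ts_of_mem_segment (hp : Diamond o m p) (hq : Diamond o m q)
    (hpq : 0 < ts p q) (hz : z ∈ segment p q) (hw : w ∈ segment p q) (h : ts p z ≤ ts p w) :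
    ts z w = ts p w - ts p z := by
  have hzd := hp.of_mem_segment hq hz
  have hwd := hp.of_mem_segment hq hw
  obtain ⟨h1, -, h3⟩ := hzd.ts_eq hwd
  rw [hp.energy_of_mem_segment hq hpq hz hw, max_eq_left (md_nonneg _ _)] at h3
  exact (md_inj h1 ((hp.ts_eq hwd).1.mono (by linarith) (by
    linarith [(hp.ts_eq hzd).1.1]))).1 h3

theorem Diamond.chron_iff (hz : Diamond o m z) (hw : Diamond o m w) :
    chron z w ↔ 0 < tau z w := by
  have e1 := one_sub_chart_pos hz.reach
  have e2 := one_sub_chart_pos hw.reach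
  constructor
  · intro h
    have hR := hz.reach_of_causal hw (causal_of_chron h)
    obtain ⟨h1, h2, h3⟩ := hR.ts_eq
    rw [h2, ENNReal.ofReal_pos]
    refine h1.1.lt_of_ne fun h0 => ?_
    rw [← h0, md_zero, energy_chart hz.reach hw.reach] at h3
    obtain ⟨e5, e6⟩ := (chron_iff_chart hz.reach hw.reach).1 h
    rw [← sub_pos] at e5 e6
    exact h3.not_lt (by positivity)
  · intro h
    have hc := causal_of_tau_pos h
    obtain ⟨h1, h2, h3⟩ := (hz.reach_of_causal hw hc).ts_eq
    rw [h2, ENNReal.ofReal_pos] at h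
    have h4 := md_pos h1 h
    rw [h3, energy_chart hz.reach hw.reach] at h4
    obtain ⟨e5, e6⟩ := (causal_iff_chart hz.reach hw.reach).1 hc
    rw [chron_iff_chart hz.reach hw.reach]
    refine ⟨e5.lt_of_ne fun h0 => ?_, e6.lt_of_ne fun h0 => ?_⟩ <;> simp [h0] at h4

theorem chron_of_chron_of_causal (h : chron p q) (h' : causal q r) : chron p r := by
  rw [chron_iff_uv] at h ⊢
  rw [causal_iff_uv] at h'
  exact ⟨h.1.trans_le h'.1, h.2.trans_le h'.2⟩

/-- Geodesics of the model spaces, with their images. -/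
theorem Reach.exists_geodesic_mem (h : Reach p q) :
    ∃ c : I → Model K, c 0 = p ∧ c 1 = q ∧ Continuous (fun s => (c s).u) ∧
      Continuous (fun s => (c s).v) ∧ (∀ s t, s ≤ t → causal (c s) (c t)) ∧
      (∀ s t, s ≤ t → tau (c s) (c t) = ENNReal.ofReal (ts p (c t) - ts p (c s))) ∧
      Monotone (fun s => ts p (c s)) ∧ Continuous (fun s => energy p (c s)) ∧ ∀ s, c s ∈ segment p q := by
  obtain ⟨c, h0, h1, hu, hv, hc, ht, hm, he⟩ := h.exists_geodesic
  have dp : Diamond p q p := ⟨h, causal_refl p, h.1⟩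
  have dq : Diamond p q q := ⟨h, h.1, causal_refl q⟩
  have hmem : ∀ s, c s ∈ segment p q := fun s => by
    have e1 := ht 0 s s.2.1
    have e2 := ht s 1 s.2.2
    have e3 := hc 0 s s.2.1
    have e4 := hc s 1 s.2.2
    rw [h0, ts_self, sub_zero] at e1
    rw [h1] at e2 e4
    rw [h0] at e3
    have hs : Diamond p q (c s) := ⟨h, e3, e4⟩
    refine Or.inl ⟨e3, e4, ?_⟩
    have hle : ts p (c s) ≤ ts p q := by
      have := hm (show s ≤ 1 from s.2.2)
      simpa only [h1] using this
    rw [e1, e2, ← ENNReal.ofReal_add hs.reach.ts_eq.1.1 (by linarith), h.ts_eq.2.1]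
    congr 1
    ring
  exact ⟨c, h0, h1, hu, hv, hc, ht, hm, he, hmem⟩

/-- The causal future is closed along geodesics. -/
theorem Reach.causal_of_forall_lt (h : Reach p q) (hpq : 0 < ts p q) (hz : z ∈ segment p q)
    (hw : causal p w) (hlt : ∀ e ∈ segment p q, ts p e < ts p z → causal e w) : causal z w := by
  obtain ⟨c, h0, h1, hu, hv, hc, ht, -, he, hmem⟩ := h.exists_geodesic_mem
  have dp : Diamond p q p := ⟨h, causal_refl p, h.1⟩
  have dq : Diamond p q q := ⟨h, h.1, causal_refl q⟩
  obtain ⟨κ, hκ⟩ : ∃ κ, c κ = z := by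
    obtain ⟨-, h3, -⟩ := dp.ts_add dq hz
    have h2 := (dp.ts_add dq hz).1
    have hzd := dp.of_mem_segment dq hz
    have := intermediate_value_univ (0 : I) 1 he
    simp only [h0, h1, energy_self] at this
    obtain ⟨κ, hκ⟩ := this (show energy p z ∈ Icc _ _ by
      rw [h3, ← h.ts_eq.2.2]
      exact ⟨md_nonneg _ _, (md_le_md (dp.ts_eq hzd).1 h.ts_eq.1).2 (by
        linarith [(hzd.ts_eq dq).1.1])⟩)
    refine ⟨κ, dp.eq_of_mem_segment dq hpq (hmem κ) hz ?_⟩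
    have hcd := dp.of_mem_segment dq (hmem κ)
    rw [← md_inj (dp.ts_eq hcd).1 (dp.ts_eq hzd).1, ← (dp.ts_add dq (hmem κ)).2.1, ← h3]
    exact hκ
  have key : ∀ s ≤ κ, c s = z ∨ causal (c s) w := by
    intro s hs
    have hcz := hc s κ hs
    rw [hκ] at hcz
    have hcd := dp.of_mem_segment dq (hmem s)
    have hzd := dp.of_mem_segment dq hz
    rcases lt_or_ge (ts p (c s)) (ts p z) with h2 | h2
    · exact Or.inr (hlt _ (hmem s) h2)
    · refine Or.inl (dp.eq_of_mem_segment dq hpq (hmem s) hz (le_antisymm ?_ h2))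
      by_contra! h3
      have h4 := dp.ts_of_mem_segment dq hpq hz (hmem s) h3.le
      have h5 : causal z (c s) := by
        have : 0 < ts z (c s) := by linarith
        have h6 : 0 < tauSym z (c s) := by
          rw [(hzd.ts_eq hcd).2.1]; exact ENNReal.ofReal_pos.2 this
        by_contra h7
        have h8 : tau (c s) z = 0 := by
          have := ht s κ hs
          rw [hκ, ENNReal.ofReal_of_nonpos (by linarith)] at this
          exact this
        rw [tauSym, h8, tau_eq_zero h7] at h6
        simp at h6
      rw [causal_antisymm h5 hcz] at h3
      exact h3.false
  -- If a null coordinate of z exceeded that of w, some value strictly in between would be taken on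
  -- the curve before z. There each point is z itself or is causally before w, and neither takes
  -- this value.
  have aux : ∀ g : Model K → ℝ, Continuous (fun s => g (c s)) → g p ≤ g w →
      (∀ s, causal (c s) w → g (c s) ≤ g w) → g z ≤ g w := by
    intro g hg hgp hgw
    by_contra! hlt'
    obtain ⟨y, hy1, hy2⟩ := exists_between hlt'
    obtain ⟨s, hs, hsy⟩ := intermediate_value_Icc (show (0 : I) ≤ κ from κ.2.1) hg.continuousOn
      (show y ∈ Icc _ _ by simp only [h0, hκ]; exact ⟨hgp.trans hy1.le, hy2.le⟩)
    simp only at hsy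
    rcases key s hs.2 with h2 | h2
    · rw [h2] at hsy; linarith
    · have := hgw s h2; linarith
  rw [causal_iff_uv] at hw ⊢
  exact ⟨aux u hu hw.1 fun s hs => (causal_iff_uv.1 hs).1,
    aux v hv hw.2 fun s hs => (causal_iff_uv.1 hs).2⟩

theorem subset_conv (S : Set (Model K)) : S ⊆ conv S :=
  subset_sInter fun _ hC => hC.1

theorem segment_subset_conv {S : Set (Model K)} (hp : p ∈ conv S) (hq : q ∈ conv S)
    (h : causal p q) : segment p q ⊆ conv S :=
  subset_sInter fun C hC => hC.2 p (hp C hC) q (hq C hC) h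

end Model

/-! ### Rigidity and comparison points -/

section

variable {X : Type*} [MetricSpace X] [LorentzianPreLengthSpace X] {K : ℝ} {U : Set X}
  {x y z w a b c p q : X} {S₁ S₂ S₃ : Set X} {a' b' c' p' q' x' : Model K}

/-- At most one of τ(x, y) and τ(y, x) is nonzero when they are finite, so the upper bounds already
determine which of α, β attains the maximum. -/
theorem tau_eq_of_tauSym_eq {α β : ℝ≥0∞} (h1 : α ≤ tau x y) (h2 : β ≤ tau y x)
    (h3 : max α β = tauSym x y) (hf : tauSym x y ≠ ⊤) : α = tau x y ∧ β = tau y x := by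
  rcases (zero_le : 0 ≤ tauSym x y).eq_or_lt with h0 | h0
  · have h4 : tau x y = 0 := le_antisymm ((le_max_left _ _).trans_eq h0.symm) zero_le
    have h5 : tau y x = 0 := le_antisymm ((le_max_right _ _).trans_eq h0.symm) zero_le
    rw [h4] at h1 ⊢
    rw [h5] at h2 ⊢
    exact ⟨le_antisymm h1 zero_le, le_antisymm h2 zero_le⟩
  · rcases chron_or_of_tauSym_pos h0 with h | h
    · have h4 : tau x y ≠ ⊤ := ne_top_of_le_ne_top hf (le_max_left _ _)
      have h5 := tau_eq_zero_of_chron h h4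
      rw [h5] at h2
      have h6 : β = 0 := le_antisymm h2 zero_le
      rw [tauSym_eq_of_chron h h4, h6, max_eq_left zero_le] at h3
      exact ⟨h3, h6.trans h5.symm⟩
    · have h4 : tau y x ≠ ⊤ := ne_top_of_le_ne_top hf (le_max_right _ _)
      have h5 := tau_eq_zero_of_chron h h4
      rw [h5] at h1
      have h6 : α = 0 := le_antisymm h1 zero_le
      rw [tauSym_comm, tauSym_eq_of_chron h h4, h6, max_eq_right zero_le] at h3
      exact ⟨h6.trans h5.symm, h3⟩

/-- Comparison gives one inequality. For the other, equal coefficients identify `md` of the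
separation with the energy of the comparison points. If p and q are not timelike related there is
nothing left to show, which is why the hypothesis on coefficients is conditional. -/
theorem SideTriangle.ts_eq_of_coef_eq (T : SideTriangle K U a b c S₁ S₂ S₃)
    (hU : IsUpperComparisonNhd K U) (hT : IsComparisonTriangle a b c a' b' c')
    (hp : p ∈ S₁) (hq : q ∈ S₂) (hp' : p' ∈ Model.segment a' b')
    (hpp : tauSym a' p' = tauSym a p) (hq' : q' ∈ Model.segment a' c')
    (hqq : tauSym a' q' = tauSym a q)
    (h : p ≠ a → q ≠ a → 0 < tauSym p q → coef K a p q = coef K a b c) :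
    tauSym p' q' = tauSym p q := by
  obtain ⟨e1, e2, e3, e4, -⟩ := energy_comparison_point hT hp' hq'
  have h1 : ts a' p' = ts a p := by rw [ts, ts, hpp]
  have h2 : ts a' q' = ts a q := by rw [ts, ts, hqq]
  have hlt := T.tauSym_lt hp hq
  obtain ⟨l1, l2⟩ := T.tau_le hU hT hp hq hp' hpp hq' hqq
  have hr := inRange_of_lt_modelDiam hlt
  refine le_antisymm (max_le_max l1 l2) ?_
  rcases (zero_le : 0 ≤ tauSym p q).eq_or_lt with h0 | h0
  · rw [← h0]; exact zero_le
  rw [hr.2, e3]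
  refine ENNReal.ofReal_le_ofReal ((md_le_md hr.1 e2).1 ?_)
  refine le_trans (le_of_eq ?_) (e4.symm ▸ le_max_left _ _)
  rw [h1, h2] at e1
  have haa := T.ab.ts_self T.near_ab.ne_top
  by_cases hpa : p = a
  · subst hpa
    rw [haa, md_zero, sn_zero] at e1
    change md K (ts p q) = _
    linarith
  by_cases hqa : q = a
  · subst hqa
    rw [haa, md_zero, sn_zero] at e1
    change md K (ts p q) = _
    rw [ts_comm]
    linarith
  rw [← h hpa hqa h0, coef, hingeNum] at e1
  have h3 := (T.near_left hp hpa).sn_pos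
  have h4 := (T.near_left' hq hqa).sn_pos
  rw [mul_div_cancel₀ _ (by positivity)] at e1
  change md K (ts p q) = _
  linarith

theorem SideTriangle.tau_eq_of_coef_eq (T : SideTriangle K U a b c S₁ S₂ S₃)
    (hU : IsUpperComparisonNhd K U) (hT : IsComparisonTriangle a b c a' b' c')
    (hp : p ∈ S₁) (hq : q ∈ S₂) (hp' : p' ∈ Model.segment a' b')
    (hpp : tauSym a' p' = tauSym a p) (hq' : q' ∈ Model.segment a' c')
    (hqq : tauSym a' q' = tauSym a q)
    (h : p ≠ a → q ≠ a → 0 < tauSym p q → coef K a p q = coef K a b c) :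
    tau p' q' = tau p q ∧ tau q' p' = tau q p := by
  obtain ⟨l1, l2⟩ := T.tau_le hU hT hp hq hp' hpp hq' hqq
  exact tau_eq_of_tauSym_eq l1 l2 (T.ts_eq_of_coef_eq hU hT hp hq hp' hpp hq' hqq h)
    (T.tauSym_lt hp hq).ne_top

theorem IsComparisonTriangle.right_mem_segment (hT : IsComparisonTriangle a b c a' b' c') :
    b' ∈ Model.segment a' b' :=
  Model.right_mem_segment (causal_or_of_tauSym_pos hT.timelike_pq)

/-- A cevian has the same length as in the comparison triangle if and only if it has the same
hinge coefficient. -/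
theorem SideTriangle.tauSym_cevian_iff (T : SideTriangle K U a b c S₁ S₂ S₃)
    (hU : IsUpperComparisonNhd K U) (hT : IsComparisonTriangle a b c a' b' c')
    (hx : x ∈ S₂) (hxa : x ≠ a) (hx' : x' ∈ Model.segment a' c')
    (hxx : tauSym a' x' = tauSym a x) :
    tauSym b x = tauSym b' x' ↔ (0 < tauSym b x → coef K a b x = coef K a b c) := by
  constructor
  · intro h h0
    obtain ⟨e1, e2, e3, e4, -⟩ := energy_comparison_point hT hT.right_mem_segment hx'
    have h1 : ts b' x' = ts b x := by rw [ts, ts, h]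
    have h2 : ts a' x' = ts a x := by rw [ts, ts, hxx]
    have hn := T.near_of_pos T.ab.right_mem hx h0
    have h3 : Model.energy b' x' = md K (ts b x) := by
      have h4 := md_pos hn.inRange hn.ts_pos
      rw [← h1, e4] at h4 ⊢
      rcases max_choice (Model.energy b' x') 0 with h5 | h5 <;> rw [h5] at h4 ⊢
      exact absurd h4 (lt_irrefl _)
    rw [h3, h2, hT.ts_pq] at e1
    have h5 := T.near_ab.sn_pos
    have h6 := (T.near_left' hx hxa).sn_pos
    rw [coef, div_eq_iff (by positivity), hingeNum, e1]
    ring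
  · intro h
    exact (T.ts_eq_of_coef_eq hU hT T.ab.right_mem hx hT.right_mem_segment hT.tauSym_pq hx' hxx
      fun _ _ => h).symm

/-- The comparison condition for points on one side. -/
theorem SideTriangle.tau_eq_of_mem (T : SideTriangle K U a b c S₁ S₂ S₃)
    (hU : IsUpperComparisonNhd K U) (hT : IsComparisonTriangle a b c a' b' c')
    (hp : p ∈ S₁) (hq : q ∈ S₁) (hp' : p' ∈ Model.segment a' b')
    (hpp : ts a' p' = ts a p) (hq' : q' ∈ Model.segment a' b')
    (hqq : ts a' q' = ts a q) : tau p' q' = tau p q ∧ tau q' p' = tau q p := by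
  have hf := T.near_ab.ne_top
  obtain ⟨o, m, ha, hb, hc⟩ := hT.exists_diamond
  have hpd := ha.of_mem_segment hb hp'
  have hqd := ha.of_mem_segment hb hq'
  have conv : ∀ {p' p}, Model.Diamond o m p' → p ∈ S₁ → ts a' p' = ts a p →
      tauSym a' p' = tauSym a p := by
    intro p' p h1 h2 h3
    rw [(ha.ts_eq h1).2.1, h3, ts, ENNReal.ofReal_toReal]
    exact ne_top_of_le_ne_top hf (T.ab.tauSym_le hf T.ab.left_mem h2)
  have hl : tau p' q' ≤ tau p q ∧ tau q' p' ≤ tau q p := by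
    obtain ⟨γ₁, g1, rfl⟩ := T.ab
    obtain ⟨γ₂, g2, rfl⟩ := T.ac
    obtain ⟨γ₃, g3, rfl⟩ := T.bc
    have := hU.comparison ⟨a, b, c, γ₁, γ₂, γ₃, g1, g2, g3⟩ ⟨T.sub_ab, T.sub_ac, T.sub_bc⟩
      a' b' c' hT
    exact ⟨this p q p' q' (Or.inl ⟨hp, hp', conv hpd hp hpp⟩) (Or.inl ⟨hq, hq', conv hqd hq hqq⟩),
      this q p q' p' (Or.inl ⟨hq, hq', conv hqd hq hqq⟩) (Or.inl ⟨hp, hp', conv hpd hp hpp⟩)⟩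
  have hf' := ne_top_of_le_ne_top hf (T.ab.tauSym_le hf hp hq)
  have h0 : 0 < ts a' b' := hT.ts_pq ▸ hT.ts_pos
  have key : ts p' q' = ts p q := by
    rcases le_total (ts a p) (ts a q) with h | h
    · rw [T.ab.ts_eq_sub hf hp hq h, ha.ts_of_mem_segment hb h0 hp' hq' (by rwa [hpp, hqq]), hpp,
        hqq]
    · rw [ts_comm, ts_comm p, T.ab.ts_eq_sub hf hq hp h,
        ha.ts_of_mem_segment hb h0 hq' hp' (by rwa [hpp, hqq]), hpp, hqq]
  refine tau_eq_of_tauSym_eq hl.1 hl.2 ?_ hf'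
  change tauSym p' q' = _
  rw [(hpd.ts_eq hqd).2.1, key, ts, ENNReal.ofReal_toReal hf']

theorem SideTriangle.rayRigid_iff (T : SideTriangle K U a b c S₁ S₂ S₃)
    (hU : IsUpperComparisonNhd K U) (hT : IsComparisonTriangle a b c a' b' c') :
    RayRigid K a b c S₂ ↔ ∀ (x : X) (x' : Model K), x ≠ a → x ≠ c →
      (x ∈ S₂ ∧ x' ∈ Model.segment a' c' ∧ tauSym a' x' = tauSym a x) →
        tauSym b x = tauSym b' x' := by
  constructor
  · rintro h x x' hxa - ⟨hx, hx', hxx⟩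
    exact (T.tauSym_cevian_iff hU hT hx hxa hx' hxx).2 (h x hx hxa)
  · intro h x hx hxa hbx
    by_cases hxc : x = c
    · rw [hxc]
    obtain ⟨x', hx', hxx, -⟩ := T.swap_right.exists_comparison_point hT.swap_right hx
    exact (T.tauSym_cevian_iff hU hT hx hxa hx' hxx).1 (h x x' hxa hxc ⟨hx, hx', hxx⟩) hbx

/-- There are points close to `a` on the side `S₂` that are timelike related to `b`. -/
theorem SideTriangle.exists_tauSym_pos (T : SideTriangle K U a b c S₁ S₂ S₃) :
    ∃ x ∈ S₂, x ≠ a ∧ x ≠ c ∧ 0 < tauSym b x := by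
  have hf := T.near_ac.ne_top
  have hV : {z | 0 < tauSym b z} ∈ 𝓝 a :=
    (lowerSemicontinuous_tauSym b).isOpen_preimage 0 |>.mem_nhds T.near_ab.symm.1
  obtain ⟨ε, hε, h⟩ := T.ac.eventually_mem hf hV
  have h0 := T.near_ac.ts_pos
  have haa := T.ac.ts_self hf
  obtain ⟨r, hr0, hr⟩ := exists_between (lt_min hε h0)
  obtain ⟨x, hx, rfl⟩ := T.ac.exists_ts_eq hf hr0.le (hr.trans_le (min_le_right _ _)).le
  refine ⟨x, hx, ?_, ?_, h x hx (hr.trans_le (min_le_left _ _))⟩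
  · rintro rfl
    rw [haa] at hr0
    exact hr0.false
  · rintro rfl
    exact (hr.trans_le (min_le_right _ _)).false

theorem SideTriangle.rayRigid_iff_exists (T : SideTriangle K U a b c S₁ S₂ S₃) (hreg : Regular X)
    (hU : IsUpperComparisonNhd K U) (hT : IsComparisonTriangle a b c a' b' c') :
    RayRigid K a b c S₂ ↔ ∃ (x : X) (x' : Model K), x ≠ a ∧ x ≠ c ∧
      (x ∈ S₂ ∧ x' ∈ Model.segment a' c' ∧ tauSym a' x' = tauSym a x) ∧
        tauSym b x = tauSym b' x' ∧ 0 < tauSym b' x' := by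
  constructor
  · intro h
    obtain ⟨x, hx, hxa, hxc, h0⟩ := T.exists_tauSym_pos
    obtain ⟨x', hx', hxx, -⟩ := T.swap_right.exists_comparison_point hT.swap_right hx
    have h1 := (T.tauSym_cevian_iff hU hT hx hxa hx' hxx).2 (h x hx hxa)
    exact ⟨x, x', hxa, hxc, ⟨hx, hx', hxx⟩, h1, h1 ▸ h0⟩
  · rintro ⟨x, x', hxa, hxc, ⟨hx, hx', hxx⟩, h1, h0⟩
    exact T.rayRigid_of_coef_eq hreg hU hx hxa hxc
      ((T.tauSym_cevian_iff hU hT hx hxa hx' hxx).1 h1 (h1 ▸ h0))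

end

/-! ### Rigid triangles are ruled by geodesics starting at a vertex -/

section

variable {X : Type*} [MetricSpace X] [LorentzianPreLengthSpace X] {K : ℝ} {U : Set X}
  {x y z w v a b c p q r : X} {S₁ S₂ S₃ G : Set X} {a' b' c' p' q' r' : Model K}

/-- By push-up x and y lie in the same chronological diamonds. These generate the topology, which
separates points. -/
theorem antisymm_of_stronglyCausal (hsc : StronglyCausal X) (h : causal x y) (h' : causal y x) :
    x = y := by
  have key : ∀ {x y : X}, causal x y → causal y x → 𝓝 x ≤ 𝓝 y := by
    intro x y h h'
    have e : (UniformSpace.toTopologicalSpace : TopologicalSpace X) = _ := hsc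
    rw [e, TopologicalSpace.nhds_generateFrom, TopologicalSpace.nhds_generateFrom]
    refine le_iInf₂ fun s hs => ?_
    obtain ⟨hy, a, b, rfl⟩ := hs
    exact iInf₂_le _ ⟨⟨chron_of_chron_of_causal hy.1 h', chron_of_causal_of_chron h hy.2⟩, a, b, rfl⟩
  exact (le_antisymm (key h h') (key h' h) : 𝓝 x = 𝓝 y) |> nhds_injective

theorem StronglyCausal.continuous {α : Type*} [TopologicalSpace α] {f : α → X}
    (hsc : StronglyCausal X) (h1 : ∀ a, IsOpen {s | chron a (f s)})
    (h2 : ∀ b, IsOpen {s | chron (f s) b}) : Continuous f := by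
  have e : (UniformSpace.toTopologicalSpace : TopologicalSpace X) = _ := hsc
  rw [e, continuous_generateFrom_iff]
  rintro _ ⟨a, b, rfl⟩
  exact (h1 a).inter (h2 b)

theorem IsSide.exists_before (h : IsSide G a b) (hf : tauSym a b ≠ ⊤) (hx : x ∈ G) (hxa : x ≠ a)
    {V : Set X} (hV : V ∈ 𝓝 x) : ∃ e ∈ G, ts a e < ts a x ∧ e ∈ V := by
  obtain ⟨γ, -, rfl, hm, -⟩ := h.exists_param hf
  obtain ⟨κ, rfl⟩ := hx
  have hκ : 0 < κ := unitInterval.pos_iff_ne_zero.2 fun e => hxa (by rw [e, γ.source])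
  have : (𝓝[<] κ).NeBot := nhdsLT_neBot_of_exists_lt ⟨0, hκ⟩
  have h1 : ∀ᶠ s in 𝓝[<] κ, γ s ∈ V :=
    (γ.continuous.continuousAt.eventually hV).filter_mono nhdsWithin_le_nhds
  obtain ⟨s, hs, hs'⟩ := (h1.and self_mem_nhdsWithin).exists
  exact ⟨γ s, mem_range_self s, hm hs', hs⟩

/-- The earlier points of the geodesic converge to x inside U, where ≤ is closed. -/
theorem IsSide.causal_of_forall_lt (hUc : CausallyClosed U) (h : IsSide G a b)
    (hf : tauSym a b ≠ ⊤) (hG : G ⊆ U) (hx : x ∈ G) (hxa : x ≠ a) (hv : v ∈ U)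
    (hlt : ∀ e ∈ G, ts a e < ts a x → causal e v) : causal x v := by
  obtain ⟨γ, -, rfl, hm, -⟩ := h.exists_param hf
  obtain ⟨κ, rfl⟩ := hx
  have hκ : 0 < κ := unitInterval.pos_iff_ne_zero.2 fun e => hxa (by rw [e, γ.source])
  have : (𝓝[<] κ).NeBot := nhdsLT_neBot_of_exists_lt ⟨0, hκ⟩
  have hcl : IsClosed {s : I | causal (γ s) v} := by
    have hc : Continuous fun s : I => ((⟨γ s, hG (mem_range_self s)⟩, ⟨v, hv⟩) : U × U) := by
      fun_prop
    exact IsClosed.preimage hc hUc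
  exact hcl.mem_of_tendsto (tendsto_id.mono_left nhdsWithin_le_nhds : Tendsto id (𝓝[<] κ) (𝓝 κ))
    (by filter_upwards [self_mem_nhdsWithin] with s hs
        exact hlt _ (mem_range_self s) (hm hs))

/-- A rigid triangle is divided into rigid triangles by the geodesics starting at a vertex. -/
theorem SideTriangle.sub_rigid (T : SideTriangle K U q p r S₁ S₃ S₂) (hreg : Regular X)
    (hU : IsUpperComparisonNhd K U) (hrig : RayRigid K q p r S₃)
    (hG : ∀ y ∈ S₃, Near K p y) {G G' : Set X} {y y' : X} (hy : y ∈ S₃) (hy' : y' ∈ S₃)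
    (hyy : ts q y < ts q y') (hs : IsSide G p y) (hs' : IsSide G' p y') (hGU : G ⊆ U)
    (hGU' : G' ⊆ U) :
    ∃ R ⊆ S₃, SideTriangle K U p y y' G G' R ∧ HingeRigid K p y y' G G' := by
  have hf := T.near_ac.ne_top
  have hqq := T.ac.ts_self hf
  have hyq : y' ≠ q := by
    rintro rfl
    rw [hqq] at hyy
    exact hyy.not_ge ENNReal.toReal_nonneg
  obtain ⟨R', h1, h2, h3⟩ := T.ac.exists_initial hf hy' hyq
  have T' : SideTriangle K U q p y' S₁ R' G' :=
    ⟨T.ab, h2, hs', T.sub_ab, h1.trans T.sub_ac, hGU', T.near_ab, T.near_left' hy' hyq, hG y' hy'⟩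
  -- The coefficient at q is constant along the whole side, so cutting the triangle at y' keeps it
  -- rigid. Seen from y', a second cut at y works in the same way, and `hingeRigid_all` carries the
  -- result to p.
  have hr' : RayRigid K q p y' R' := fun x hx hxq hpx => by
    rw [hrig x (h1 hx) hxq hpx, hrig y' hy' hyq (hG y' hy').1]
  have hr := T'.rayRigid_reverse hr'
  obtain ⟨R, k1, k2, k3⟩ := h2.exists_subside T'.near_ac.ne_top (h3 y hy hyy.le) h2.right_mem hyy
  have hn : Near K y y' := by
    have h0 : 0 < ts y y' := by rw [T.ac.ts_eq_sub hf hy hy' hyy.le]; linarith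
    exact ⟨(ENNReal.toReal_pos_iff.1 h0).1, (T.ac.tauSym_le hf hy hy').trans_lt T.near_ac.2⟩
  have T'' : SideTriangle K U y' p y G' R G :=
    ⟨hs'.symm, k2.symm, hs, hGU', (k1.trans h1).trans T.sub_ac, hGU, (hG y' hy').symm, hn.symm,
      hG y hy⟩
  have hr'' : RayRigid K y' p y R := fun x hx hxy hpx => by
    rw [hr x (k1 hx) hxy hpx, hr y (k1 k2.left_mem) T''.swap_right.ne_ab (hG y hy).1]
  have h4 := (T''.hingeRigid_all hreg hU (T''.hingeRigid_of_rayRigid hreg hU hr'')).1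
  exact ⟨R, k1.trans h1, T''.swap_left.swap_right, h4.swap⟩

/-- A rigid triangle with vertices `p ≪ q ≪ r`, together with a choice of geodesics from `p` to the
points of the opposite side. -/
structure Fan (K : ℝ) (U : Set X) (p q r : X) (S₁ S₂ S₃ : Set X) (p' q' r' : Model K)
    (G : X → Set X) : Prop where
  tri : SideTriangle K U p q r S₁ S₂ S₃
  cmp : IsComparisonTriangle p q r p' q' r'
  rig : HingeRigid K p q r S₁ S₂
  pq : chron p q
  qr : chron q r
  side : ∀ y ∈ S₃, IsSide (G y) p y
  sub : ∀ y ∈ S₃, G y ⊆ U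
  eq_left : G q = S₁
  eq_right : G r = S₂

/-- The point `x` corresponds to the point `z` of the model triangle. -/
def FanRel {K : ℝ} (p q : X) (S₃ : Set X) (p' q' r' : Model K) (G : X → Set X) (z : Model K)
    (x : X) : Prop :=
  ∃ Y y, Y ∈ Model.segment q' r' ∧ y ∈ S₃ ∧ ts q' Y = ts q y ∧ z ∈ Model.segment p' Y ∧ x ∈ G y ∧
    ts p' z = ts p x

/-! ### Comparing the fan with the geodesics from the minimal model vertex -/

section Fan

variable {G : X → Set X} {Y Y' z w : Model K} {y' : X}

theorem SideTriangle.near_opposite (T : SideTriangle K U p q r S₁ S₂ S₃) (hpq : chron p q)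
    (hqr : chron q r) (hy : y ∈ S₃) : chron p y ∧ Near K p y := by
  obtain ⟨h1, h2⟩ := T.bc.causal_of_mem hqr T.near_bc.ne_top hy
  have h3 := chron_of_chron_of_causal hpq h1
  have h4 : tau p y ≤ tau p r := tau_le_of_between (causal_refl p) h2
  have h5 := (h4.trans (le_max_left _ (tau r p))).trans_lt T.near_ac.2
  have h6 := tauSym_eq_of_chron h3 h5.ne_top
  exact ⟨h3, tauSym_pos_of_chron h3, h6 ▸ h5⟩

/-- Geodesics are not known to be unique here, so the choice is fixed at q and r to be the given
sides. The filling then maps sides onto the given sides. -/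
theorem exists_fan (T : SideTriangle K U p q r S₁ S₂ S₃) (hreg : Regular X)
    (hU : IsUpperComparisonNhd K U) (hT : IsComparisonTriangle p q r p' q' r')
    (hrig : HingeRigid K p q r S₁ S₂) (hpq : chron p q) (hqr : chron q r) :
    ∃ G, Fan K U p q r S₁ S₂ S₃ p' q' r' G := by
  classical
  have h : ∀ y : X, ∃ G : Set X, (y ∈ S₃ → IsSide G p y ∧ G ⊆ U) ∧ (y = q → G = S₁) ∧
      (y = r → G = S₂) := by
    intro y
    by_cases h1 : y = q
    · subst h1
      exact ⟨S₁, fun _ => ⟨T.ab, T.sub_ab⟩, fun _ => rfl, fun h => absurd h.symm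
        T.swap_left.swap_right.ne_ab⟩
    by_cases h2 : y = r
    · subst h2
      exact ⟨S₂, fun _ => ⟨T.ac, T.sub_ac⟩, fun h => absurd h h1, fun _ => rfl⟩
    by_cases hy : y ∈ S₃
    · obtain ⟨G, hG, hs⟩ := exists_side hreg hU (T.sub_ab T.ab.left_mem) (T.sub_bc hy)
        (T.near_opposite hpq hqr hy).2
      exact ⟨G, fun _ => ⟨hs, hG⟩, fun h => absurd h h1, fun h => absurd h h2⟩
    · exact ⟨∅, fun h => absurd h hy, fun h => absurd h h1, fun h => absurd h h2⟩
  choose G hG h1 h2 using h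
  exact ⟨G, T, hT, hrig, hpq, hqr, fun y hy => (hG y hy).1, fun y hy => (hG y hy).2, h1 q rfl,
    h2 r rfl⟩

namespace Fan

theorem near (F : Fan K U p q r S₁ S₂ S₃ p' q' r' G) (hy : y ∈ S₃) : Near K p y :=
  (F.tri.near_opposite F.pq F.qr hy).2

theorem chron_of_mem (F : Fan K U p q r S₁ S₂ S₃ p' q' r' G) (hy : y ∈ S₃) : chron p y :=
  (F.tri.near_opposite F.pq F.qr hy).1

theorem reach (F : Fan K U p q r S₁ S₂ S₃ p' q' r' G) :
    Model.Reach p' r' ∧ Model.Diamond p' r' p' ∧ Model.Diamond p' r' q' ∧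
      Model.Diamond p' r' r' := by
  have h1 : causal p' q' := Model.causal_of_tau_pos (F.cmp.tau_pq ▸ (tau_pos_iff _ _).2 F.pq)
  have h2 : causal q' r' := Model.causal_of_tau_pos (F.cmp.tau_qr ▸ (tau_pos_iff _ _).2 F.qr)
  have h3 := Model.causal_trans h1 h2
  have h4 : Model.Reach p' r' :=
    Model.reach_of_tau_lt h3 ((le_max_left _ _).trans_lt F.cmp.lt_pr)
  exact ⟨h4, ⟨h4, Model.causal_refl _, h3⟩, ⟨h4, h1, h2⟩, h4, h3, Model.causal_refl _⟩

theorem tauSym_eq (F : Fan K U p q r S₁ S₂ S₃ p' q' r' G) (hY : Y ∈ Model.segment q' r')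
    (hy : y ∈ S₃) (h : ts q' Y = ts q y) : tauSym q' Y = tauSym q y := by
  obtain ⟨-, -, hq, hr⟩ := F.reach
  have hf := F.tri.near_bc.ne_top
  rw [(hq.ts_eq (hq.of_mem_segment hr hY)).2.1, h, ts, ENNReal.ofReal_toReal]
  exact ne_top_of_le_ne_top hf (F.tri.bc.tauSym_le hf F.tri.bc.left_mem hy)

theorem rigid (F : Fan K U p q r S₁ S₂ S₃ p' q' r' G) (hreg : Regular X)
    (hU : IsUpperComparisonNhd K U) : RayRigid K q p r S₃ :=
  F.tri.swap_left.rayRigid_of_hingeRigid (F.tri.hingeRigid_all hreg hU F.rig).1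

theorem tau_eq_left (F : Fan K U p q r S₁ S₂ S₃ p' q' r' G) (hreg : Regular X)
    (hU : IsUpperComparisonNhd K U) (hY : Y ∈ Model.segment q' r')
    (hy : y ∈ S₃) (h : ts q' Y = ts q y) : tau p' Y = tau p y ∧ tau Y p' = tau y p :=
  F.tri.swap_left.tau_eq_of_coef_eq hU F.cmp.swap_left F.tri.ab.left_mem hy
    F.cmp.swap_left.right_mem_segment F.cmp.swap_left.tauSym_pq hY (F.tauSym_eq hY hy h)
    fun _ hyq h0 => F.rigid hreg hU y hy hyq h0

theorem subtriangle (F : Fan K U p q r S₁ S₂ S₃ p' q' r' G) (hreg : Regular X)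
    (hU : IsUpperComparisonNhd K U) (hY : Y ∈ Model.segment q' r') (hy : y ∈ S₃)
    (h : ts q' Y = ts q y) (hY' : Y' ∈ Model.segment q' r') (hy' : y' ∈ S₃)
    (h' : ts q' Y' = ts q y') (hne : y ≠ y') :
    ∃ R, SideTriangle K U p y y' (G y) (G y') R ∧ HingeRigid K p y y' (G y) (G y') ∧
      IsComparisonTriangle p y y' p' Y Y' := by
  have hf := F.tri.near_bc.ne_top
  obtain ⟨R, hT, hR⟩ : ∃ R, SideTriangle K U p y y' (G y) (G y') R ∧
      HingeRigid K p y y' (G y) (G y') := by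
    have hr := F.rigid hreg hU
    rcases lt_trichotomy (ts q y) (ts q y') with h1 | h1 | h1
    · obtain ⟨R, -, h2, h3⟩ := F.tri.swap_left.sub_rigid hreg hU hr (fun _ hy => F.near hy) hy hy'
        h1 (F.side y hy) (F.side y' hy') (F.sub y hy) (F.sub y' hy')
      exact ⟨R, h2, h3⟩
    · exact absurd (F.tri.bc.eq_of_ts_eq hf hy hy' h1) hne
    · obtain ⟨R, -, h2, h3⟩ := F.tri.swap_left.sub_rigid hreg hU hr (fun _ hy => F.near hy) hy' hy
        h1 (F.side y' hy') (F.side y hy) (F.sub y' hy') (F.sub y hy)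
      exact ⟨R, h2.swap_right, h3.swap⟩
  refine ⟨R, hT, hR, ?_⟩
  obtain ⟨e1, e2⟩ := F.tau_eq_left hreg hU hY hy h
  obtain ⟨e3, e4⟩ := F.tau_eq_left hreg hU hY' hy' h'
  obtain ⟨e5, e6⟩ := F.tri.swap_left.swap_right.tau_eq_of_mem hU F.cmp.swap_left.swap_right
    hy hy' hY h hY' h'
  have s1 : tauSym p' Y = tauSym p y := by rw [tauSym, tauSym, e1, e2]
  have s2 : tauSym p' Y' = tauSym p y' := by rw [tauSym, tauSym, e3, e4]
  have s3 : tauSym Y Y' = tauSym y y' := by rw [tauSym, tauSym, e5, e6]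
  exact ⟨s1 ▸ hT.near_ab.1, s2 ▸ hT.near_ac.1, s3 ▸ hT.near_bc.1, s1 ▸ hT.near_ab.2,
    s2 ▸ hT.near_ac.2, s3 ▸ hT.near_bc.2, e1, e2, e3, e4, e5, e6⟩

/-- Two points on different geodesics of the fan lie on two sides of a rigid triangle at p, where
separations agree with the model. -/
theorem tau_eq (F : Fan K U p q r S₁ S₂ S₃ p' q' r' G) (hreg : Regular X)
    (hU : IsUpperComparisonNhd K U) (hz : FanRel p q S₃ p' q' r' G z x)
    (hw : FanRel p q S₃ p' q' r' G w v) : tau z w = tau x v ∧ tau w z = tau v x := by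
  obtain ⟨Y, y, hY, hy, hYy, hzY, hxy, hzx⟩ := hz
  obtain ⟨Y', y', hY', hy', hYy', hwY, hvy, hwv⟩ := hw
  obtain ⟨hR, hp, hq, hr⟩ := F.reach
  have hqr : 0 < ts q' r' := by rw [F.cmp.ts_qr]; exact F.tri.near_bc.ts_pos
  by_cases hne : y = y'
  · subst hne
    have : Y = Y' := hq.eq_of_mem_segment hr hqr hY hY' (hYy.trans hYy'.symm)
    subst this
    have hqr' : q ≠ r := F.tri.swap_left.swap_right.ne_ab.symm
    have hc := causal_of_chron _ _ F.qr
    -- If both points lie on one geodesic, any second geodesic of the fan supplies a nondegenerate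
    -- triangle to which the comparison applies.
    have key : ∃ e E, e ∈ S₃ ∧ e ≠ y ∧ E ∈ Model.segment q' r' ∧ ts q' E = ts q e := by
      have hm := Model.causal_trans hq.2.2 (Model.causal_refl r')
      by_cases h : q = y
      · exact ⟨r, r', F.tri.bc.right_mem, fun h' => hqr' (h.trans h'.symm),
          Model.right_mem_segment (Or.inl hm), F.cmp.ts_qr⟩
      · exact ⟨q, q', F.tri.bc.left_mem, h, Model.left_mem_segment (Or.inl hm), by
          rw [Model.ts_self, F.tri.bc.ts_self F.tri.near_bc.ne_top]⟩
    obtain ⟨e, E, he, hey, hE, hEe⟩ := key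
    obtain ⟨R, T, -, hT⟩ := F.subtriangle hreg hU hY hy hYy hE he hEe hey.symm
    exact T.tau_eq_of_mem hU hT hxy hvy hzY hzx hwY hwv
  · obtain ⟨R, T, hrig, hT⟩ := F.subtriangle hreg hU hY hy hYy hY' hy' hYy' hne
    have conv : ∀ {Y y z x}, Y ∈ Model.segment q' r' → y ∈ S₃ → z ∈ Model.segment p' Y →
        x ∈ G y → ts p' z = ts p x → tauSym p' z = tauSym p x := by
      intro Y y z x hY hy hz hx h
      have hf := (F.near hy).ne_top
      rw [(hp.ts_eq (hp.of_mem_segment (hq.of_mem_segment hr hY) hz)).2.1, h, ts,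
        ENNReal.ofReal_toReal]
      exact ne_top_of_le_ne_top hf ((F.side y hy).tauSym_le hf (F.side y hy).left_mem hx)
    exact T.tau_eq_of_coef_eq hU hT hxy hvy hzY (conv hY hy hzY hxy hzx) hwY
      (conv hY' hy' hwY hvy hwv) fun h1 h2 h3 => hrig x hxy v hvy h1 h2 h3

end Fan

end Fan

end

/-! ### The isometry from the filled triangle -/

section

variable {X : Type*} [MetricSpace X] [LorentzianPreLengthSpace X] {K : ℝ} {U : Set X}
  {x y v a b p q r : X} {S₁ S₂ S₃ : Set X} {p' q' r' : Model K}
  {G : X → Set X} {Y z w : Model K}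

namespace Fan

theorem mem (F : Fan K U p q r S₁ S₂ S₃ p' q' r' G) (hz : FanRel p q S₃ p' q' r' G z x) :
    x ∈ U := by
  obtain ⟨Y, y, hY, hy, hYy, hzY, hxy, hzx⟩ := hz
  exact F.sub y hy hxy

theorem diamond (F : Fan K U p q r S₁ S₂ S₃ p' q' r' G) (hz : FanRel p q S₃ p' q' r' G z x) :
    Model.Diamond p' r' z := by
  obtain ⟨Y, y, hY, hy, hYy, hzY, hxy, hzx⟩ := hz
  obtain ⟨hR, hp, hq, hr⟩ := F.reach
  exact hp.of_mem_segment (hq.of_mem_segment hr hY) hzY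

theorem causal_left_right (F : Fan K U p q r S₁ S₂ S₃ p' q' r' G)
    (hz : FanRel p q S₃ p' q' r' G z x) : causal p x ∧ causal x r := by
  obtain ⟨Y, y, hY, hy, hYy, hzY, hxy, hzx⟩ := hz
  obtain ⟨h1, h2⟩ := (F.side y hy).causal_of_mem (F.chron_of_mem hy) (F.near hy).ne_top hxy
  exact ⟨h1, causal_trans _ _ _ h2 (F.tri.bc.causal_of_mem F.qr F.tri.near_bc.ne_top hy).2⟩

theorem chron_iff (F : Fan K U p q r S₁ S₂ S₃ p' q' r' G) (hreg : Regular X)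
    (hU : IsUpperComparisonNhd K U) (hz : FanRel p q S₃ p' q' r' G z x)
    (hw : FanRel p q S₃ p' q' r' G w v) : chron x v ↔ chron z w := by
  rw [(F.diamond hz).chron_iff (F.diamond hw), (F.tau_eq hreg hU hz hw).1, tau_pos_iff]

theorem ts_left (F : Fan K U p q r S₁ S₂ S₃ p' q' r' G) (hreg : Regular X)
    (hU : IsUpperComparisonNhd K U) (hY : Y ∈ Model.segment q' r')
    (hy : y ∈ S₃) (h : ts q' Y = ts q y) : ts p' Y = ts p y := by
  obtain ⟨h1, h2⟩ := F.tau_eq_left hreg hU hY hy h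
  rw [ts, ts, tauSym, tauSym, h1, h2]

theorem exists_right (F : Fan K U p q r S₁ S₂ S₃ p' q' r' G) (hreg : Regular X)
    (hU : IsUpperComparisonNhd K U) (hY : Y ∈ Model.segment q' r')
    (hy : y ∈ S₃) (h : ts q' Y = ts q y) (hz : z ∈ Model.segment p' Y) :
    ∃ x ∈ G y, ts p' z = ts p x ∧ FanRel p q S₃ p' q' r' G z x := by
  obtain ⟨hR, hp, hq, hr⟩ := F.reach
  have hYd := hq.of_mem_segment hr hY
  have h1 := (hp.ts_add hYd hz).1
  have h2 := ((hp.of_mem_segment hYd hz).ts_eq hYd).1.1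
  obtain ⟨x, hx, hxz⟩ := (F.side y hy).exists_ts_eq (F.near hy).ne_top (r := ts p' z)
    ENNReal.toReal_nonneg (by rw [← F.ts_left hreg hU hY hy h]; linarith)
  exact ⟨x, hx, hxz.symm, Y, y, hY, hy, h, hz, hx, hxz.symm⟩

theorem exists_left (F : Fan K U p q r S₁ S₂ S₃ p' q' r' G) (hreg : Regular X)
    (hU : IsUpperComparisonNhd K U) (hY : Y ∈ Model.segment q' r')
    (hy : y ∈ S₃) (h : ts q' Y = ts q y) (hx : x ∈ G y) :
    ∃ z ∈ Model.segment p' Y, ts p' z = ts p x ∧ FanRel p q S₃ p' q' r' G z x := by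
  obtain ⟨hR, hp, hq, hr⟩ := F.reach
  have hYd := hq.of_mem_segment hr hY
  have e := F.ts_left hreg hU hY hy h
  obtain ⟨z, hz, hzx⟩ := hp.exists_mem_segment hYd (by rw [e]; exact (F.near hy).ts_pos)
    (s := ts p x) ENNReal.toReal_nonneg
    (by rw [e]; exact (F.side y hy).ts_le (F.near hy).ne_top hx)
  exact ⟨z, hz, hzx, Y, y, hY, hy, h, hz, hx, hzx⟩

theorem exists_opposite (F : Fan K U p q r S₁ S₂ S₃ p' q' r' G) (hy : y ∈ S₃) :
    ∃ Y ∈ Model.segment q' r', ts q' Y = ts q y := by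
  obtain ⟨hR, hp, hq, hr⟩ := F.reach
  exact hq.exists_mem_segment hr (by rw [F.cmp.ts_qr]; exact F.tri.near_bc.ts_pos)
    ENNReal.toReal_nonneg
    (by rw [F.cmp.ts_qr]; exact F.tri.bc.ts_le F.tri.near_bc.ne_top hy)

theorem exists_opposite' (F : Fan K U p q r S₁ S₂ S₃ p' q' r' G)
    (hY : Y ∈ Model.segment q' r') : ∃ y ∈ S₃, ts q' Y = ts q y := by
  obtain ⟨hR, hp, hq, hr⟩ := F.reach
  have h1 := (hq.ts_add hr hY).1
  have h2 := ((hq.of_mem_segment hr hY).ts_eq hr).1.1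
  obtain ⟨y, hy, h⟩ := F.tri.bc.exists_ts_eq F.tri.near_bc.ne_top (r := ts q' Y)
    ENNReal.toReal_nonneg (by rw [← F.cmp.ts_qr]; linarith)
  exact ⟨y, hy, h.symm⟩

theorem rel_opposite (F : Fan K U p q r S₁ S₂ S₃ p' q' r' G) (hreg : Regular X)
    (hU : IsUpperComparisonNhd K U) (hY : Y ∈ Model.segment q' r')
    (hy : y ∈ S₃) (h : ts q' Y = ts q y) : FanRel p q S₃ p' q' r' G Y y := by
  obtain ⟨hR, hp, hq, hr⟩ := F.reach
  exact ⟨Y, y, hY, hy, h, Model.right_mem_segment (Or.inl (hq.of_mem_segment hr hY).2.1),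
    (F.side y hy).right_mem, F.ts_left hreg hU hY hy h⟩

theorem exists_of_mem_conv (F : Fan K U p q r S₁ S₂ S₃ p' q' r' G) (hreg : Regular X)
    (hU : IsUpperComparisonNhd K U) (hz : z ∈ Model.conv {p', q', r'}) :
    ∃ x, FanRel p q S₃ p' q' r' G z x := by
  obtain ⟨hR, hp, hq, hr⟩ := F.reach
  obtain ⟨Y, hY, hzY⟩ := Model.exists_mem_segment_of_mem_filled hR
    ((hp.chron_iff hq).2 (F.cmp.tau_pq ▸ (tau_pos_iff _ _).2 F.pq))
    ((hq.chron_iff hr).2 (F.cmp.tau_qr ▸ (tau_pos_iff _ _).2 F.qr))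
    (Model.conv_subset_filled hR hq.2.1 hq.2.2 hz)
  obtain ⟨y, hy, h⟩ := F.exists_opposite' hY
  obtain ⟨x, -, -, hx⟩ := F.exists_right hreg hU hY hy h hzY
  exact ⟨x, hx⟩

/-- Equal separations give ≪ but not null relations. By push-up, x ≤ v puts all earlier points of
the geodesic through x in the past of v for ≪, and closedness of ≤ along the geodesic recovers x ≤
v. The same holds in the model, so ≤ is transferred through ≪. -/
theorem causal_iff (F : Fan K U p q r S₁ S₂ S₃ p' q' r' G) (hreg : Regular X)
    (hU : IsUpperComparisonNhd K U) (hUc : CausallyClosed U)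
    (hz : FanRel p q S₃ p' q' r' G z x) (hw : FanRel p q S₃ p' q' r' G w v) :
    causal x v ↔ causal z w := by
  have hz' := hz
  obtain ⟨Y, y, hY, hy, hYy, hzY, hxy, hzx⟩ := hz'
  obtain ⟨hR, hp, hq, hr⟩ := F.reach
  have hYd := hq.of_mem_segment hr hY
  have hch := F.chron_of_mem hy
  have hf := (F.near hy).ne_top
  constructor
  · intro h
    refine (hp.reach_of_causal hYd hYd.2.1).causal_of_forall_lt
      (by rw [F.ts_left hreg hU hY hy hYy]; exact (F.near hy).ts_pos) hzY (F.diamond hw).2.1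
      fun e he hlt => ?_
    obtain ⟨d, hd, hed, hR⟩ := F.exists_right hreg hU hY hy hYy he
    have h1 := (F.side y hy).chron_of_ts_lt hch hf hd hxy (by rwa [← hed, ← hzx])
    exact Model.causal_of_chron
      ((F.chron_iff hreg hU hR hw).1 (chron_of_chron_of_causal h1 h))
  · intro h
    by_cases hxp : x = p
    · rw [hxp]; exact (F.causal_left_right hw).1
    refine (F.side y hy).causal_of_forall_lt hUc hf (F.sub y hy) hxy hxp (F.mem hw)
      fun d hd hlt => ?_
    obtain ⟨e, he, hed, hR⟩ := F.exists_left hreg hU hY hy hYy hd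
    have h1 := (F.side y hy).chron_of_ts_lt hch hf hd hxy hlt
    exact causal_of_chron _ _ ((F.chron_iff hreg hU hR hw).2
      (Model.chron_of_chron_of_causal ((F.chron_iff hreg hU hR hz).1 h1) h))

/-- For continuity, membership of x in the future of a has to be witnessed by a matched point d
strictly before x. Only the minimal vertex has no such point, and there push-up suffices. -/
theorem exists_before (F : Fan K U p q r S₁ S₂ S₃ p' q' r' G) (hreg : Regular X)
    (hU : IsUpperComparisonNhd K U) (hz : FanRel p q S₃ p' q' r' G z x) (h : chron a x) :
    x = p ∨ ∃ e d, FanRel p q S₃ p' q' r' G e d ∧ chron e z ∧ chron a d := by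
  by_cases hxp : x = p
  · exact Or.inl hxp
  refine Or.inr ?_
  have hz' := hz
  obtain ⟨Y, y, hY, hy, hYy, hzY, hxy, hzx⟩ := hz'
  have hf := (F.near hy).ne_top
  obtain ⟨d, hd, hlt, had⟩ := (F.side y hy).exists_before hf hxy hxp
    ((isOpen_chron_right a).mem_nhds h)
  obtain ⟨e, -, -, hR⟩ := F.exists_left hreg hU hY hy hYy hd
  exact ⟨e, d, hR, (F.chron_iff hreg hU hR hz).1
    ((F.side y hy).chron_of_ts_lt (F.chron_of_mem hy) hf hd hxy hlt), had⟩

theorem exists_after (F : Fan K U p q r S₁ S₂ S₃ p' q' r' G) (hreg : Regular X)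
    (hU : IsUpperComparisonNhd K U) (hz : FanRel p q S₃ p' q' r' G z x) (h : chron x b) :
    x = r ∨ ∃ e d, FanRel p q S₃ p' q' r' G e d ∧ chron z e ∧ chron d b := by
  have hz' := hz
  obtain ⟨Y, y, hY, hy, hYy, hzY, hxy, hzx⟩ := hz'
  have key : ∀ {S : Set X} {a c : X}, IsSide S a c → chron a c → tauSym a c ≠ ⊤ → x ∈ S →
      x ≠ c → ∃ d ∈ S, chron x d ∧ chron d b := by
    intro S a c hs hac hf hx hxc
    obtain ⟨d, hd, hlt, hdb⟩ := hs.symm.exists_before (tauSym_comm a c ▸ hf) hx hxc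
      ((isOpen_chron_left b).mem_nhds h)
    refine ⟨d, hd, hs.chron_of_ts_lt hac hf hx hd ?_, hdb⟩
    have h1 := hs.ts_add hf hx
    have h2 := hs.ts_add hf hd
    rw [ts_comm c, ts_comm c] at hlt
    linarith
  by_cases hxr : x = r
  · exact Or.inl hxr
  refine Or.inr ?_
  -- At the far end of its fan geodesic x cannot be advanced along it, so the side S₃ is followed
  -- instead.
  by_cases hxy' : x = y
  · subst hxy'
    obtain ⟨d, hd, h1, h2⟩ := key F.tri.bc F.qr F.tri.near_bc.ne_top hy hxr
    obtain ⟨e, he, hed⟩ := F.exists_opposite hd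
    have hR := F.rel_opposite hreg hU he hd hed
    exact ⟨e, d, hR, (F.chron_iff hreg hU hz hR).1 h1, h2⟩
  · obtain ⟨d, hd, h1, h2⟩ := key (F.side y hy) (F.chron_of_mem hy) (F.near hy).ne_top hxy hxy'
    obtain ⟨e, -, -, hR⟩ := F.exists_left hreg hU hY hy hYy hd
    exact ⟨e, d, hR, (F.chron_iff hreg hU hz hR).1 h1, h2⟩

/-- Chronological futures and pasts form a subbasis. A matched witness moves the condition into the
model, where ≪ is open in the null coordinates. -/
theorem continuous_comp (F : Fan K U p q r S₁ S₂ S₃ p' q' r' G) (hsc : StronglyCausal X)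
    (hreg : Regular X) (hU : IsUpperComparisonNhd K U) {c : I → Model K} {g : I → X}
    (hu : Continuous fun s => (c s).u) (hv : Continuous fun s => (c s).v)
    (hg : ∀ s, FanRel p q S₃ p' q' r' G (c s) (g s)) : Continuous g := by
  have op1 : ∀ e : Model K, IsOpen {s | chron e (c s)} := fun e => by
    simp only [Model.chron_iff_uv]
    exact (isOpen_lt continuous_const hu).inter (isOpen_lt continuous_const hv)
  have op2 : ∀ e : Model K, IsOpen {s | chron (c s) e} := fun e => by
    simp only [Model.chron_iff_uv]
    exact (isOpen_lt hu continuous_const).inter (isOpen_lt hv continuous_const)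
  refine hsc.continuous (fun a => isOpen_iff_mem_nhds.2 fun s hs => ?_)
    fun b => isOpen_iff_mem_nhds.2 fun s hs => ?_
  · rcases F.exists_before hreg hU (hg s) hs with h | ⟨e, d, hR, h1, h2⟩
    · exact Eventually.of_forall fun t => chron_of_chron_of_causal (h ▸ hs)
        (F.causal_left_right (hg t)).1
    · filter_upwards [(op1 e).mem_nhds h1] with t ht
      exact chron_trans _ _ _ h2 ((F.chron_iff hreg hU hR (hg t)).2 ht)
  · rcases F.exists_after hreg hU (hg s) hs with h | ⟨e, d, hR, h1, h2⟩
    · exact Eventually.of_forall fun t => chron_of_causal_of_chron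
        (F.causal_left_right (hg t)).2 (h ▸ hs)
    · filter_upwards [(op2 e).mem_nhds h1] with t ht
      exact chron_trans _ _ _ ((F.chron_iff hreg hU (hg t) hR).2 ht) h2

end Fan

/-- An isometric filling of a triangle. -/
def IsFilling (U : Set X) (S₁ S₂ S₃ : Set X) (a' b' c' : Model K) (f : Model K → X) : Prop :=
  IsIsometryOn f (Model.conv {a', b', c'}) ∧ MapsTo f (Model.conv {a', b', c'}) U ∧
    f '' Model.segment a' b' = S₁ ∧ f '' Model.segment a' c' = S₂ ∧
    f '' Model.segment b' c' = S₃ ∧ GeodesicallyConvex (f '' Model.conv {a', b', c'})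

theorem Fan.exists_filling (F : Fan K U p q r S₁ S₂ S₃ p' q' r' G) (hsc : StronglyCausal X)
    (hreg : Regular X) (hU : IsUpperComparisonNhd K U) (hUc : CausallyClosed U) :
    ∃ f, IsFilling U S₁ S₂ S₃ p' q' r' f := by
  classical
  obtain ⟨hR, hp, hq, hr⟩ := F.reach
  -- A model point may correspond to x through several geodesics of the fan. Antisymmetry of ≤ shows
  -- that all choices agree, and the default p is never taken on the hull.
  let f : Model K → X := fun z => if h : ∃ x, FanRel p q S₃ p' q' r' G z x then h.choose else p
  have hf : ∀ {z x}, FanRel p q S₃ p' q' r' G z x → f z = x := by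
    intro z x hz
    have h : ∃ x, FanRel p q S₃ p' q' r' G z x := ⟨x, hz⟩
    have e : f z = h.choose := dif_pos h
    rw [e]
    exact antisymm_of_stronglyCausal hsc
      ((F.causal_iff hreg hU hUc h.choose_spec hz).2 (Model.causal_refl z))
      ((F.causal_iff hreg hU hUc hz h.choose_spec).2 (Model.causal_refl z))
  have hrel : ∀ {z}, z ∈ Model.conv {p', q', r'} → FanRel p q S₃ p' q' r' G z (f z) := by
    intro z hz
    obtain ⟨x, hx⟩ := F.exists_of_mem_conv hreg hU hz
    rwa [hf hx]
  have himg : ∀ {Y y}, Y ∈ Model.segment q' r' → y ∈ S₃ → ts q' Y = ts q y →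
      f '' Model.segment p' Y = G y := by
    intro Y y hY hy h
    refine Subset.antisymm ?_ fun x hx => ?_
    · rintro _ ⟨z, hz, rfl⟩
      obtain ⟨x, hx, -, hzx⟩ := F.exists_right hreg hU hY hy h hz
      rwa [hf hzx]
    · obtain ⟨z, hz, -, hzx⟩ := F.exists_left hreg hU hY hy h hx
      exact ⟨z, hz, hf hzx⟩
  have hqr := hq.2.2
  refine ⟨f, ⟨fun z hz w hw h => ?_, fun z hz w hw => ⟨(F.tau_eq hreg hU (hrel hz) (hrel hw)).1.symm,
    F.causal_iff hreg hU hUc (hrel hz) (hrel hw)⟩⟩, fun z hz => F.mem (hrel hz), ?_, ?_, ?_, ?_⟩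
  · have h1 := F.causal_iff hreg hU hUc (hrel hz) (hrel hw)
    have h2 := F.causal_iff hreg hU hUc (hrel hw) (hrel hz)
    rw [h] at h1 h2
    exact Model.causal_antisymm (h1.1 (causal_refl _)) (h2.1 (causal_refl _))
  · rw [himg (Model.left_mem_segment (Or.inl hqr)) F.tri.bc.left_mem
      (by rw [Model.ts_self, F.tri.bc.ts_self F.tri.near_bc.ne_top]), F.eq_left]
  · rw [himg (Model.right_mem_segment (Or.inl hqr)) F.tri.bc.right_mem F.cmp.ts_qr, F.eq_right]
  · refine Subset.antisymm ?_ fun y hy => ?_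
    · rintro _ ⟨Y, hY, rfl⟩
      obtain ⟨y, hy, h⟩ := F.exists_opposite' hY
      rwa [hf (F.rel_opposite hreg hU hY hy h)]
    · obtain ⟨Y, hY, h⟩ := F.exists_opposite hy
      exact ⟨Y, hY, hf (F.rel_opposite hreg hU hY hy h)⟩
  · rintro _ ⟨z, hz, rfl⟩ _ ⟨w, hw, rfl⟩ hzw
    have hzw' := (F.causal_iff hreg hU hUc (hrel hz) (hrel hw)).1 hzw
    -- Convexity of the image: the model geodesic stays in the hull, and its image is continuous,
    -- causal and has additive separation. Null related endpoints are included.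
    obtain ⟨c, h0, h1, hu, hv, hc, ht, hmono, -, hm⟩ := ((F.diamond (hrel hz)).reach_of_causal
      (F.diamond (hrel hw)) hzw').exists_geodesic_mem
    have hm' := fun s => Model.segment_subset_conv hz hw hzw' (hm s)
    have hR' := fun s => hrel (hm' s)
    refine ⟨⟨⟨fun s => f (c s), F.continuous_comp hsc hreg hU hu hv hR'⟩, congrArg f h0,
      congrArg f h1⟩, isFutureGeodesic_iff.2 ⟨fun s t hst => ?_, fun s => ?_, fun s t k hst htk => ?_⟩, ?_⟩
    · exact (F.causal_iff hreg hU hUc (hR' s) (hR' t)).2 (hc s t hst)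
    · have := (F.tau_eq hreg hU (hR' s) (hR' s)).1
      rw [Model.Reach.tau_self] at this
      exact this.symm
    · have e := fun s t => (F.tau_eq hreg hU (hR' s) (hR' t)).1.symm
      have h2 : ts z (c s) ≤ ts z (c t) := hmono hst
      have h3 : ts z (c t) ≤ ts z (c k) := hmono htk
      change tau (f (c s)) (f (c k)) = tau (f (c s)) (f (c t)) + tau (f (c t)) (f (c k))
      rw [e, e, e, ht s k (hst.trans htk), ht s t hst, ht t k htk, ← ENNReal.ofReal_add
        (by linarith) (by linarith)]
      congr 1
      ring
    · rintro _ ⟨s, rfl⟩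
      exact ⟨c s, hm' s, rfl⟩

end

/-! ### Fillings for every order of the vertices, and rigidity from a filling -/

section

variable {X : Type*} [MetricSpace X] [LorentzianPreLengthSpace X] {K : ℝ} {U : Set X}
  {a b c : X} {S₁ S₂ S₃ S : Set X} {a' b' c' : Model K} {f : Model K → X} {C : Set (Model K)}

theorem IsFilling.swap_right (h : IsFilling U S₁ S₂ S₃ a' b' c' f) :
    IsFilling U S₂ S₁ S₃ a' c' b' f := by
  obtain ⟨h1, h2, h3, h4, h5, h6⟩ := h
  rw [pair_comm] at h1 h2 h6
  rw [Model.segment_comm] at h5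
  exact ⟨h1, h2, h4, h3, h5, h6⟩

theorem IsFilling.swap_left (h : IsFilling U S₁ S₂ S₃ a' b' c' f) :
    IsFilling U S₁ S₃ S₂ b' a' c' f := by
  obtain ⟨h1, h2, h3, h4, h5, h6⟩ := h
  rw [insert_comm] at h1 h2 h6
  rw [Model.segment_comm] at h3
  exact ⟨h1, h2, h3, h5, h4, h6⟩

/-- Rigid triangles have isometric fillings. -/
theorem SideTriangle.exists_filling (T : SideTriangle K U a b c S₁ S₂ S₃) (hsc : StronglyCausal X)
    (hreg : Regular X) (hU : IsUpperComparisonNhd K U) (hUc : CausallyClosed U)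
    (hT : IsComparisonTriangle a b c a' b' c') (h : HingeRigid K a b c S₁ S₂) :
    ∃ f, IsFilling U S₁ S₂ S₃ a' b' c' f := by
  have key : ∀ {a b c : X} {S₁ S₂ S₃ : Set X} {a' b' c' : Model K},
      SideTriangle K U a b c S₁ S₂ S₃ → IsComparisonTriangle a b c a' b' c' →
      HingeRigid K a b c S₁ S₂ → chron a b → chron b c →
      ∃ f, IsFilling U S₁ S₂ S₃ a' b' c' f := by
    intro a b c S₁ S₂ S₃ a' b' c' T hT h hab hbc
    obtain ⟨G, F⟩ := exists_fan T hreg hU hT h hab hbc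
    exact F.exists_filling hsc hreg hU hUc
  have cyc : ∀ {x y z : X}, Near K x z → chron x y → chron y z → chron z x → False := by
    intro x y z h h1 h2 h3
    exact not_causal_of_chron (chron_trans _ _ _ h1 h2)
      ((le_max_left (tau x z) (tau z x)).trans_lt h.2).ne_top (causal_of_chron _ _ h3)
  obtain ⟨hb, hc⟩ := T.hingeRigid_all hreg hU h
  -- Six of the eight cases are linear orders and reduce to a ≪ b ≪ c by relabelling, with rigidity
  -- moved to the minimal vertex. The two cyclic ones contradict finiteness of τ.
  rcases T.near_ab.chron_or with c1 | c1 <;> rcases T.near_ac.chron_or with c2 | c2 <;>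
    rcases T.near_bc.chron_or with c3 | c3
  · exact key T hT h c1 c3
  · obtain ⟨f, hf⟩ := key T.swap_right hT.swap_right h.swap c2 c3
    exact ⟨f, hf.swap_right⟩
  · exact (cyc T.near_ac c1 c3 c2).elim
  · obtain ⟨f, hf⟩ := key T.swap_right.swap_left hT.swap_right.swap_left hc c2 c1
    exact ⟨f, hf.swap_left.swap_right⟩
  · obtain ⟨f, hf⟩ := key T.swap_left hT.swap_left hb c1 c2
    exact ⟨f, hf.swap_left⟩
  · exact (cyc T.near_ab c2 c3 c1).elim
  · obtain ⟨f, hf⟩ := key T.swap_left.swap_right hT.swap_left.swap_right hb.swap c3 c2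
    exact ⟨f, hf.swap_right.swap_left⟩
  · obtain ⟨f, hf⟩ := key T.reverse hT.swap_right.swap_left.swap_right hc.swap c3 c1
    exact ⟨f, hf.swap_right.swap_left.swap_right⟩

/-- An isometry that maps a segment onto a side maps the endpoints to the endpoints. -/
theorem IsIsometryOn.map_endpoints (h : IsIsometryOn f C) (hs : IsSide S a b) (hab : chron a b)
    (hf : tauSym a b ≠ ⊤) (hR : Model.Reach a' b') (hC : Model.segment a' b' ⊆ C)
    (hS : f '' Model.segment a' b' = S) : f a' = a ∧ f b' = b := by
  have da : Model.Diamond a' b' a' := ⟨hR, Model.causal_refl _, hR.1⟩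
  have db : Model.Diamond a' b' b' := ⟨hR, hR.1, Model.causal_refl _⟩
  have ha := Model.left_mem_segment (Or.inl hR.1)
  have hb := Model.right_mem_segment (Or.inl hR.1)
  have hmem : ∀ z ∈ Model.segment a' b', f z ∈ S := fun z hz => hS ▸ mem_image_of_mem f hz
  obtain ⟨z, hz, hza⟩ : a ∈ f '' Model.segment a' b' := hS ▸ hs.left_mem
  obtain ⟨w, hw, hwb⟩ : b ∈ f '' Model.segment a' b' := hS ▸ hs.right_mem
  have h1 := (hs.causal_of_mem hab hf (hmem _ ha)).1
  have h2 := (hs.causal_of_mem hab hf (hmem _ hb)).2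
  rw [← hza, (h.2 _ (hC hz) _ (hC ha)).2] at h1
  rw [← hwb, (h.2 _ (hC hb) _ (hC hw)).2] at h2
  rw [← hza, ← hwb, Model.causal_antisymm h1 (da.of_mem_segment db hz).2.1,
    Model.causal_antisymm h2 (da.of_mem_segment db hw).2.2]
  exact ⟨rfl, rfl⟩

theorem SideTriangle.map_vertices (T : SideTriangle K U a b c S₁ S₂ S₃)
    (hT : IsComparisonTriangle a b c a' b' c') (h : IsFilling U S₁ S₂ S₃ a' b' c' f) :
    f a' = a ∧ f b' = b := by
  obtain ⟨h1, -, h2, -⟩ := h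
  have hs := Model.subset_conv {a', b', c'}
  have ha : a' ∈ Model.conv {a', b', c'} := hs (by simp)
  have hb : b' ∈ Model.conv {a', b', c'} := hs (by simp)
  rcases T.near_ab.chron_or with hab | hab
  · have hc : causal a' b' := Model.causal_of_tau_pos (hT.tau_pq ▸ (tau_pos_iff _ _).2 hab)
    exact h1.map_endpoints T.ab hab T.near_ab.ne_top
      (Model.reach_of_tau_lt hc ((le_max_left _ _).trans_lt hT.lt_pq))
      (Model.segment_subset_conv ha hb hc) h2
  · have hc : causal b' a' := Model.causal_of_tau_pos (hT.tau_qp ▸ (tau_pos_iff _ _).2 hab)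
    rw [Model.segment_comm] at h2
    exact (h1.map_endpoints T.ab.symm hab T.near_ab.symm.ne_top
      (Model.reach_of_tau_lt hc ((le_max_right _ _).trans_lt hT.lt_pq))
      (Model.segment_subset_conv hb ha hc) h2).symm

/-- A point of a side is determined by its distance from a. Hence a filling, which fixes the
vertices, sends each comparison point to its original and preserves the cevian. -/
theorem SideTriangle.tauSym_eq_of_filling (T : SideTriangle K U a b c S₁ S₂ S₃)
    (hT : IsComparisonTriangle a b c a' b' c') (h : IsFilling U S₁ S₂ S₃ a' b' c' f) {x : X}
    {x' : Model K} (hx : x ∈ S₂) (hx' : x' ∈ Model.segment a' c')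
    (hxx : tauSym a' x' = tauSym a x) : tauSym b x = tauSym b' x' := by
  obtain ⟨ha, hb⟩ := T.map_vertices hT h
  have hs := Model.subset_conv {a', b', c'}
  have ha' : a' ∈ Model.conv {a', b', c'} := hs (by simp)
  have hb' : b' ∈ Model.conv {a', b', c'} := hs (by simp)
  have hc' : c' ∈ Model.conv {a', b', c'} := hs (by simp)
  have hxC : x' ∈ Model.conv {a', b', c'} := by
    rcases causal_or_of_tauSym_pos hT.timelike_pr with h1 | h1
    · exact Model.segment_subset_conv ha' hc' h1 hx'
    · rw [Model.segment_comm] at hx'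
      exact Model.segment_subset_conv hc' ha' h1 hx'
  have e : ∀ z ∈ Model.conv {a', b', c'}, ∀ w ∈ Model.conv {a', b', c'},
      tauSym (f z) (f w) = tauSym z w := fun z hz w hw => by
    rw [tauSym, tauSym, (h.1.2 z hz w hw).1, (h.1.2 w hw z hz).1]
  have h1 := e a' ha' x' hxC
  have h2 : f x' ∈ S₂ := h.2.2.2.1 ▸ mem_image_of_mem f hx'
  have h3 : f x' = x := by
    refine T.ac.eq_of_ts_eq T.near_ac.ne_top h2 hx ?_
    rw [ts, ts, ← hxx, ← h1, ha]
  rw [← h3, ← hb, e b' hb' x' hxC]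

theorem IsComparisonTriangle.near (hT : IsComparisonTriangle a b c a' b' c') : Near K a b := by
  rw [Near, ← hT.tauSym_pq]
  exact ⟨hT.timelike_pq, hT.lt_pq⟩

theorem TimelikeTriangle.sideTriangle (T : TimelikeTriangle X) (hT : T.IsIn U)
    (hT' : IsComparisonTriangle T.a T.b T.c a' b' c') :
    SideTriangle K U T.a T.b T.c (range T.ab) (range T.ac) (range T.bc) :=
  ⟨⟨_, T.geodesic_ab, rfl⟩, ⟨_, T.geodesic_ac, rfl⟩, ⟨_, T.geodesic_bc, rfl⟩, hT.1, hT.2.1, hT.2.2,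
    hT'.near, hT'.swap_right.near, hT'.swap_left.swap_right.near⟩

end

end Lorentz

end

/-! ### The equivalence of the five conditions -/

theorem proposition4p1 {X : Type*} [MetricSpace X] [Lorentz.LorentzianPreLengthSpace X]
    (hsc : Lorentz.StronglyCausal X) (hreg : Lorentz.Regular X)
    (K : ℝ) (U : Set X) (hU : Lorentz.IsUpperComparisonNhd K U) (hUc : Lorentz.CausallyClosed U)
    (T : Lorentz.TimelikeTriangle X) (hT : T.IsIn U) (a' b' c' : Lorentz.Model K)
    (hT' : Lorentz.IsComparisonTriangle T.a T.b T.c a' b' c') :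
    List.TFAE [
      Lorentz.angle K T.ab T.ac = ENNReal.ofReal (Lorentz.Model.angle a' b' c'),
      Lorentz.angle K T.ab T.ac = ENNReal.ofReal (Lorentz.Model.angle a' b' c') ∧
        Lorentz.angle K T.ab.symm T.bc = ENNReal.ofReal (Lorentz.Model.angle b' a' c') ∧
        Lorentz.angle K T.ac.symm T.bc.symm = ENNReal.ofReal (Lorentz.Model.angle c' a' b'),
      ∀ (x : X) (x' : Lorentz.Model K), x ≠ T.a → x ≠ T.c →
        Lorentz.IsComparisonPoint T.ac a' c' x x' →
          Lorentz.tauSym T.b x = Lorentz.tauSym b' x',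
      ∃ (x : X) (x' : Lorentz.Model K), x ≠ T.a ∧ x ≠ T.c ∧
        Lorentz.IsComparisonPoint T.ac a' c' x x' ∧
          Lorentz.tauSym T.b x = Lorentz.tauSym b' x' ∧ 0 < Lorentz.tauSym b' x',
      ∃ f : Lorentz.Model K → X,
        Lorentz.IsIsometryOn f (Lorentz.Model.conv {a', b', c'}) ∧
        MapsTo f (Lorentz.Model.conv {a', b', c'}) U ∧
        f '' Lorentz.Model.segment a' b' = range T.ab ∧
        f '' Lorentz.Model.segment a' c' = range T.ac ∧
        f '' Lorentz.Model.segment b' c' = range T.bc ∧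
        Lorentz.GeodesicallyConvex (f '' Lorentz.Model.conv {a', b', c'})] := by
  have S := T.sideTriangle hT hT'
  have S₁ : Lorentz.SideTriangle K U T.b T.a T.c (range T.ab.symm) (range T.bc) (range T.ac) := by
    rw [Path.symm_range]; exact S.swap_left
  have S₂ : Lorentz.SideTriangle K U T.c T.a T.b (range T.ac.symm) (range T.bc.symm)
      (range T.ab) := by
    rw [Path.symm_range, Path.symm_range]; exact S.swap_right.swap_left
  -- Rigidity at a links the conditions: the angle condition is its hinge form, and the two cevian
  -- conditions are its ray form.
  have h0 : Lorentz.HingeRigid K T.a T.b T.c (range T.ab) (range T.ac) ↔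
      Lorentz.RayRigid K T.a T.b T.c (range T.ac) := S.hingeRigid_iff hreg hU
  have h1 := S.angle_eq_iff T.geodesic_ab T.geodesic_ac hreg hU
  have h2 := S₁.angle_eq_iff T.geodesic_ab.symm T.geodesic_bc hreg hU
  have h3 := S₂.angle_eq_iff T.geodesic_ac.symm T.geodesic_bc.symm hreg hU
  simp only [Path.symm_range] at h2 h3
  have e1 := hT'.angle_eq
  have e2 := hT'.swap_left.angle_eq
  have e3 := hT'.swap_right.swap_left.angle_eq
  rw [← Lorentz.coef] at e1 e2 e3
  rw [← e1] at h1
  rw [← e2] at h2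
  rw [← e3] at h3
  tfae_have 1 → 2 := fun h => by
    obtain ⟨hb, hc⟩ := S.hingeRigid_all hreg hU (h1.1 h)
    exact ⟨h, h2.2 hb, h3.2 hc⟩
  tfae_have 2 → 1 := fun h => h.1
  tfae_have 1 ↔ 3 := (h1.trans h0).trans (S.rayRigid_iff hU hT')
  tfae_have 1 ↔ 4 := (h1.trans h0).trans (S.rayRigid_iff_exists hreg hU hT')
  tfae_have 1 → 5 := fun h => S.exists_filling hsc hreg hU hUc hT' (h1.1 h)
  tfae_have 5 → 3 := fun ⟨f, hf⟩ x x' _ _ ⟨hx, hx', hxx⟩ =>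
    S.tauSym_eq_of_filling hT' hf hx hx' hxx
  tfae_finish
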